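/- Let $dA=\frac1\pi\,d^2\zeta$ be the normalised area measure on $\mathbb{C}$. Fix $\mathcal{S}\in\mathbb{R}$, and for $N\ge 1$ put $a=a_N=1+\frac{\mathcal{S}}{2\sqrt N}$ and $Q(\zeta)=|\zeta-a|^2$. For $c>-1$ let $p^c_{j,N}$ $(j\ge 0)$ be the orthonormal polynomials, $\deg p^c_{j,N}=j$, with respect to the measure $|\zeta|^{2c}e^{-NQ(\zeta)}\,dA(\zeta)$, and let $$\widehat{\mathbf K}^c_N(\zeta,\eta)=(\zeta\bar\eta)^c e^{-\frac N2(Q(\zeta)+Q(\eta))}\sum_{j=0}^{N-1}p^c_{j,N}(\zeta)\overline{p^c_{j,N}(\eta)},\qquad \widehat K^c_N(z,w)=\frac1N\,\widehat{\mathbf K}^c_N\Big(\frac z{\sqrt N},\frac w{\sqrt N}\Big),$$ where $(\zeta\bar\eta)^c$ means $\zeta^c\,\overline{\eta^c}$ with the principal branch. Kernels are considered up to cocycles, i.e. up to multiplication by $g(z)\overline{g(w)}$ with $|g|=1$. A limiting edge kernel $\widehat K^c_{\rm edge}$ is a limit, as $N\to\infty$, of $g_N(z)\overline{g_N(w)}\,\widehat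 K_N^c(z,w)$ for some functions $g_N$ with $|g_N|=1$, where the convergence is uniform on compact subsets of $\mathbb{C}^2$ if $c\ge 0$, and of $(\mathbb{C}\setminus\{0\})^2$ if $c<0$. Write $\widehat R^c_{\rm edge}(z)=\widehat K^c_{\rm edge}(z,z)$. Then for every $c>-1$ the limiting edge kernel $\widehat K^c_{\rm edge}$ exists, and for any limiting edge kernels of charges $c$ and $c+1$ one has $\widehat R^c_{\rm edge}(w)>0$ for all $w\neq 0$ close to $0$ and $$\widehat R^{c+1}_{\rm edge}(z)=\widehat R^c_{\rm edge}(z)-\frac{|\widehat K^c_{\rm edge}(0,z)|^2}{\widehat R^c_{\rm edge}(0)}$$ for every $z\in\mathbb{C}$ (with $z\ne 0$ if $c<0$). Here the quotient stands for $\lim_{w\to 0}|\widehat K^c_{\rm edge}(w,z)|^2/\widehat R^c_{\rm edge}(w)$, which exists; this is needed for $c\neq0$, where numerator and denominator both vanish or are both infinite at $w=0$. For $c=0$ one has $\widehat R^0_{\rm edge}(0)>0$, and the formula also holds with the literal quotient. -/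

import Mathlib

open Filter Topology MeasureTheory Polynomial
open scoped ComplexConjugate

noncomputable section

namespace EdgeRecursion

/-- The normalised area measure `dA = d²ζ / π` on the complex plane. -/
def areaMeasure : Measure ℂ := ENNReal.ofReal (Real.pi⁻¹) • volume

/-- The shifted Gaussian potential `Q(ζ) = |ζ - a|²`. -/
def Q (a : ℝ) (ζ : ℂ) : ℝ := ‖ζ - (a : ℂ)‖ ^ 2

/-- The critical parameter `a`, determined by `S = 2 √N (a - 1)`. -/
def critA (S : ℝ) (N : ℕ) : ℝ := 1 + S / (2 * √(N : ℝ))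

/-- `p j` (`j = 0, 1, 2, …`) is an orthonormal polynomial of degree exactly `j` with respect to
the measure `|ζ|^{2c} e^{-N Q(ζ)} dA(ζ)`. -/
def IsOrthonormalPolys (c a : ℝ) (N : ℕ) (p : ℕ → ℂ[X]) : Prop :=
  (∀ j, (p j).degree = (j : WithBot ℕ)) ∧
  ∀ j k, ∫ ζ, (p j).eval ζ * conj ((p k).eval ζ) *
      ((‖ζ‖ ^ (2 * c) * Real.exp (-(N : ℝ) * Q a ζ) : ℝ) : ℂ) ∂areaMeasure
    = if j = k then 1 else 0

/-- The correlation kernel of the `N`-point ensemble,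
`(ζ η̄)^c e^{-N (Q(ζ) + Q(η)) / 2} ∑_{j < N} p_j(ζ) conj (p_j(η))`,
where `(ζ η̄)^c` is read as `ζ^c · conj (η^c)`. -/
def kernel (c a : ℝ) (N : ℕ) (p : ℕ → ℂ[X]) (ζ η : ℂ) : ℂ :=
  ζ ^ (c : ℂ) * conj (η ^ (c : ℂ)) *
    ((Real.exp (-((N : ℝ) / 2) * (Q a ζ + Q a η)) : ℝ) : ℂ) *
    ∑ j ∈ Finset.range N, (p j).eval ζ * conj ((p j).eval η)

/-- The kernel of the point process rescaled by `√N` at the origin. -/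
def rescaledKernel (c a : ℝ) (N : ℕ) (p : ℕ → ℂ[X]) (z w : ℂ) : ℂ :=
  (1 / (N : ℂ)) * kernel c a N p (z / ((√(N : ℝ) : ℝ) : ℂ)) (w / ((√(N : ℝ) : ℝ) : ℂ))

/-- The points at which the kernels of charge `c` are finite: the factor `|z|^c` is infinite
at the origin when `c < 0`. -/
def finiteDomain (c : ℝ) : Set ℂ := {z | z ≠ 0 ∨ 0 ≤ c}

/-- `K` is a limiting edge correlation kernel of charge `c` at the scaled parameter `S`: with
`a = 1 + S / (2 √N)`, the rescaled `N`-point kernels converge to `K` uniformly on compact sets.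
As always for correlation kernels, they are taken up to cocycles `g(z) conj (g(w))` with `|g| = 1`,
which change neither the point process nor the modulus of the kernel. -/
def IsEdgeKernel (S c : ℝ) (K : ℂ → ℂ → ℂ) : Prop :=
  ∃ p : ℕ → ℕ → ℂ[X], (∀ N, 1 ≤ N → IsOrthonormalPolys c (critA S N) N (p N)) ∧
  ∃ g : ℕ → ℂ → ℂ, (∀ N z, ‖g N z‖ = 1) ∧
  ∀ C : Set (ℂ × ℂ), IsCompact C → C ⊆ finiteDomain c ×ˢ finiteDomain c →
    TendstoUniformlyOn
      (fun (N : ℕ) (q : ℂ × ℂ) =>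
        g N q.1 * conj (g N q.2) * rescaledKernel c (critA S N) N (p N) q.1 q.2)
      (fun q => K q.1 q.2) atTop C

/-- The one-point function `R(z) = K(z, z)` of a kernel `K`; `K(z, z)` is a non-negative real
number for a limiting edge kernel `K`. -/
def onePoint (K : ℂ → ℂ → ℂ) (z : ℂ) : ℝ := (K z z).re

end EdgeRecursion

end

/-!
Up to a cocycle and a fixed factor, the rescaled kernels are the reproducing kernels `L = L^c_n` of
the spaces of functions `p(z) e^{b z}`, `deg p < n`, in `L²(|z|^{2c} e^{-|z|²} dA)`. The functions
of such a space which vanish at `0` are `z` times the functions of the space of charge `c + 1` and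
degree `n - 1`. Comparing reproducing kernels gives, already at finite level,
`z w̄ L^{c+1}_{n-1}(z, w) = L^c_n(z, w) - L^c_n(z, 0) L^c_n(0, w) / L^c_n(0, 0)`,
and the recursion is the limit of this identity on the diagonal.

For charge `0` the kernels of large degree converge, being truncated exponential series evaluated at
their transition point. For other charges they form a normal family, and a subsequential limit could
fail to be unique only through loss of mass at infinity. A sequence with bounded energy of charge
`c + 1` loses no mass in charge `c`. The deformed Weyl translations
`f ↦ e^{ā z} f((1 - ā / b) z - a)` preserve the polynomials of degree less than `n` times `e^{b z}`,
and averaging them over `a` against the density `ρ - b⁻¹ ∂ρ` raises the charge by one, while `f`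
changes as little as we like when `ρ` concentrates at `0`. Repeating this carries functions from the
limit space of one charge to that of any other.
-/

open scoped ENNReal NNReal

noncomputable section

namespace EdgeRecursion

/-! ### Fock measures -/

/-- The weight `|z|^{2c} e^{-|z|²}`, to which `|ζ|^{2c} e^{-N Q(ζ)}` reduces after rescaling by `√N`
and absorbing the shift of the Gaussian into the functions, see `expPoly`. -/
def fockWeight (c : ℝ) (z : ℂ) : ℝ := ‖z‖ ^ (2 * c) * Real.exp (-‖z‖ ^ 2)

/-- The Fock measure `|z|^{2c} e^{-|z|²} dA` of charge `c`. -/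
def fockMeasure (c : ℝ) : Measure ℂ :=
  areaMeasure.withDensity fun z => ENNReal.ofReal (fockWeight c z)

/-- The squared norm of `L²(fockMeasure c)`, with values in `[0, ∞]`. -/
def energy (c : ℝ) (f : ℂ → ℂ) : ℝ≥0∞ := ∫⁻ z, ‖f z‖ₑ ^ 2 ∂fockMeasure c

/-- The entire functions whose energy of charge `c` is at most `A`; a normal family. -/
def energyBall (c : ℝ) (A : ℝ≥0∞) : Set (ℂ → ℂ) := {f | Differentiable ℂ f ∧ energy c f ≤ A}

lemma fockWeight_nonneg (c : ℝ) (z : ℂ) : 0 ≤ fockWeight c z := by unfold fockWeight; positivity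

lemma measurable_fockWeight (c : ℝ) : Measurable (fockWeight c) := by unfold fockWeight; fun_prop

lemma fockWeight_le_rpow (c : ℝ) (z : ℂ) : fockWeight c z ≤ ‖z‖ ^ (2 * c) :=
  mul_le_of_le_one_right (by positivity) (Real.exp_le_one_iff.2 (neg_nonpos.2 (sq_nonneg _)))

lemma fockWeight_add_one (c : ℝ) {z : ℂ} (hz : z ≠ 0) :
    fockWeight (c + 1) z = ‖z‖ ^ 2 * fockWeight c z := by
  have h : 2 * (c + 1) = 2 * c + (2 : ℕ) := by push_cast; ring
  unfold fockWeight
  rw [h, Real.rpow_add_natCast (norm_ne_zero_iff.2 hz)]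
  ring

lemma exists_pos_le_fockWeight (c : ℝ) {r₁ : ℝ} (hr₁ : 0 < r₁) (r₂ : ℝ) :
    ∃ m > 0, ∀ z : ℂ, r₁ ≤ ‖z‖ → ‖z‖ ≤ r₂ → m ≤ fockWeight c z := by
  have hcont : ContinuousOn (fun r : ℝ => r ^ (2 * c) * Real.exp (-r ^ 2)) (Set.Icc r₁ r₂) :=
    (continuousOn_id.rpow_const fun r hr => Or.inl (hr₁.trans_le hr.1).ne').mul (by fun_prop)
  obtain ⟨m, hm, h⟩ := isCompact_Icc.exists_forall_le' hcont (a := 0) fun r hr => by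
    have := hr₁.trans_le hr.1
    positivity
  exact ⟨m, hm, fun z h₁ h₂ => h ‖z‖ ⟨h₁, h₂⟩⟩

lemma lintegral_areaMeasure (f : ℂ → ℝ≥0∞) :
    ∫⁻ z, f z ∂areaMeasure = ENNReal.ofReal Real.pi⁻¹ * ∫⁻ z, f z := by
  unfold areaMeasure; rw [lintegral_smul_measure, smul_eq_mul]

lemma lintegral_fockMeasure (c : ℝ) (f : ℂ → ℝ≥0∞) :
    ∫⁻ z, f z ∂fockMeasure c = ∫⁻ z, ENNReal.ofReal (fockWeight c z) * f z ∂areaMeasure :=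
  lintegral_withDensity_eq_lintegral_mul_non_measurable _
    (measurable_fockWeight c).ennreal_ofReal (Eventually.of_forall fun _ => ENNReal.ofReal_lt_top) f

lemma integral_fockMeasure (c : ℝ) (f : ℂ → ℂ) :
    ∫ z, f z ∂fockMeasure c = ∫ z, f z * ((fockWeight c z : ℝ) : ℂ) ∂areaMeasure := by
  unfold fockMeasure
  rw [integral_withDensity_eq_integral_toReal_smul (measurable_fockWeight c).ennreal_ofReal
    (Eventually.of_forall fun _ => ENNReal.ofReal_lt_top)]
  refine integral_congr_ae (Eventually.of_forall fun z => ?_)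
  simp [ENNReal.toReal_ofReal (fockWeight_nonneg c z), mul_comm]

lemma ae_ne_zero_areaMeasure : ∀ᵐ z ∂areaMeasure, z ≠ (0 : ℂ) :=
  measure_eq_zero_iff_ae_notMem.1 (by simp [areaMeasure] : areaMeasure {(0 : ℂ)} = 0)

lemma energy_id_mul (c : ℝ) (f : ℂ → ℂ) : energy c (fun z => z * f z) = energy (c + 1) f := by
  unfold energy
  rw [lintegral_fockMeasure, lintegral_fockMeasure]
  refine lintegral_congr_ae (ae_ne_zero_areaMeasure.mono fun z hz => ?_)
  simp only [fockWeight_add_one c hz, enorm_mul]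
  rw [ENNReal.ofReal_mul (by positivity), ENNReal.ofReal_pow (norm_nonneg _), ofReal_norm]
  ring

lemma integral_fockMeasure_add_one (c : ℝ) (f g : ℂ → ℂ) :
    ∫ z, f z * conj (g z) ∂fockMeasure (c + 1)
      = ∫ z, (z * f z) * conj (z * g z) ∂fockMeasure c := by
  rw [integral_fockMeasure, integral_fockMeasure]
  refine integral_congr_ae (ae_ne_zero_areaMeasure.mono fun z hz => ?_)
  simp only [fockWeight_add_one c hz, map_mul]
  push_cast
  rw [← Complex.mul_conj']
  ring

lemma lintegral_rpow_mul_exp_lt_top {c t : ℝ} (hc : -1 < c) (ht : 0 < t) :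
    ∫⁻ z : ℂ, ENNReal.ofReal (‖z‖ ^ (2 * c) * Real.exp (-t * ‖z‖ ^ 2)) < ⊤ := by
  have hint : Integrable fun z : ℂ => ‖z‖ ^ (2 * c) * Real.exp (-t * ‖z‖ ^ (2 : ℝ)) := by
    refine not_imp_comm.1 integral_undef (ne_of_gt ?_)
    have hΓ : 0 < Real.Gamma ((2 * c + 2) / 2) := Real.Gamma_pos_of_pos (by linarith)
    rw [Complex.integral_rpow_mul_exp_neg_mul_rpow (by norm_num) (by linarith) ht]
    positivity
  have hfin := (hasFiniteIntegral_iff_ofReal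
    (Eventually.of_forall fun z => by positivity)).1 hint.hasFiniteIntegral
  simpa only [Real.rpow_two] using hfin

lemma isFiniteMeasure_fockMeasure {c : ℝ} (hc : -1 < c) : IsFiniteMeasure (fockMeasure c) := by
  constructor
  rw [← setLIntegral_one, setLIntegral_univ, lintegral_fockMeasure, lintegral_areaMeasure]
  simpa [fockWeight] using
    ENNReal.mul_lt_top ENNReal.ofReal_lt_top (lintegral_rpow_mul_exp_lt_top hc one_pos)

lemma enorm_le_lintegral_circle {f : ℂ → ℂ} (hf : Differentiable ℂ f) {r : ℝ} {z : ℂ}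
    (hz : ‖z‖ + 1 ≤ r) :
    ‖f z‖ₑ ≤ ENNReal.ofReal ((2 * Real.pi)⁻¹ * r) *
      ∫⁻ θ in Set.Ioo (-Real.pi) Real.pi, ‖f (circleMap 0 r θ)‖ₑ := by
  have hr : 0 < r := by linarith [norm_nonneg z]
  have hmem : z ∈ Metric.ball (0 : ℂ) |r| := by rw [abs_of_pos hr, mem_ball_zero_iff]; linarith
  set F : ℝ → ℂ := fun θ =>
    ((circleMap 0 r θ - 0) / (circleMap 0 r θ - z)) • f (circleMap 0 r θ) with hF
  have hmean : f z = (2 * Real.pi)⁻¹ • ∫ θ in Set.Ioo (-Real.pi) Real.pi, F θ := by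
    have hper : Function.Periodic F (2 * Real.pi) := fun θ => by
      simp only [hF, periodic_circleMap 0 r θ]
    have hshift := hper.intervalIntegral_add_eq 0 (-Real.pi)
    rw [zero_add, show -Real.pi + 2 * Real.pi = Real.pi by ring] at hshift
    rw [← hf.diffContOnCl.circleAverage_smul_div hmem, Real.circleAverage_def, hshift,
      intervalIntegral.integral_of_le (by linarith [Real.pi_pos]), integral_Ioc_eq_integral_Ioo]
  have hFle : ∀ θ, ‖F θ‖ₑ ≤ ENNReal.ofReal r * ‖f (circleMap 0 r θ)‖ₑ := fun θ => by
    have hn : ‖circleMap 0 r θ‖ = r := by simp [abs_of_pos hr]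
    have hd : 1 ≤ ‖circleMap 0 r θ - z‖ := by linarith [norm_sub_norm_le (circleMap 0 r θ) z]
    rw [hF, enorm_smul, sub_zero, ← ofReal_norm, norm_div, hn]
    gcongr
    exact div_le_self hr.le hd
  rw [hmean, enorm_smul, ENNReal.ofReal_mul (by positivity), mul_assoc,
    Real.enorm_eq_ofReal (by positivity), ← lintegral_const_mul' _ _ ENNReal.ofReal_ne_top]
  gcongr
  exact (enorm_integral_le_lintegral_enorm _).trans (lintegral_mono hFle)

lemma lintegral_circleMap_le_lintegral_annulus {F : ℂ → ℝ≥0∞} (hF : Measurable F) {r₁ : ℝ}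
    (hr₁ : 1 ≤ r₁) (r₂ : ℝ) :
    ∫⁻ r in Set.Ioo r₁ r₂, ∫⁻ θ in Set.Ioo (-Real.pi) Real.pi, F (circleMap 0 r θ) ≤
      ∫⁻ z in {z : ℂ | ‖z‖ ∈ Set.Ioo r₁ r₂}, F z := by
  set A : Set ℂ := {z : ℂ | ‖z‖ ∈ Set.Ioo r₁ r₂}
  have hA : MeasurableSet A := measurable_norm measurableSet_Ioo
  have hcircle : Continuous fun p : ℝ × ℝ => circleMap 0 p.1 p.2 := by unfold circleMap; fun_prop
  have hsub : Set.Ioo r₁ r₂ ×ˢ Set.Ioo (-Real.pi) Real.pi ⊆ polarCoord.target :=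
    Set.prod_mono (fun r hr => zero_lt_one.trans_le (hr₁.trans hr.1.le)) le_rfl
  rw [← lintegral_prod (μ := volume.restrict (Set.Ioo r₁ r₂))
    (ν := volume.restrict (Set.Ioo (-Real.pi) Real.pi)) (fun p : ℝ × ℝ => F (circleMap 0 p.1 p.2))
    (hF.comp hcircle.measurable).aemeasurable, Measure.prod_restrict,
    ← lintegral_indicator hA, ← Complex.lintegral_comp_polarCoord_symm]
  refine le_trans (setLIntegral_mono' (measurableSet_Ioo.prod measurableSet_Ioo) fun p hp => ?_)
    (lintegral_mono_set hsub)
  have hp1 : 1 ≤ p.1 := hr₁.trans hp.1.1.le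
  have hpolar : Complex.polarCoord.symm p = circleMap 0 p.1 p.2 := by
    simp [circleMap, Complex.exp_mul_I, Complex.polarCoord_symm_apply]
  have hmem : circleMap 0 p.1 p.2 ∈ A := by
    have : |p.1| = p.1 := abs_of_pos (by linarith)
    simpa [A, this] using hp.1
  rw [hpolar, Set.indicator_of_mem hmem, smul_eq_mul]
  exact le_mul_of_one_le_left' (ENNReal.one_le_ofReal.2 hp1)

lemma enorm_le_lintegral_annulus {f : ℂ → ℂ} (hf : Differentiable ℂ f) {M : ℝ} {z : ℂ}
    (hz : ‖z‖ ≤ M) :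
    ‖f z‖ₑ ≤ ENNReal.ofReal ((2 * Real.pi)⁻¹ * (M + 2)) *
      ∫⁻ w in {w : ℂ | ‖w‖ ∈ Set.Ioo (M + 1) (M + 2)}, ‖f w‖ₑ := by
  have hM : 0 ≤ M := (norm_nonneg z).trans hz
  refine le_trans ?_ (mul_le_mul_right (lintegral_circleMap_le_lintegral_annulus
    hf.continuous.measurable.enorm (by linarith) (M + 2)) _)
  calc ‖f z‖ₑ = ∫⁻ _ in Set.Ioo (M + 1) (M + 2), ‖f z‖ₑ := by
        rw [setLIntegral_const, Real.volume_Ioo]; norm_num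
    _ ≤ ∫⁻ r in Set.Ioo (M + 1) (M + 2), ENNReal.ofReal ((2 * Real.pi)⁻¹ * (M + 2)) *
          ∫⁻ θ in Set.Ioo (-Real.pi) Real.pi, ‖f (circleMap 0 r θ)‖ₑ :=
        setLIntegral_mono' measurableSet_Ioo fun r hr =>
          (enorm_le_lintegral_circle (r := r) hf (by linarith [hr.1])).trans <|
            mul_le_mul_left (ENNReal.ofReal_le_ofReal
              (mul_le_mul_of_nonneg_left hr.2.le (by positivity))) _
    _ = _ := lintegral_const_mul' _ _ ENNReal.ofReal_ne_top

lemma exists_enorm_sq_le_energy (c M : ℝ) : ∃ C : ℝ≥0, ∀ f : ℂ → ℂ, Differentiable ℂ f →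
    ∀ z, ‖z‖ ≤ M → ‖f z‖ₑ ^ 2 ≤ C * energy c f := by
  rcases lt_or_ge M 0 with hM | hM
  · exact ⟨0, fun f _ z hz => absurd (norm_nonneg z) (by linarith)⟩
  obtain ⟨m, hm, hle⟩ := exists_pos_le_fockWeight c (by linarith : 0 < M + 1) (M + 2)
  set A : Set ℂ := {w | ‖w‖ ∈ Set.Ioo (M + 1) (M + 2)}
  have hA : MeasurableSet A := measurable_norm measurableSet_Ioo
  have hpos : 0 < Real.pi⁻¹ * m := by positivity
  have hannulus (f : ℂ → ℂ) :
      ENNReal.ofReal (Real.pi⁻¹ * m) * ∫⁻ w in A, ‖f w‖ₑ ^ 2 ≤ energy c f := by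
    rw [energy, lintegral_fockMeasure, lintegral_areaMeasure, ENNReal.ofReal_mul (by positivity),
      mul_assoc, ← lintegral_const_mul' _ _ ENNReal.ofReal_ne_top]
    refine mul_le_mul_right ?_ _
    refine (setLIntegral_mono' hA fun w hw => ?_).trans (setLIntegral_le_lintegral A _)
    gcongr
    exact hle w hw.1.le hw.2.le
  refine ⟨((2 * Real.pi)⁻¹ * (M + 2)).toNNReal * (Real.pi⁻¹ * m).toNNReal⁻¹, fun f hf z hz => ?_⟩
  rw [ENNReal.coe_mul, mul_assoc, ENNReal.coe_inv (by simpa using hpos)]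
  refine le_trans ?_ (mul_le_mul_right (ENNReal.mul_le_iff_le_inv
    (by simpa using hpos) ENNReal.ofReal_ne_top |>.1 (hannulus f)) _)
  change _ ≤ ENNReal.ofReal _ * _
  simpa only [Pi.pow_apply, enorm_pow] using enorm_le_lintegral_annulus (hf.pow 2) hz

lemma rpow_le_two_rpow_abs_mul {x y : ℝ} (hy : 0 < y) (hl : y / 2 ≤ x) (hu : x ≤ 2 * y) (s : ℝ) :
    x ^ s ≤ 2 ^ |s| * y ^ s := by
  have hx : 0 < x := (half_pos hy).trans_le hl
  rcases le_or_gt 0 s with h | h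
  · rw [abs_of_nonneg h, ← Real.mul_rpow zero_le_two hy.le]
    exact Real.rpow_le_rpow hx.le hu h
  · rw [abs_of_neg h, Real.rpow_neg zero_le_two, mul_comm, ← div_eq_mul_inv,
      ← Real.div_rpow hy.le zero_le_two]
    exact Real.rpow_le_rpow_of_nonpos (half_pos hy) hl h.le

lemma exists_lintegral_shift_le {c : ℝ} (hc : -1 < c) : ∃ C : ℝ≥0, ∀ a : ℂ, ‖a‖ ≤ 1 →
    ∫⁻ z in Metric.closedBall (0 : ℂ) 2, ENNReal.ofReal (‖z + a‖ ^ (2 * c)) ∂areaMeasure ≤ C := by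
  set w : ℂ → ℝ≥0∞ := fun z => ENNReal.ofReal (‖z‖ ^ (2 * c) * Real.exp (-1 * ‖z‖ ^ 2)) with hw
  have hfin : ENNReal.ofReal Real.pi⁻¹ * (ENNReal.ofReal (Real.exp 9) * ∫⁻ z, w z) ≠ ⊤ :=
    (ENNReal.mul_lt_top ENNReal.ofReal_lt_top
      (ENNReal.mul_lt_top ENNReal.ofReal_lt_top (lintegral_rpow_mul_exp_lt_top hc one_pos))).ne
  refine ⟨(ENNReal.ofReal Real.pi⁻¹ * (ENNReal.ofReal (Real.exp 9) * ∫⁻ z, w z)).toNNReal,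
    fun a ha => ?_⟩
  rw [ENNReal.coe_toNNReal hfin, ← lintegral_indicator measurableSet_closedBall,
    lintegral_areaMeasure, ← lintegral_add_right_eq_self w a,
    ← lintegral_const_mul' (ENNReal.ofReal (Real.exp 9)) _ ENNReal.ofReal_ne_top]
  refine mul_le_mul_right (lintegral_mono <| Set.indicator_le fun z hz => ?_) _
  rw [hw, ← ENNReal.ofReal_mul (by positivity), mul_left_comm, ← Real.exp_add]
  have h3 : ‖z + a‖ ≤ 3 := by linarith [norm_add_le z a, mem_closedBall_zero_iff.1 hz]
  exact ENNReal.ofReal_le_ofReal <| le_mul_of_one_le_right (by positivity) <|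
    Real.one_le_exp (by nlinarith [norm_nonneg (z + a)])

-- Near the origin `f` is bounded by its energy, so local integrability of `u` is all that matters.
lemma exists_lintegral_mul_le_energy (c : ℝ) (A B : ℝ≥0) : ∃ C : ℝ≥0, ∀ u : ℂ → ℝ≥0∞,
    Measurable u → ∫⁻ z in Metric.closedBall (0 : ℂ) 2, u z ∂areaMeasure ≤ A →
    (∀ z, 2 < ‖z‖ → u z ≤ B * ENNReal.ofReal (fockWeight c z)) →
    ∀ f : ℂ → ℂ, Differentiable ℂ f → ∫⁻ z, u z * ‖f z‖ₑ ^ 2 ∂areaMeasure ≤ C * energy c f := by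
  obtain ⟨C, hC⟩ := exists_enorm_sq_le_energy c 2
  refine ⟨A * C + B, fun u hu hA hB f hf => ?_⟩
  rw [← lintegral_add_compl _ (measurableSet_closedBall (x := (0 : ℂ)) (ε := 2)), ENNReal.coe_add,
    ENNReal.coe_mul, add_mul, mul_assoc]
  refine add_le_add ?_ ?_
  · calc ∫⁻ z in Metric.closedBall (0 : ℂ) 2, u z * ‖f z‖ₑ ^ 2 ∂areaMeasure
        ≤ ∫⁻ z in Metric.closedBall (0 : ℂ) 2, u z * (C * energy c f) ∂areaMeasure :=
          setLIntegral_mono' measurableSet_closedBall fun z hz =>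
            mul_le_mul_right (hC f hf z (mem_closedBall_zero_iff.1 hz)) _
      _ = (∫⁻ z in Metric.closedBall (0 : ℂ) 2, u z ∂areaMeasure) * (C * energy c f) :=
          lintegral_mul_const _ hu
      _ ≤ A * (C * energy c f) := mul_le_mul_left hA _
  · rw [energy, lintegral_fockMeasure, ← lintegral_const_mul' _ _ ENNReal.coe_ne_top]
    refine (setLIntegral_mono' measurableSet_closedBall.compl fun z hz => ?_).trans
      (setLIntegral_le_lintegral _ _)
    rw [← mul_assoc]
    exact mul_le_mul_left (hB z (by simpa using hz)) _

lemma exists_lintegral_shift_le_energy {c : ℝ} (hc : -1 < c) : ∃ C : ℝ≥0, ∀ a : ℂ, ‖a‖ ≤ 1 →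
    ∀ f : ℂ → ℂ, Differentiable ℂ f →
    ∫⁻ z, ENNReal.ofReal (‖z + a‖ ^ (2 * c) * Real.exp (-‖z‖ ^ 2)) * ‖f z‖ₑ ^ 2 ∂areaMeasure
      ≤ C * energy c f := by
  obtain ⟨A, hA⟩ := exists_lintegral_shift_le hc
  obtain ⟨C, hC⟩ := exists_lintegral_mul_le_energy c A (2 ^ |2 * c| : ℝ).toNNReal
  refine ⟨C, fun a ha => hC _ (by fun_prop) ?_ fun z hz => ?_⟩
  · exact (lintegral_mono fun z => ENNReal.ofReal_le_ofReal <| mul_le_of_le_one_right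
      (by positivity) (Real.exp_le_one_iff.2 (neg_nonpos.2 (sq_nonneg _)))).trans (hA a ha)
  · change _ ≤ ENNReal.ofReal _ * _
    have hl : ‖z‖ / 2 ≤ ‖z + a‖ := by linarith [norm_sub_le_norm_add z a]
    have hu : ‖z + a‖ ≤ 2 * ‖z‖ := by linarith [norm_add_le z a]
    rw [← ENNReal.ofReal_mul (by positivity), fockWeight, ← mul_assoc]
    exact ENNReal.ofReal_le_ofReal <| mul_le_mul_of_nonneg_right
      (rpow_le_two_rpow_abs_mul (by linarith) hl hu _) (Real.exp_pos _).le

lemma exists_energy_le_energy {c₁ c₂ : ℝ} (hc : -1 < c₁) (h : c₁ ≤ c₂) : ∃ C : ℝ≥0,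
    ∀ f : ℂ → ℂ, Differentiable ℂ f → energy c₁ f ≤ C * energy c₂ f := by
  obtain ⟨A, hA⟩ := exists_lintegral_shift_le hc
  obtain ⟨C, hC⟩ := exists_lintegral_mul_le_energy c₂ A 1
  refine ⟨C, fun f hf => ?_⟩
  rw [energy, lintegral_fockMeasure]
  refine hC _ (measurable_fockWeight c₁).ennreal_ofReal ?_ (fun z hz => ?_) f hf
  · refine (lintegral_mono fun z => ENNReal.ofReal_le_ofReal (fockWeight_le_rpow c₁ z)).trans ?_
    simpa using hA 0 (by simp)
  · rw [ENNReal.coe_one, one_mul]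
    exact ENNReal.ofReal_le_ofReal <| mul_le_mul_of_nonneg_right
      (Real.rpow_le_rpow_of_exponent_le (by linarith) (by linarith)) (Real.exp_pos _).le

/-! ### Normal families -/

lemma norm_sub_le_of_norm_le {f : ℂ → ℂ} (hf : Differentiable ℂ f) {B M : ℝ}
    (hB : ∀ z, ‖z‖ ≤ M + 1 → ‖f z‖ ≤ B) {z z' : ℂ} (hz : ‖z‖ ≤ M) (hz' : ‖z'‖ ≤ M) :
    ‖f z - f z'‖ ≤ B * ‖z - z'‖ := by
  refine (convex_closedBall (0 : ℂ) M).norm_image_sub_le_of_norm_deriv_le (fun x _ => hf x)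
    (fun x hx => ?_) (mem_closedBall_zero_iff.2 hz') (mem_closedBall_zero_iff.2 hz)
  refine (Complex.norm_deriv_le_of_forall_mem_sphere_norm_le one_pos hf.diffContOnCl
    fun y hy => hB y ?_).trans_eq (div_one B)
  linarith [norm_le_norm_add_norm_sub' y x, mem_sphere_iff_norm.1 hy, mem_closedBall_zero_iff.1 hx]

lemma exists_norm_le_of_mem_energyBall (c M : ℝ) {A : ℝ≥0∞} (hA : A ≠ ⊤) :
    ∃ B : ℝ, ∀ f ∈ energyBall c A, ∀ z, ‖z‖ ≤ M → ‖f z‖ ≤ B := by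
  obtain ⟨C, hC⟩ := exists_enorm_sq_le_energy c M
  have hfin : (C : ℝ≥0∞) * A ≠ ⊤ := ENNReal.mul_ne_top ENNReal.coe_ne_top hA
  refine ⟨√((C : ℝ≥0∞) * A).toReal, fun f hf z hz => Real.le_sqrt_of_sq_le ?_⟩
  have h := (hC f hf.1 z hz).trans (mul_le_mul_right hf.2 (C : ℝ≥0∞))
  simpa [ENNReal.toReal_pow] using ENNReal.toReal_mono hfin h

lemma equicontinuous_energyBall (c : ℝ) {A : ℝ≥0∞} (hA : A ≠ ⊤) :
    (energyBall c A).Equicontinuous := by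
  intro x
  obtain ⟨B, hB⟩ := exists_norm_le_of_mem_energyBall c (‖x‖ + 1 + 1) hA
  have hlim : Tendsto (fun y => B * ‖x - y‖) (𝓝 x) (𝓝 0) := by
    simpa using (Continuous.tendsto (by fun_prop : Continuous fun y => B * ‖x - y‖) x)
  refine Metric.equicontinuousAt_of_continuity_modulus _ hlim _ ?_
  filter_upwards [Metric.ball_mem_nhds x one_pos] with y hy f
  have hy' : ‖y‖ ≤ ‖x‖ + 1 := by
    linarith [norm_le_norm_add_norm_sub' y x, mem_ball_iff_norm.1 hy]
  rw [dist_eq_norm]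
  exact norm_sub_le_of_norm_le f.2.1 (hB f f.2) (by linarith) hy'

lemma tendstoLocallyUniformly_of_equicontinuous {X α ι : Type*} [TopologicalSpace X]
    [PseudoMetricSpace α] {l : Filter ι} [l.NeBot] {H : Set (X → α)} (hH : H.Equicontinuous)
    {F : ι → X → α} {f : X → α} (hF : ∀ᶠ i in l, F i ∈ H)
    (hlim : ∀ x, Tendsto (fun i => F i x) l (𝓝 (f x))) : TendstoLocallyUniformly F f l := by
  have hf : f ∈ closure H := mem_closure_of_tendsto (tendsto_pi_nhds.2 hlim) hF
  rw [Metric.tendstoLocallyUniformly_iff]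
  intro ε hε x
  refine ⟨_, Metric.equicontinuousAt_iff_right.1 (hH.closure x) (ε / 3) (by positivity), ?_⟩
  filter_upwards [hF, Metric.tendsto_nhds.1 (hlim x) (ε / 3) (by positivity)] with i hi hx y hy
  have hfy : dist (f x) (f y) < ε / 3 := hy ⟨f, hf⟩
  have hFy : dist (F i x) (F i y) < ε / 3 := hy ⟨F i, subset_closure hi⟩
  have htri := dist_triangle4 (f y) (f x) (F i x) (F i y)
  rw [dist_comm (f y) (f x), dist_comm (f x) (F i x)] at htri
  linarith

lemma exists_subseq_tendsto_of_equicontinuous {X α : Type*} [TopologicalSpace X]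
    [WeaklyLocallyCompactSpace X] [SigmaCompactSpace X] [MetricSpace α] [ProperSpace α]
    {H : Set (X → α)} (hH : H.Equicontinuous)
    (hbdd : ∀ x, Bornology.IsBounded ((fun f => f x) '' H)) {F : ℕ → X → α} (hF : ∀ n, F n ∈ H) :
    ∃ (f : X → α) (φ : ℕ → ℕ), StrictMono φ ∧
      ∀ x, Tendsto (fun n => F (φ n) x) atTop (𝓝 (f x)) := by
  set S : Set C(X, α) := {g | (g : X → α) ∈ closure H}
  have himage : ContinuousMap.toFun '' S = closure H := by
    refine Set.Subset.antisymm (Set.image_subset_iff.2 fun g hg => hg) fun g hg => ?_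
    exact ⟨⟨g, hH.closure.continuous_of_mem hg⟩, hg, rfl⟩
  have hcompact : IsCompact (closure H) :=
    (isCompact_univ_pi fun x => (hbdd x).isCompact_closure).of_isClosed_subset isClosed_closure
      (closure_minimal (fun f hf x _ => subset_closure (Set.mem_image_of_mem _ hf))
        (isClosed_set_pi fun _ _ => isClosed_closure))
  have hS : IsCompact S := ArzelaAscoli.isCompact_of_equicontinuous S (himage ▸ hcompact)
    (hH.closure.comp fun g : S => ⟨g.1, g.2⟩)
  obtain ⟨g, -, φ, hφ, hlim⟩ := hS.tendsto_subseq
    (x := fun n => ⟨F n, hH.continuous_of_mem (hF n)⟩) fun n => subset_closure (hF n)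
  exact ⟨g, φ, hφ, fun x => ((continuous_eval_const x).tendsto g).comp hlim⟩

lemma exists_subseq_tendsto_of_mem_energyBall {c : ℝ} {A : ℝ≥0∞} (hA : A ≠ ⊤) {f : ℕ → ℂ → ℂ}
    (hf : ∀ k, f k ∈ energyBall c A) : ∃ (g : ℂ → ℂ) (φ : ℕ → ℕ), StrictMono φ ∧
      ∀ z, Tendsto (fun k => f (φ k) z) atTop (𝓝 (g z)) := by
  refine exists_subseq_tendsto_of_equicontinuous (equicontinuous_energyBall c hA) (fun z => ?_) hf
  obtain ⟨B, hB⟩ := exists_norm_le_of_mem_energyBall c ‖z‖ hA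
  refine isBounded_iff_forall_norm_le.2 ⟨B, ?_⟩
  rintro _ ⟨g, hg, rfl⟩
  exact hB g hg z le_rfl

lemma tendstoLocallyUniformly_of_mem_energyBall {ι : Type*} {l : Filter ι} [l.NeBot] {c : ℝ}
    {A : ℝ≥0∞} (hA : A ≠ ⊤) {f : ι → ℂ → ℂ} {g : ℂ → ℂ} (hf : ∀ᶠ k in l, f k ∈ energyBall c A)
    (h : ∀ z, Tendsto (fun k => f k z) l (𝓝 (g z))) : TendstoLocallyUniformly f g l :=
  tendstoLocallyUniformly_of_equicontinuous (equicontinuous_energyBall c hA) hf h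

lemma lintegral_enorm_sq_le_of_tendsto {α : Type*} [MeasurableSpace α] {μ : Measure α}
    {f : ℕ → α → ℂ} {g : α → ℂ} {A : ℝ≥0∞} (hf : ∀ᶠ k in atTop, Measurable (f k))
    (hfA : ∀ᶠ k in atTop, ∫⁻ x, ‖f k x‖ₑ ^ 2 ∂μ ≤ A)
    (h : ∀ x, Tendsto (fun k => f k x) atTop (𝓝 (g x))) : ∫⁻ x, ‖g x‖ₑ ^ 2 ∂μ ≤ A := by
  obtain ⟨k₀, hk₀⟩ := eventually_atTop.1 (hf.and hfA)
  have h' (x : α) : Tendsto (fun k => ‖f (k + k₀) x‖ₑ ^ 2) atTop (𝓝 (‖g x‖ₑ ^ 2)) :=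
    ENNReal.Tendsto.pow ((tendsto_add_atTop_iff_nat k₀).2 (h x)).enorm
  calc ∫⁻ x, ‖g x‖ₑ ^ 2 ∂μ
      = ∫⁻ x, liminf (fun k => ‖f (k + k₀) x‖ₑ ^ 2) atTop ∂μ :=
        lintegral_congr fun x => (h' x).liminf_eq.symm
    _ ≤ liminf (fun k => ∫⁻ x, ‖f (k + k₀) x‖ₑ ^ 2 ∂μ) atTop :=
        lintegral_liminf_le fun k => (hk₀ _ (Nat.le_add_left _ _)).1.enorm.pow_const 2
    _ ≤ A := by
        refine liminf_le_of_le (by isBoundedDefault) fun x hx => ?_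
        obtain ⟨k, hk⟩ := hx.exists
        exact hk.trans (hk₀ _ (Nat.le_add_left _ _)).2

lemma mem_energyBall_of_tendsto {c : ℝ} {A : ℝ≥0∞} (hA : A ≠ ⊤) {f : ℕ → ℂ → ℂ} {g : ℂ → ℂ}
    (hf : ∀ᶠ k in atTop, f k ∈ energyBall c A)
    (h : ∀ z, Tendsto (fun k => f k z) atTop (𝓝 (g z))) : g ∈ energyBall c A := by
  refine ⟨?_, lintegral_enorm_sq_le_of_tendsto (hf.mono fun k hk => hk.1.continuous.measurable)
    (hf.mono fun k hk => hk.2) h⟩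
  have hlu := tendstoLocallyUniformlyOn_univ.2 (tendstoLocallyUniformly_of_mem_energyBall hA hf h)
  exact differentiableOn_univ.1
    (hlu.differentiableOn (hf.mono fun k hk => hk.1.differentiableOn) isOpen_univ)

/-! ### Tightness -/

lemma sq_lintegral_mul_le {α : Type*} [MeasurableSpace α] (μ : Measure α) {u v : α → ℝ≥0∞}
    (hu : AEMeasurable u μ) (hv : AEMeasurable v μ) :
    (∫⁻ x, u x * v x ∂μ) ^ 2 ≤ (∫⁻ x, u x ^ 2 ∂μ) * ∫⁻ x, v x ^ 2 ∂μ := by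
  have h := pow_le_pow_left' (ENNReal.lintegral_mul_le_Lp_mul_Lq μ .two_two hu hv) 2
  have hsqrt (x : ℝ≥0∞) : (x ^ (1 / 2 : ℝ)) ^ 2 = x := by
    rw [← ENNReal.rpow_natCast, ← ENNReal.rpow_mul]; norm_num
  simpa [mul_pow, hsqrt, ← one_div] using h

lemma sq_lintegral_enorm_mul_conj_le {α : Type*} [MeasurableSpace α] (μ : Measure α) {f g : α → ℂ}
    (hf : AEMeasurable f μ) (hg : AEMeasurable g μ) :
    (∫⁻ x, ‖f x * conj (g x)‖ₑ ∂μ) ^ 2 ≤ (∫⁻ x, ‖f x‖ₑ ^ 2 ∂μ) * ∫⁻ x, ‖g x‖ₑ ^ 2 ∂μ := by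
  simpa using sq_lintegral_mul_le μ hf.enorm hg.enorm

lemma sq_enorm_integral_mul_conj_le {α : Type*} [MeasurableSpace α] (μ : Measure α) {f g : α → ℂ}
    (hf : AEMeasurable f μ) (hg : AEMeasurable g μ) :
    ‖∫ x, f x * conj (g x) ∂μ‖ₑ ^ 2 ≤ (∫⁻ x, ‖f x‖ₑ ^ 2 ∂μ) * ∫⁻ x, ‖g x‖ₑ ^ 2 ∂μ :=
  (pow_le_pow_left' (enorm_integral_le_lintegral_enorm _) 2).trans
    (sq_lintegral_enorm_mul_conj_le μ hf hg)

lemma integrable_mul_conj {α : Type*} [MeasurableSpace α] {μ : Measure α} {f g : α → ℂ}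
    (hf : AEMeasurable f μ) (hg : AEMeasurable g μ) (hf' : ∫⁻ x, ‖f x‖ₑ ^ 2 ∂μ ≠ ⊤)
    (hg' : ∫⁻ x, ‖g x‖ₑ ^ 2 ∂μ ≠ ⊤) : Integrable (fun x => f x * conj (g x)) μ := by
  refine ⟨(hf.mul (Complex.continuous_conj.measurable.comp_aemeasurable hg)).aestronglyMeasurable,
    ?_⟩
  have h := (sq_lintegral_enorm_mul_conj_le μ hf hg).trans_lt
    (ENNReal.mul_lt_top hf'.lt_top hg'.lt_top)
  exact (ENNReal.pow_lt_top_iff.1 h).resolve_right two_ne_zero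

/-- A sequence is tight in `L²(fockMeasure c)` if it loses no mass at infinity. -/
def Tight (c : ℝ) (f : ℕ → ℂ → ℂ) : Prop :=
  ∀ η : ℝ≥0∞, 0 < η → ∃ M : ℝ, ∀ᶠ k in atTop,
    ∫⁻ z in (Metric.closedBall (0 : ℂ) M)ᶜ, ‖f k z‖ₑ ^ 2 ∂fockMeasure c ≤ η

lemma tight_const {c : ℝ} {f : ℂ → ℂ} (hf : energy c f ≠ ⊤) : Tight c fun _ => f := by
  intro η hη
  set s : ℕ → Set ℂ := fun n => (Metric.closedBall (0 : ℂ) n)ᶜ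
  have hs (n : ℕ) : MeasurableSet (s n) := measurableSet_closedBall.compl
  have hanti : Antitone s := fun m n hmn =>
    Set.compl_subset_compl.2 (Metric.closedBall_subset_closedBall (Nat.cast_le.2 hmn))
  have hinter : ⋂ n, s n = ∅ := by
    rw [← Set.compl_iUnion, Metric.iUnion_closedBall_nat, Set.compl_univ]
  have hlim := tendsto_measure_iInter_atTop
    (μ := (fockMeasure c).withDensity fun z => ‖f z‖ₑ ^ 2)
    (fun n => (hs n).nullMeasurableSet) hanti ⟨0, by
      rw [withDensity_apply _ (hs 0)]
      exact ne_top_of_le_ne_top hf (setLIntegral_le_lintegral _ _)⟩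
  rw [hinter, measure_empty] at hlim
  obtain ⟨n, hn⟩ := (ENNReal.tendsto_nhds_zero.1 hlim η hη).exists
  rw [Function.comp_apply, withDensity_apply _ (hs n)] at hn
  exact ⟨n, Eventually.of_forall fun _ => hn⟩

-- Raising the charge by one inserts `|z|²` in the energy, so Markov's inequality applies.
lemma tight_of_energy_add_one_le {c : ℝ} {A : ℝ≥0∞} (hA : A ≠ ⊤) {f : ℕ → ℂ → ℂ}
    (hf : ∀ᶠ k in atTop, energy (c + 1) (f k) ≤ A) : Tight c f := by
  intro η hη
  have hlim : Tendsto (fun n : ℕ => A / (n : ℝ≥0∞)) atTop (𝓝 0) := by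
    simpa using ENNReal.Tendsto.const_div (a := A) ENNReal.tendsto_nat_nhds_top (Or.inr hA)
  obtain ⟨n, hn, hn1⟩ :=
    ((ENNReal.tendsto_nhds_zero.1 hlim η hη).and (eventually_ge_atTop 1)).exists
  refine ⟨n, hf.mono fun k hk => le_trans ?_ hn⟩
  rw [ENNReal.le_div_iff_mul_le (Or.inl (by simp; omega)) (Or.inl (ENNReal.natCast_ne_top n)),
    ← lintegral_mul_const' _ _ (ENNReal.natCast_ne_top n)]
  refine le_trans ((setLIntegral_mono' measurableSet_closedBall.compl fun z hz => ?_).trans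
    (setLIntegral_le_lintegral _ _)) ((energy_id_mul c (f k)).trans_le hk)
  have hz' : (n : ℝ) < ‖z‖ := by simpa using hz
  have hn1' : (1 : ℝ) ≤ n := by exact_mod_cast hn1
  rw [enorm_mul, mul_pow, mul_comm, ← ofReal_norm z, ← ENNReal.ofReal_pow (norm_nonneg _),
    ← ENNReal.ofReal_natCast]
  exact mul_le_mul_left (ENNReal.ofReal_le_ofReal (by nlinarith)) _

lemma tendsto_setLIntegral_enorm_sub {α E ι : Type*} [MeasurableSpace α] [NormedAddCommGroup E]
    {μ : Measure α} [IsFiniteMeasure μ] {l : Filter ι} {s : Set α} (hs : MeasurableSet s)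
    {h : ι → α → E} {h₀ : α → E} (hu : TendstoUniformlyOn h h₀ l s) :
    Tendsto (fun k => ∫⁻ x in s, ‖h k x - h₀ x‖ₑ ∂μ) l (𝓝 0) := by
  rw [ENNReal.tendsto_nhds_zero]
  intro ε hε
  obtain ⟨δ, hδ, hδε⟩ : ∃ δ : ℝ≥0, 0 < δ ∧ δ * μ s ≤ ε := by
    obtain ⟨δ, hδ, h⟩ := ENNReal.exists_nnreal_pos_mul_lt (measure_ne_top μ s) hε.ne'
    exact ⟨δ, hδ, h.le⟩
  filter_upwards [Metric.tendstoUniformlyOn_iff.1 hu δ hδ] with k hk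
  refine le_trans ((setLIntegral_mono' hs fun x hx => ?_).trans_eq (setLIntegral_const s _)) hδε
  rw [← edist_eq_enorm_sub, edist_comm, edist_nndist]
  exact ENNReal.coe_le_coe.2 (hk x hx).le

lemma tendsto_integral_of_tail_le {α E ι : Type*} [MeasurableSpace α] [NormedAddCommGroup E]
    [NormedSpace ℝ E] {μ : Measure α} {l : Filter ι} {h : ι → α → E} {h₀ : α → E}
    (hh : ∀ᶠ k in l, Integrable (h k) μ) (hh₀ : Integrable h₀ μ)
    (htail : ∀ ε : ℝ≥0∞, 0 < ε → ∃ s, MeasurableSet s ∧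
      Tendsto (fun k => ∫⁻ x in s, ‖h k x - h₀ x‖ₑ ∂μ) l (𝓝 0) ∧
      (∀ᶠ k in l, ∫⁻ x in sᶜ, ‖h k x‖ₑ ∂μ ≤ ε) ∧ ∫⁻ x in sᶜ, ‖h₀ x‖ₑ ∂μ ≤ ε) :
    Tendsto (fun k => ∫ x, h k x ∂μ) l (𝓝 (∫ x, h₀ x ∂μ)) := by
  refine tendsto_integral_of_L1 _ hh₀.aestronglyMeasurable hh
    (ENNReal.tendsto_nhds_zero.2 fun ε hε => ?_)
  have hε3 : 0 < ε / 3 := ENNReal.div_pos hε.ne' (by norm_num)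
  obtain ⟨s, hs, hlim, hk, h0⟩ := htail (ε / 3) hε3
  filter_upwards [hh, hk, ENNReal.tendsto_nhds_zero.1 hlim _ hε3] with k hint hk hks
  calc ∫⁻ x, ‖h k x - h₀ x‖ₑ ∂μ
      = ∫⁻ x in s, ‖h k x - h₀ x‖ₑ ∂μ + ∫⁻ x in sᶜ, ‖h k x - h₀ x‖ₑ ∂μ :=
        (lintegral_add_compl _ hs).symm
    _ ≤ ∫⁻ x in s, ‖h k x - h₀ x‖ₑ ∂μ
          + (∫⁻ x in sᶜ, ‖h k x‖ₑ ∂μ + ∫⁻ x in sᶜ, ‖h₀ x‖ₑ ∂μ) := by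
        rw [← lintegral_add_left' hint.aestronglyMeasurable.enorm.restrict]
        exact add_le_add_right (lintegral_mono fun x => enorm_sub_le) _
    _ ≤ ε / 3 + (ε / 3 + ε / 3) := by gcongr
    _ = ε := by rw [← add_assoc, ENNReal.add_thirds]

lemma exists_forall_sq_le_mul_imp_le {A : ℝ≥0∞} (hA : A ≠ ⊤) {ε : ℝ≥0∞} (hε : 0 < ε) :
    ∃ η : ℝ≥0∞, 0 < η ∧ ∀ x : ℝ≥0∞, x ^ 2 ≤ η * A → x ≤ ε := by
  rcases eq_or_ne ε ⊤ with rfl | -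
  · exact ⟨1, one_pos, fun x _ => le_top⟩
  obtain ⟨η, hη, h⟩ := ENNReal.exists_nnreal_pos_mul_lt hA (pow_ne_zero 2 hε.ne')
  exact ⟨η, by exact_mod_cast hη, fun x hx =>
    (ENNReal.pow_le_pow_left_iff two_ne_zero).1 (hx.trans h.le)⟩

lemma tendsto_integral_mul_conj {c : ℝ} (hc : -1 < c) {A : ℝ≥0∞} (hA : A ≠ ⊤)
    {f g : ℕ → ℂ → ℂ} {f₀ g₀ : ℂ → ℂ} (hf : ∀ᶠ k in atTop, f k ∈ energyBall c A)
    (hg : ∀ᶠ k in atTop, g k ∈ energyBall c A)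
    (hf₀ : ∀ z, Tendsto (fun k => f k z) atTop (𝓝 (f₀ z)))
    (hg₀ : ∀ z, Tendsto (fun k => g k z) atTop (𝓝 (g₀ z))) (htight : Tight c f) :
    Tendsto (fun k => ∫ z, f k z * conj (g k z) ∂fockMeasure c) atTop
      (𝓝 (∫ z, f₀ z * conj (g₀ z) ∂fockMeasure c)) := by
  have := isFiniteMeasure_fockMeasure hc
  have hf₀A := mem_energyBall_of_tendsto hA hf hf₀
  have hg₀A := mem_energyBall_of_tendsto hA hg hg₀
  have hmeas {u : ℂ → ℂ} {s : Set ℂ} (hu : u ∈ energyBall c A) :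
      AEMeasurable u ((fockMeasure c).restrict s) := hu.1.continuous.aemeasurable
  have hint {u v : ℂ → ℂ} (hu : u ∈ energyBall c A) (hv : v ∈ energyBall c A) :
      Integrable (fun z => u z * conj (v z)) (fockMeasure c) :=
    integrable_mul_conj hu.1.continuous.aemeasurable hv.1.continuous.aemeasurable
      (ne_top_of_le_ne_top hA hu.2) (ne_top_of_le_ne_top hA hv.2)
  have hlu : TendstoLocallyUniformly (fun k z => f k z * conj (g k z))
      (fun z => f₀ z * conj (g₀ z)) atTop := by
    refine TendstoLocallyUniformly.fun_mul₀ (tendstoLocallyUniformly_of_mem_energyBall hA hf hf₀) ?_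
      hf₀A.1.continuous (Complex.continuous_conj.comp hg₀A.1.continuous)
    exact Complex.conjLIE.isometry.uniformContinuous.comp_tendstoLocallyUniformly
      (tendstoLocallyUniformly_of_mem_energyBall hA hg hg₀)
  refine tendsto_integral_of_tail_le
    (by filter_upwards [hf, hg] with k hfk hgk using hint hfk hgk) (hint hf₀A hg₀A) fun ε hε => ?_
  obtain ⟨η, hη, hηε⟩ := exists_forall_sq_le_mul_imp_le hA hε
  obtain ⟨M, hM⟩ := htight η hη
  have htail {u v : ℂ → ℂ} (hu : u ∈ energyBall c A) (hv : v ∈ energyBall c A)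
      (huη : ∫⁻ z in (Metric.closedBall (0 : ℂ) M)ᶜ, ‖u z‖ₑ ^ 2 ∂fockMeasure c ≤ η) :
      ∫⁻ z in (Metric.closedBall (0 : ℂ) M)ᶜ, ‖u z * conj (v z)‖ₑ ∂fockMeasure c ≤ ε :=
    hηε _ ((sq_lintegral_enorm_mul_conj_le _ (hmeas hu) (hmeas hv)).trans
      (mul_le_mul' huη ((setLIntegral_le_lintegral _ _).trans hv.2)))
  refine ⟨_, measurableSet_closedBall, tendsto_setLIntegral_enorm_sub measurableSet_closedBall
    (tendstoLocallyUniformly_iff_forall_isCompact.1 hlu _ (isCompact_closedBall 0 M)), ?_, ?_⟩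
  · filter_upwards [hf, hg, hM] with k hfk hgk hMk using htail hfk hgk hMk
  · exact htail hf₀A hg₀A (lintegral_enorm_sq_le_of_tendsto
      (hf.mono fun k hk => hk.1.continuous.measurable) hM hf₀)

/-! ### Deformed Weyl translations -/

lemma lintegral_comp_mul_sub {α : ℂ} (hα : α ≠ 0) (a : ℂ) {G : ℂ → ℝ≥0∞} (hG : Measurable G) :
    ∫⁻ z, G (α * z - a) ∂areaMeasure =
      ENNReal.ofReal (‖α‖ ^ 2)⁻¹ * ∫⁻ z, G z ∂areaMeasure := by
  have hdet : LinearMap.det (LinearMap.mulLeft ℝ α) = ‖α‖ ^ 2 := by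
    rw [← Complex.normSq_eq_norm_sq, ← Algebra.norm_complex_apply]
    rfl
  have hne : LinearMap.det (LinearMap.mulLeft ℝ α) ≠ 0 := by
    rw [hdet]; exact pow_ne_zero 2 (norm_ne_zero_iff.2 hα)
  have hmap := Measure.map_linearMap_addHaar_eq_smul_addHaar (volume : Measure ℂ) hne
  have hcomp : ∫⁻ z, G (α * z - a) =
      ∫⁻ z, G (z - a) ∂(Measure.map (LinearMap.mulLeft ℝ α) volume) := by
    rw [lintegral_map (f := fun z => G (z - a)) (hG.comp (measurable_id.sub_const a))]
    · rfl
    · exact (continuous_const.mul continuous_id : Continuous fun z => α * z).measurable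
  rw [lintegral_areaMeasure, hcomp, hmap, lintegral_smul_measure, smul_eq_mul,
    lintegral_sub_right_eq_self G a, hdet, abs_of_nonneg (by positivity), mul_left_comm,
    ← lintegral_areaMeasure]

/-- The deformed Weyl translation `f ↦ e^{ā z} f((1 - δ ā) z - a)`; for `δ = 0` it is the usual Weyl
translation of the Fock space, up to a constant factor. -/
def weyl (δ : ℝ) (a : ℂ) (f : ℂ → ℂ) (z : ℂ) : ℂ :=
  Complex.exp (conj a * z) * f ((1 - δ * conj a) * z - a)

lemma weyl_exponent_le {δ : ℝ} (hδ : 0 ≤ δ) {a : ℂ} (ha : δ * ‖a‖ ^ 2 ≤ a.re) (z : ℂ) :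
    2 * (conj a * z).re - ‖z‖ ^ 2 ≤ -‖(1 - δ * conj a) * z - a‖ ^ 2 + 2 * ‖a‖ ^ 2 := by
  set x := z.re
  set y := z.im
  set p := a.re
  set q := a.im
  have ha2 : ‖a‖ ^ 2 = p ^ 2 + q ^ 2 := by rw [Complex.sq_norm, Complex.normSq_apply]; ring
  have hz2 : ‖z‖ ^ 2 = x ^ 2 + y ^ 2 := by rw [Complex.sq_norm, Complex.normSq_apply]; ring
  have hw2 : ‖(1 - δ * conj a) * z - a‖ ^ 2 =
      ((1 - δ * p) * x - δ * q * y - p) ^ 2 + ((1 - δ * p) * y + δ * q * x - q) ^ 2 := by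
    rw [Complex.sq_norm, Complex.normSq_apply]
    simp only [Complex.sub_re, Complex.mul_re, Complex.one_re, Complex.ofReal_re, Complex.conj_re,
      Complex.ofReal_im, Complex.conj_im, Complex.sub_im, Complex.mul_im, Complex.one_im]
    ring
  have hre : (conj a * z).re = p * x + q * y := by
    simp [Complex.mul_re, p, q, x, y]
  rw [ha2] at ha
  have hgain : 0 ≤ δ * (p - δ * (p ^ 2 + q ^ 2)) * (x ^ 2 + y ^ 2) :=
    mul_nonneg (mul_nonneg hδ (by linarith)) (by positivity)
  rw [hw2, hz2, hre, ha2]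
  linarith [sq_nonneg (p - δ * (p * x + q * y)), sq_nonneg (q - δ * (p * y - q * x))]

lemma half_le_norm_one_sub {δ : ℝ} (hδ : 0 ≤ δ) (hδ2 : δ ≤ 1 / 2) {a : ℂ} (ha : ‖a‖ ≤ 1) :
    1 / 2 ≤ ‖1 - δ * conj a‖ := by
  have h : ‖(δ : ℂ) * conj a‖ ≤ 1 / 2 := by
    rw [norm_mul, RCLike.norm_conj, Complex.norm_real, Real.norm_of_nonneg hδ]
    nlinarith [norm_nonneg a]
  linarith [norm_sub_norm_le (1 : ℂ) (δ * conj a), norm_one (α := ℂ)]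

lemma inv_sq_mul_rpow_neg_le {r c : ℝ} (hr : 1 / 2 ≤ r) (hc : -1 ≤ c) :
    (r ^ 2)⁻¹ * r ^ (-(2 * c)) ≤ 2 ^ (2 * (c + 1)) := by
  have hpos : 0 < r := by linarith
  have h : (r ^ 2)⁻¹ * r ^ (-(2 * c)) = r⁻¹ ^ (2 * (c + 1)) := by
    rw [Real.inv_rpow hpos.le, ← Real.rpow_neg hpos.le,
      show -(2 * (c + 1)) = -(2 * c) - (2 : ℕ) by push_cast; ring, Real.rpow_sub_natCast hpos.ne']
    field_simp
  rw [h]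
  refine Real.rpow_le_rpow (by positivity) ?_ (by linarith)
  rw [inv_le_comm₀ hpos two_pos]
  linarith

lemma fockWeight_mul_exp_le {c δ : ℝ} (hδ : 0 ≤ δ) {a : ℂ} (ha : ‖a‖ ≤ 1)
    (hre : δ * ‖a‖ ^ 2 ≤ a.re) (hα : 1 - δ * conj a ≠ 0) (z : ℂ) :
    fockWeight c z * ‖Complex.exp (conj a * z)‖ ^ 2 ≤
      Real.exp 2 * ‖1 - δ * conj a‖ ^ (-(2 * c)) *
        (‖(1 - δ * conj a) * z - a + a‖ ^ (2 * c) *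
          Real.exp (-‖(1 - δ * conj a) * z - a‖ ^ 2)) := by
  have hexp := weyl_exponent_le hδ hre z
  have ha2 : ‖a‖ ^ 2 ≤ 1 := pow_le_one₀ (norm_nonneg _) ha
  set α := 1 - δ * conj a
  have hrpow : ‖α‖ ^ (-(2 * c)) * ‖α * z‖ ^ (2 * c) = ‖z‖ ^ (2 * c) := by
    rw [norm_mul, Real.mul_rpow (norm_nonneg _) (norm_nonneg _), ← mul_assoc,
      ← Real.rpow_add (norm_pos_iff.2 hα), neg_add_cancel, Real.rpow_zero, one_mul]
  calc fockWeight c z * ‖Complex.exp (conj a * z)‖ ^ 2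
      = ‖z‖ ^ (2 * c) * Real.exp (2 * (conj a * z).re - ‖z‖ ^ 2) := by
        rw [fockWeight, Complex.norm_exp, ← Real.exp_nat_mul, mul_assoc, ← Real.exp_add]
        congr 2
        push_cast
        ring
    _ ≤ ‖z‖ ^ (2 * c) * Real.exp (2 + -‖α * z - a‖ ^ 2) :=
        mul_le_mul_of_nonneg_left (Real.exp_le_exp.2 (by linarith)) (by positivity)
    _ = Real.exp 2 * ‖α‖ ^ (-(2 * c)) *
          (‖α * z - a + a‖ ^ (2 * c) * Real.exp (-‖α * z - a‖ ^ 2)) := by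
        rw [sub_add_cancel, Real.exp_add, ← hrpow]
        ring

lemma exists_energy_weyl_le {c : ℝ} (hc : -1 < c) : ∃ C : ℝ≥0, ∀ (δ : ℝ) (a : ℂ), 0 ≤ δ →
    δ ≤ 1 / 2 → ‖a‖ ≤ 1 → δ * ‖a‖ ^ 2 ≤ a.re → ∀ f : ℂ → ℂ, Differentiable ℂ f →
    energy c (weyl δ a f) ≤ C * energy c f := by
  obtain ⟨C, hC⟩ := exists_lintegral_shift_le_energy hc
  refine ⟨Real.toNNReal (Real.exp 2 * 2 ^ (2 * (c + 1))) * C, fun δ a hδ hδ2 ha hre f hf => ?_⟩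
  have hα := half_le_norm_one_sub hδ hδ2 ha
  have hα0 : 1 - δ * conj a ≠ 0 := norm_pos_iff.1 (by linarith)
  set α : ℂ := 1 - δ * conj a
  set G : ℂ → ℝ≥0∞ := fun ζ =>
    ENNReal.ofReal (‖ζ + a‖ ^ (2 * c) * Real.exp (-‖ζ‖ ^ 2)) * ‖f ζ‖ₑ ^ 2
  have hG : Measurable G := by
    have := hf.continuous.measurable
    fun_prop
  have hpt : ∀ z, ENNReal.ofReal (fockWeight c z) * ‖weyl δ a f z‖ₑ ^ 2 ≤
      ENNReal.ofReal (Real.exp 2 * ‖α‖ ^ (-(2 * c))) * G (α * z - a) := fun z => by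
    simp only [weyl, G, enorm_mul, mul_pow]
    rw [← mul_assoc, ← mul_assoc, ← ofReal_norm (Complex.exp _),
      ← ENNReal.ofReal_pow (norm_nonneg _), ← ENNReal.ofReal_mul (fockWeight_nonneg _ _),
      ← ENNReal.ofReal_mul (by positivity)]
    exact mul_le_mul_left (ENNReal.ofReal_le_ofReal (fockWeight_mul_exp_le hδ ha hre hα0 z)) _
  calc energy c (weyl δ a f)
      ≤ ∫⁻ z, ENNReal.ofReal (Real.exp 2 * ‖α‖ ^ (-(2 * c))) * G (α * z - a) ∂areaMeasure := by
        rw [energy, lintegral_fockMeasure]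
        exact lintegral_mono hpt
    _ = ENNReal.ofReal (Real.exp 2 * ((‖α‖ ^ 2)⁻¹ * ‖α‖ ^ (-(2 * c)))) *
          ∫⁻ z, G z ∂areaMeasure := by
        rw [lintegral_const_mul' _ _ ENNReal.ofReal_ne_top, lintegral_comp_mul_sub hα0 a hG,
          ← mul_assoc, ← ENNReal.ofReal_mul (by positivity), mul_right_comm, mul_assoc]
    _ ≤ ENNReal.ofReal (Real.exp 2 * 2 ^ (2 * (c + 1))) * (C * energy c f) :=
        mul_le_mul' (ENNReal.ofReal_le_ofReal (mul_le_mul_of_nonneg_left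
          (inv_sq_mul_rpow_neg_le hα hc.le) (Real.exp_pos _).le)) (hC a ha f hf)
    _ = _ := by rw [ENNReal.coe_mul, mul_assoc]; rfl

lemma continuous_weyl (δ : ℝ) {f : ℂ → ℂ} (hf : Continuous f) :
    Continuous fun p : ℂ × ℂ => weyl δ p.1 f p.2 := by
  unfold weyl
  have := Complex.continuous_conj
  fun_prop

/-- The average of the deformed Weyl translations of `f` against the density `σ`. -/
def weylAvg (δ : ℝ) (σ : ℂ → ℂ) (f : ℂ → ℂ) (z : ℂ) : ℂ := ∫ a, σ a * weyl δ a f z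

lemma sq_enorm_integral_mul_le {α : Type*} [MeasurableSpace α] {μ : Measure α} {σ g : α → ℂ}
    (hσ : Measurable σ) (hg : Measurable g) :
    ‖∫ a, σ a * g a ∂μ‖ₑ ^ 2 ≤ (∫⁻ a, ‖σ a‖ₑ ∂μ) * ∫⁻ a, ‖σ a‖ₑ * ‖g a‖ₑ ^ 2 ∂μ := by
  have h := sq_lintegral_mul_le (μ.withDensity fun a => ‖σ a‖ₑ) (u := fun _ => 1)
    (v := fun a => ‖g a‖ₑ) aemeasurable_const hg.enorm.aemeasurable
  simp only [one_mul, one_pow] at h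
  rw [lintegral_withDensity_eq_lintegral_mul _ hσ.enorm hg.enorm,
    lintegral_withDensity_eq_lintegral_mul _ hσ.enorm measurable_const,
    lintegral_withDensity_eq_lintegral_mul _ hσ.enorm (hg.enorm.pow_const 2)] at h
  simp only [Pi.mul_apply, mul_one] at h
  refine le_trans (pow_le_pow_left' ?_ 2) h
  simpa only [enorm_mul] using enorm_integral_le_lintegral_enorm (μ := μ) fun a => σ a * g a

lemma exists_energy_weylAvg_le {c : ℝ} (hc : -1 < c) : ∃ C : ℝ≥0, ∀ (δ : ℝ) (σ : ℂ → ℂ), 0 ≤ δ →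
    δ ≤ 1 / 2 → Continuous σ → (∀ a, σ a ≠ 0 → ‖a‖ ≤ 1 ∧ δ * ‖a‖ ^ 2 ≤ a.re) →
    ∀ f : ℂ → ℂ, Differentiable ℂ f →
    energy c (weylAvg δ σ f) ≤ (∫⁻ a, ‖σ a‖ₑ) ^ 2 * (C * energy c f) := by
  have := isFiniteMeasure_fockMeasure hc
  obtain ⟨C, hC⟩ := exists_energy_weyl_le hc
  refine ⟨C, fun δ σ hδ hδ2 hσ hsupp f hf => ?_⟩
  have hσm : Measurable fun a => ‖σ a‖ₑ := hσ.measurable.enorm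
  have hweyl := continuous_weyl δ hf.continuous
  have hW : Measurable fun p : ℂ × ℂ => ‖σ p.2‖ₑ * ‖weyl δ p.2 f p.1‖ₑ ^ 2 :=
    (hσm.comp measurable_snd).mul ((hweyl.comp continuous_swap).measurable.enorm.pow_const 2)
  unfold energy
  calc ∫⁻ z, ‖weylAvg δ σ f z‖ₑ ^ 2 ∂fockMeasure c
      ≤ ∫⁻ z, ((∫⁻ a, ‖σ a‖ₑ) * ∫⁻ a, ‖σ a‖ₑ * ‖weyl δ a f z‖ₑ ^ 2) ∂fockMeasure c :=
        lintegral_mono fun z =>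
          sq_enorm_integral_mul_le hσ.measurable (hweyl.comp (.prodMk_left z)).measurable
    _ = (∫⁻ a, ‖σ a‖ₑ) * ∫⁻ z, (∫⁻ a, ‖σ a‖ₑ * ‖weyl δ a f z‖ₑ ^ 2) ∂fockMeasure c :=
        lintegral_const_mul _ hW.lintegral_prod_right'
    _ = (∫⁻ a, ‖σ a‖ₑ) * ∫⁻ a, (∫⁻ z, ‖σ a‖ₑ * ‖weyl δ a f z‖ₑ ^ 2 ∂fockMeasure c) := by
        rw [lintegral_lintegral_swap hW.aemeasurable]
    _ ≤ (∫⁻ a, ‖σ a‖ₑ) * ∫⁻ a, ‖σ a‖ₑ * (C * energy c f) := by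
        refine mul_le_mul_right (lintegral_mono fun a => ?_) _
        rw [lintegral_const_mul' _ _ enorm_ne_top]
        by_cases ha : σ a = 0
        · simp [ha]
        · exact mul_le_mul_right (hC δ a hδ hδ2 (hsupp a ha).1 (hsupp a ha).2 f hf) _
    _ = _ := by rw [lintegral_mul_const _ hσm, energy]; ring

/-- The Wirtinger derivative `∂`. -/
def dz (ρ : ℂ → ℂ) (a : ℂ) : ℂ := (fderiv ℝ ρ a 1 - Complex.I * fderiv ℝ ρ a Complex.I) / 2

/-- The Wirtinger derivative `∂̄`. -/
def dzbar (ρ : ℂ → ℂ) (a : ℂ) : ℂ := (fderiv ℝ ρ a 1 + Complex.I * fderiv ℝ ρ a Complex.I) / 2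

/-- The density `ρ - δ ∂ρ`, whose averages of deformed Weyl translations stay square integrable
after multiplication by `z`, see `mul_reg`. -/
def regDensity (δ : ℝ) (ρ : ℂ → ℂ) (a : ℂ) : ℂ := ρ a - δ * dz ρ a

/-- The regularisation `f ↦ ∫ (ρ - δ ∂ρ)(a) e^{ā z} f((1 - δ ā) z - a) d²a`. -/
def reg (δ : ℝ) (ρ : ℂ → ℂ) (f : ℂ → ℂ) : ℂ → ℂ := weylAvg δ (regDensity δ ρ) f

lemma hasLineDerivAt_weyl (δ : ℝ) {f : ℂ → ℂ} (hf : Differentiable ℂ f) (z a v : ℂ) :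
    HasLineDerivAt ℝ (fun a => weyl δ a f z)
      (conj v * (z * (weyl δ a f z - δ * weyl δ a (deriv f) z)) - v * weyl δ a (deriv f) z)
      a v := by
  unfold HasLineDerivAt weyl
  have hline : HasDerivAt (fun t : ℝ => a + t • v) v 0 := by
    simpa using ((hasDerivAt_id (0 : ℝ)).smul_const v).const_add a
  have hconj : HasDerivAt (fun t : ℝ => conj (a + t • v)) (conj v) 0 := hline.star
  have hexp : HasDerivAt (fun t : ℝ => Complex.exp (conj (a + t • v) * z))
      (Complex.exp (conj (a + (0 : ℝ) • v) * z) * (conj v * z)) 0 :=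
    (hconj.mul_const z).cexp
  have harg : HasDerivAt (fun t : ℝ => (1 - δ * conj (a + t • v)) * z - (a + t • v))
      (-(δ * conj v) * z - v) 0 :=
    (((hconj.const_mul (δ : ℂ)).const_sub 1).mul_const z).sub hline
  refine (hexp.mul ((hf ((1 - δ * conj (a + (0 : ℝ) • v)) * z -
    (a + (0 : ℝ) • v))).hasDerivAt.comp 0 harg)).congr_deriv ?_
  simp only [Function.comp, zero_smul, add_zero]
  ring

lemma continuous_weyl_left (δ : ℝ) {f : ℂ → ℂ} (hf : Continuous f) (z : ℂ) :
    Continuous fun a => weyl δ a f z :=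
  (continuous_weyl δ hf).comp (.prodMk_left z)

lemma integrable_mul_weyl {σ f : ℂ → ℂ} (hσ : Continuous σ) (hs : HasCompactSupport σ)
    (hf : Continuous f) (δ : ℝ) (z : ℂ) : Integrable fun a => σ a * weyl δ a f z :=
  (hσ.mul (continuous_weyl_left δ hf z)).integrable_of_hasCompactSupport hs.mul_right

lemma weylAvg_sub_const_mul {σ τ f : ℂ → ℂ} (hσ : Continuous σ) (hσs : HasCompactSupport σ)
    (hτ : Continuous τ) (hτs : HasCompactSupport τ) (hf : Continuous f) (δ : ℝ) (k z : ℂ) :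
    weylAvg δ (fun a => σ a - k * τ a) f z = weylAvg δ σ f z - k * weylAvg δ τ f z := by
  simp only [weylAvg, sub_mul, mul_assoc]
  rw [integral_sub (integrable_mul_weyl hσ hσs hf δ z)
    ((integrable_mul_weyl hτ hτs hf δ z).const_mul k), integral_const_mul]

section Regularisation

variable {ρ : ℂ → ℂ}

lemma support_fderiv_apply_subset (ρ : ℂ → ℂ) (v : ℂ) :
    Function.support (fun a => fderiv ℝ ρ a v) ⊆ tsupport ρ := fun a ha =>
  support_fderiv_subset ℝ fun h => ha (by simp [h])

lemma support_dz_subset (ρ : ℂ → ℂ) : Function.support (dz ρ) ⊆ tsupport ρ := fun a ha =>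
  support_fderiv_subset ℝ fun h => ha (by simp [dz, h])

lemma support_dzbar_subset (ρ : ℂ → ℂ) : Function.support (dzbar ρ) ⊆ tsupport ρ := fun a ha =>
  support_fderiv_subset ℝ fun h => ha (by simp [dzbar, h])

lemma support_regDensity_subset (δ : ℝ) (ρ : ℂ → ℂ) :
    Function.support (regDensity δ ρ) ⊆ tsupport ρ := fun a ha => by
  by_contra h
  exact ha (by simp [regDensity, image_eq_zero_of_notMem_tsupport h,
    Function.notMem_support.1 fun h' => h (support_dz_subset ρ h')])

lemma continuous_fderiv_apply (hρ : ContDiff ℝ 1 ρ) (v : ℂ) :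
    Continuous fun a => fderiv ℝ ρ a v :=
  (hρ.continuous_fderiv one_ne_zero).clm_apply continuous_const

lemma continuous_dz (hρ : ContDiff ℝ 1 ρ) : Continuous (dz ρ) :=
  ((continuous_fderiv_apply hρ 1).sub
    (continuous_const.mul (continuous_fderiv_apply hρ _))).div_const 2

lemma continuous_dzbar (hρ : ContDiff ℝ 1 ρ) : Continuous (dzbar ρ) :=
  ((continuous_fderiv_apply hρ 1).add
    (continuous_const.mul (continuous_fderiv_apply hρ _))).div_const 2

lemma continuous_regDensity (δ : ℝ) (hρ : ContDiff ℝ 1 ρ) : Continuous (regDensity δ ρ) :=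
  hρ.continuous.sub (continuous_const.mul (continuous_dz hρ))

lemma weylAvg_fderiv_apply (hρ : ContDiff ℝ 1 ρ) (hs : HasCompactSupport ρ) {f : ℂ → ℂ}
    (hf : Differentiable ℂ f) (δ : ℝ) (v z : ℂ) :
    weylAvg δ (fun a => fderiv ℝ ρ a v) f z = v * weylAvg δ ρ (deriv f) z -
      conj v * (z * (weylAvg δ ρ f z - δ * weylAvg δ ρ (deriv f) z)) := by
  have hfi := integrable_mul_weyl hρ.continuous hs hf.continuous δ z
  have hfi' := integrable_mul_weyl hρ.continuous hs hf.deriv.continuous δ z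
  have hfc := continuous_weyl_left δ hf.continuous z
  have hfc' := continuous_weyl_left δ hf.deriv.continuous z
  have hparts : ∫ a, ρ a * (conj v * (z * (weyl δ a f z - δ * weyl δ a (deriv f) z)) -
      v * weyl δ a (deriv f) z) = -weylAvg δ (fun a => fderiv ℝ ρ a v) f z :=
    integral_bilinear_hasLineDerivAt_right_eq_neg_left_of_integrable
      (B := ContinuousLinearMap.mul ℝ ℂ) (v := v)
      (integrable_mul_weyl (continuous_fderiv_apply hρ v)
        (hs.mono' (support_fderiv_apply_subset ρ v)) hf.continuous δ z)
      ((hρ.continuous.mul (by fun_prop)).integrable_of_hasCompactSupport hs.mul_right) hfi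
      (fun a _ => (hρ.differentiable one_ne_zero a).hasFDerivAt.hasLineDerivAt v)
      (fun a _ => hasLineDerivAt_weyl δ hf z a v)
  have hlin : ∀ a, ρ a * (conj v * (z * (weyl δ a f z - δ * weyl δ a (deriv f) z)) -
      v * weyl δ a (deriv f) z) = conj v * z * (ρ a * weyl δ a f z) -
        (conj v * z * δ + v) * (ρ a * weyl δ a (deriv f) z) := fun a => by ring
  simp_rw [hlin] at hparts
  rw [integral_sub (hfi.const_mul _) (hfi'.const_mul _), integral_const_mul,
    integral_const_mul] at hparts
  rw [← neg_eq_iff_eq_neg.2 hparts]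
  simp only [weylAvg]
  ring

lemma weylAvg_dz (hρ : ContDiff ℝ 1 ρ) (hs : HasCompactSupport ρ) {f : ℂ → ℂ}
    (hf : Differentiable ℂ f) (δ : ℝ) (z : ℂ) :
    weylAvg δ (dz ρ) f z = weylAvg δ ρ (deriv f) z := by
  have hdz : weylAvg δ (dz ρ) f z = (weylAvg δ (fun a => fderiv ℝ ρ a 1) f z -
      Complex.I * weylAvg δ (fun a => fderiv ℝ ρ a Complex.I) f z) / 2 := by
    rw [← weylAvg_sub_const_mul (continuous_fderiv_apply hρ _)
      (hs.mono' (support_fderiv_apply_subset ρ _)) (continuous_fderiv_apply hρ _)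
      (hs.mono' (support_fderiv_apply_subset ρ _)) hf.continuous]
    simp only [weylAvg, dz, div_mul_eq_mul_div, integral_div]
  rw [hdz, weylAvg_fderiv_apply hρ hs hf, weylAvg_fderiv_apply hρ hs hf, map_one, Complex.conj_I]
  linear_combination (-weylAvg δ ρ (deriv f) z -
    z * (weylAvg δ ρ f z - δ * weylAvg δ ρ (deriv f) z)) / 2 * Complex.I_mul_I

lemma weylAvg_dzbar (hρ : ContDiff ℝ 1 ρ) (hs : HasCompactSupport ρ) {f : ℂ → ℂ}
    (hf : Differentiable ℂ f) (δ : ℝ) (z : ℂ) :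
    weylAvg δ (dzbar ρ) f z = -(z * (weylAvg δ ρ f z - δ * weylAvg δ ρ (deriv f) z)) := by
  have hdz : weylAvg δ (dzbar ρ) f z = (weylAvg δ (fun a => fderiv ℝ ρ a 1) f z -
      -Complex.I * weylAvg δ (fun a => fderiv ℝ ρ a Complex.I) f z) / 2 := by
    rw [← weylAvg_sub_const_mul (continuous_fderiv_apply hρ _)
      (hs.mono' (support_fderiv_apply_subset ρ _)) (continuous_fderiv_apply hρ _)
      (hs.mono' (support_fderiv_apply_subset ρ _)) hf.continuous]
    simp only [weylAvg, dzbar, div_mul_eq_mul_div, integral_div, neg_mul, sub_neg_eq_add]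
  rw [hdz, weylAvg_fderiv_apply hρ hs hf, weylAvg_fderiv_apply hρ hs hf, map_one, Complex.conj_I]
  linear_combination (weylAvg δ ρ (deriv f) z +
    z * (weylAvg δ ρ f z - δ * weylAvg δ ρ (deriv f) z)) / 2 * Complex.I_mul_I

-- `∂̄_a e^{ā z} f((1 - δ ā) z - a)` is `z` times `1 + δ ∂_a` of the translation, so after
-- integration by parts the factor `z` turns into a derivative of the density.
lemma mul_reg (hρ : ContDiff ℝ 1 ρ) (hs : HasCompactSupport ρ) {f : ℂ → ℂ}
    (hf : Differentiable ℂ f) (δ : ℝ) (z : ℂ) :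
    z * reg δ ρ f z = -weylAvg δ (dzbar ρ) f z := by
  have hreg : reg δ ρ f z = weylAvg δ ρ f z - δ * weylAvg δ (dz ρ) f z :=
    weylAvg_sub_const_mul hρ.continuous hs (continuous_dz hρ) (hs.mono' (support_dz_subset ρ))
      hf.continuous δ δ z
  rw [hreg, weylAvg_dz hρ hs hf, weylAvg_dzbar hρ hs hf, neg_neg]

lemma lintegral_enorm_regDensity_le (δ : ℝ) (hρ : Continuous ρ) :
    ∫⁻ a, ‖regDensity δ ρ a‖ₑ ≤ (∫⁻ a, ‖ρ a‖ₑ) + ENNReal.ofReal |δ| * ∫⁻ a, ‖dz ρ a‖ₑ :=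
  calc ∫⁻ a, ‖regDensity δ ρ a‖ₑ ≤ ∫⁻ a, (‖ρ a‖ₑ + ‖(δ : ℂ)‖ₑ * ‖dz ρ a‖ₑ) :=
        lintegral_mono fun a => enorm_sub_le.trans (by rw [enorm_mul])
    _ = _ := by
        rw [lintegral_add_left hρ.measurable.enorm, lintegral_const_mul' _ _ enorm_ne_top,
          ← ofReal_norm, Complex.norm_real, Real.norm_eq_abs]

lemma norm_regDensity_le {δ : ℝ} (hδ : |δ| ≤ 1) (ρ : ℂ → ℂ) (a : ℂ) :
    ‖regDensity δ ρ a‖ ≤ ‖ρ a‖ + ‖dz ρ a‖ := by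
  refine (norm_sub_le _ _).trans (add_le_add_right ?_ _)
  rw [norm_mul, Complex.norm_real, Real.norm_eq_abs]
  exact mul_le_of_le_one_left (norm_nonneg _) hδ

lemma norm_weyl_le {δ R B : ℝ} (hδ : |δ| ≤ 1) {a z : ℂ} (ha : ‖a‖ ≤ R) {f : ℂ → ℂ}
    (hB : ∀ w, ‖w‖ ≤ (1 + R) * ‖z‖ + R → ‖f w‖ ≤ B) :
    ‖weyl δ a f z‖ ≤ Real.exp (R * ‖z‖) * B := by
  rw [weyl, norm_mul]
  refine mul_le_mul ?_ (hB _ ?_) (norm_nonneg _) (Real.exp_pos _).le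
  · rw [Complex.norm_exp]
    refine Real.exp_le_exp.2 ((Complex.re_le_norm _).trans ?_)
    rw [norm_mul, RCLike.norm_conj]
    gcongr
  · have hδa : ‖1 - δ * conj a‖ ≤ 1 + R := by
      refine (norm_sub_le _ _).trans ?_
      rw [norm_one, norm_mul, RCLike.norm_conj, Complex.norm_real, Real.norm_eq_abs]
      linarith [mul_le_of_le_one_left (norm_nonneg a) hδ]
    refine (norm_sub_le _ _).trans (add_le_add ?_ ha)
    rw [norm_mul]
    gcongr

lemma tendsto_weyl {f : ℕ → ℂ → ℂ} {g : ℂ → ℂ} {δ : ℕ → ℝ} {δ₀ : ℝ}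
    (hδ : Tendsto δ atTop (𝓝 δ₀)) (h : TendstoLocallyUniformly f g atTop) (hg : Continuous g)
    (a z : ℂ) : Tendsto (fun k => weyl (δ k) a (f k) z) atTop (𝓝 (weyl δ₀ a g z)) := by
  have harg : Tendsto (fun k => (1 - (δ k : ℂ) * conj a) * z - a) atTop
      (𝓝 ((1 - (δ₀ : ℂ) * conj a) * z - a)) :=
    (((hδ.ofReal.mul_const _).const_sub 1).mul_const z).sub_const a
  exact (h.tendsto_comp hg.continuousAt harg).const_mul _

lemma tendsto_reg {c : ℝ} {A : ℝ≥0∞} (hA : A ≠ ⊤) {f : ℕ → ℂ → ℂ} {g : ℂ → ℂ} {δ : ℕ → ℝ}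
    {δ₀ : ℝ} (hδ₀ : |δ₀| < 1) (hδ : Tendsto δ atTop (𝓝 δ₀))
    (hf : ∀ᶠ k in atTop, f k ∈ energyBall c A)
    (h : ∀ z, Tendsto (fun k => f k z) atTop (𝓝 (g z)))
    (hρ : ContDiff ℝ 1 ρ) (hs : HasCompactSupport ρ) (z : ℂ) :
    Tendsto (fun k => reg (δ k) ρ (f k) z) atTop (𝓝 (reg δ₀ ρ g z)) := by
  have hg := (mem_energyBall_of_tendsto hA hf h).1.continuous
  have hloc := tendstoLocallyUniformly_of_mem_energyBall hA hf h
  obtain ⟨R, hR⟩ := isBounded_iff_forall_norm_le.1 hs.isCompact.isBounded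
  obtain ⟨B, hB⟩ := exists_norm_le_of_mem_energyBall c ((1 + R) * ‖z‖ + R) hA
  unfold reg weylAvg
  refine tendsto_integral_filter_of_dominated_convergence
    (fun a => (‖ρ a‖ + ‖dz ρ a‖) * (Real.exp (R * ‖z‖) * B)) ?_ ?_ ?_ ?_
  · filter_upwards [hf] with k hk
    exact ((continuous_regDensity _ hρ).mul
      (continuous_weyl_left _ hk.1.continuous z)).aestronglyMeasurable
  · filter_upwards [hf, hδ.abs.eventually_le_const hδ₀] with k hk hδk
    refine Eventually.of_forall fun a => ?_
    rw [norm_mul]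
    by_cases ha : a ∈ tsupport ρ
    · exact mul_le_mul (norm_regDensity_le hδk ρ a) (norm_weyl_le hδk (hR a ha) (hB _ hk))
        (norm_nonneg _) (by positivity)
    · rw [Function.notMem_support.1 fun h' => ha (support_regDensity_subset _ ρ h'),
        Function.notMem_support.1 fun h' => ha (support_dz_subset ρ h'),
        image_eq_zero_of_notMem_tsupport ha]
      simp
  · refine Integrable.mul_const (.add ?_ ?_) _
    · exact (hρ.continuous.integrable_of_hasCompactSupport hs).norm
    · exact ((continuous_dz hρ).integrable_of_hasCompactSupport
        (hs.mono' (support_dz_subset ρ))).norm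
  · refine Eventually.of_forall fun a => ?_
    exact ((hδ.ofReal.mul_const _).const_sub _).mul (tendsto_weyl hδ hloc hg a z)

end Regularisation

/-- A smooth approximate identity supported in the disc of centre `2ε` and radius `ε`. The disc
avoids `0`, so that `δ |a|² ≤ Re a` on it for small `δ`, as `exists_energy_weyl_le` requires. -/
structure Mollifier (ε : ℝ) where
  /-- The density. -/
  toFun : ℂ → ℂ
  contDiff : ContDiff ℝ 1 toFun
  tsupport_subset : tsupport toFun ⊆ Metric.closedBall ((2 * ε : ℝ) : ℂ) ε
  integral_eq_one : ∫ a, toFun a = 1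
  lintegral_enorm : ∫⁻ a, ‖toFun a‖ₑ = 1

instance {ε : ℝ} : CoeFun (Mollifier ε) fun _ => ℂ → ℂ := ⟨Mollifier.toFun⟩

lemma nonempty_mollifier {ε : ℝ} (hε : 0 < ε) : Nonempty (Mollifier ε) := by
  let φ : ContDiffBump ((2 * ε : ℝ) : ℂ) := ⟨ε / 2, ε, by positivity, by linarith⟩
  have hsup : Function.support (fun a => ((φ.normed volume a : ℝ) : ℂ)) =
      Function.support (φ.normed volume) := by ext a; simp
  refine ⟨⟨fun a => ((φ.normed volume a : ℝ) : ℂ), ?_, ?_, ?_, ?_⟩⟩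
  · exact Complex.ofRealCLM.contDiff.comp (φ.contDiff_normed (n := 1))
  · rw [tsupport, hsup, ← tsupport, φ.tsupport_normed_eq]
  · rw [integral_complex_ofReal, φ.integral_normed, Complex.ofReal_one]
  · have henorm (a) : ‖((φ.normed volume a : ℝ) : ℂ)‖ₑ = ENNReal.ofReal (φ.normed volume a) := by
      rw [← ofReal_norm, Complex.norm_real, Real.norm_of_nonneg (φ.nonneg_normed a)]
    simp_rw [henorm]
    rw [← ofReal_integral_eq_lintegral_ofReal φ.integrable_normed
      (Eventually.of_forall φ.nonneg_normed), φ.integral_normed, ENNReal.ofReal_one]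

namespace Mollifier

variable {ε : ℝ} (ρ : Mollifier ε)

lemma hasCompactSupport : HasCompactSupport ρ :=
  (isCompact_closedBall _ _).of_isClosed_subset (isClosed_tsupport _) ρ.tsupport_subset

lemma norm_le_of_mem_tsupport {a : ℂ} (ha : a ∈ tsupport ρ) : ‖a‖ ≤ 3 * ε := by
  have h : ‖a - ((2 * ε : ℝ) : ℂ)‖ ≤ ε := by simpa [dist_eq_norm] using ρ.tsupport_subset ha
  have hε : ‖((2 * ε : ℝ) : ℂ)‖ = 2 * ε := by
    rw [Complex.norm_real, Real.norm_of_nonneg (by linarith [(norm_nonneg _).trans h])]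
  linarith [norm_le_norm_add_norm_sub' a ((2 * ε : ℝ) : ℂ)]

lemma le_re_of_mem_tsupport {a : ℂ} (ha : a ∈ tsupport ρ) : ε ≤ a.re := by
  have h : ‖a - ((2 * ε : ℝ) : ℂ)‖ ≤ ε := by simpa [dist_eq_norm] using ρ.tsupport_subset ha
  have hre := (abs_le.1 ((Complex.abs_re_le_norm _).trans h)).1
  rw [Complex.sub_re, Complex.ofReal_re] at hre
  linarith

lemma norm_le_one_and_mul_sq_le_re (hε : ε ≤ 1 / 3) {δ : ℝ} (hδ : δ ≤ 1 / 3) {a : ℂ}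
    (ha : a ∈ tsupport ρ) : ‖a‖ ≤ 1 ∧ δ * ‖a‖ ^ 2 ≤ a.re := by
  have hle := ρ.norm_le_of_mem_tsupport ha
  have hone : ‖a‖ ≤ 1 := by linarith
  refine ⟨hone, ?_⟩
  have hsq : ‖a‖ ^ 2 ≤ 3 * ε := by nlinarith [norm_nonneg a]
  nlinarith [ρ.le_re_of_mem_tsupport ha, sq_nonneg ‖a‖]

end Mollifier

lemma lintegral_enorm_ne_top {σ : ℂ → ℂ} (hσ : Continuous σ) (hs : HasCompactSupport σ) :
    ∫⁻ a, ‖σ a‖ₑ ≠ ⊤ :=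
  (hσ.integrable_of_hasCompactSupport hs).hasFiniteIntegral.ne

lemma exists_energy_reg_le {c : ℝ} (hc : -1 < c) : ∃ C : ℝ≥0, ∀ (ε : ℝ) (ρ : Mollifier ε),
    ε ≤ 1 / 3 → ∃ δ₀ > 0, ∀ δ : ℝ, 0 ≤ δ → δ ≤ δ₀ → ∀ f : ℂ → ℂ, Differentiable ℂ f →
    energy c (reg δ ρ f) ≤ C * energy c f := by
  obtain ⟨C, hC⟩ := exists_energy_weylAvg_le hc
  refine ⟨4 * C, fun ε ρ hε => ?_⟩
  obtain ⟨κ, hκ, hκD⟩ := ENNReal.exists_nnreal_pos_mul_lt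
    (lintegral_enorm_ne_top (continuous_dz ρ.contDiff)
      (ρ.hasCompactSupport.mono' (support_dz_subset ρ))) one_ne_zero
  refine ⟨min (1 / 3) κ, lt_min (by norm_num) hκ, fun δ hδ hδ₀ f hf => ?_⟩
  have hδ3 : δ ≤ 1 / 3 := hδ₀.trans (min_le_left _ _)
  have hδκ : ENNReal.ofReal |δ| ≤ κ := by
    rw [abs_of_nonneg hδ, ← ENNReal.ofReal_coe_nnreal]
    exact ENNReal.ofReal_le_ofReal (hδ₀.trans (min_le_right _ _))
  have hL1 : ∫⁻ a, ‖regDensity δ ρ a‖ₑ ≤ 2 :=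
    calc ∫⁻ a, ‖regDensity δ ρ a‖ₑ
        ≤ (∫⁻ a, ‖ρ a‖ₑ) + ENNReal.ofReal |δ| * ∫⁻ a, ‖dz ρ a‖ₑ :=
          lintegral_enorm_regDensity_le δ ρ.contDiff.continuous
      _ ≤ 1 + 1 := add_le_add ρ.lintegral_enorm.le ((mul_le_mul_left hδκ _).trans hκD.le)
      _ = 2 := one_add_one_eq_two
  calc energy c (reg δ ρ f) ≤ (∫⁻ a, ‖regDensity δ ρ a‖ₑ) ^ 2 * (C * energy c f) :=
        hC δ _ hδ (by linarith) (continuous_regDensity δ ρ.contDiff)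
          (fun a ha =>
            ρ.norm_le_one_and_mul_sq_le_re hε hδ3 (support_regDensity_subset δ ρ ha)) f hf
    _ ≤ 2 ^ 2 * (C * energy c f) := mul_le_mul_left (pow_le_pow_left' hL1 2) _
    _ = _ := by push_cast; ring

lemma exists_energy_add_one_reg_le {c : ℝ} (hc : -1 < c) {ε : ℝ} (ρ : Mollifier ε)
    (hε : ε ≤ 1 / 3) : ∃ C : ℝ≥0, ∀ δ : ℝ, 0 ≤ δ → δ ≤ 1 / 3 → ∀ f : ℂ → ℂ, Differentiable ℂ f →
    energy (c + 1) (reg δ ρ f) ≤ C * energy c f := by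
  obtain ⟨C, hC⟩ := exists_energy_weylAvg_le hc
  have hfin := lintegral_enorm_ne_top (continuous_dzbar ρ.contDiff)
    (ρ.hasCompactSupport.mono' (support_dzbar_subset ρ))
  refine ⟨(∫⁻ a, ‖dzbar ρ a‖ₑ).toNNReal ^ 2 * C, fun δ hδ hδ3 f hf => ?_⟩
  calc energy (c + 1) (reg δ ρ f) = energy c fun z => z * reg δ ρ f z := (energy_id_mul c _).symm
    _ = energy c (weylAvg δ (dzbar ρ) f) := by
        simp only [energy, mul_reg ρ.contDiff ρ.hasCompactSupport hf, enorm_neg]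
    _ ≤ (∫⁻ a, ‖dzbar ρ a‖ₑ) ^ 2 * (C * energy c f) :=
        hC δ _ hδ (by linarith) (continuous_dzbar ρ.contDiff)
          (fun a ha => ρ.norm_le_one_and_mul_sq_le_re hε hδ3 (support_dzbar_subset ρ ha)) f hf
    _ = _ := by
        rw [ENNReal.coe_mul, ENNReal.coe_pow, ENNReal.coe_toNNReal hfin, mul_assoc]

lemma Mollifier.norm_integral_mul_sub_le {ε η : ℝ} (ρ : Mollifier ε) {g : ℂ → ℂ}
    (hg : Continuous g) {w : ℂ} (hη : ∀ a, ‖a‖ ≤ 3 * ε → ‖g a - w‖ ≤ η) :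
    ‖(∫ a, ρ a * g a) - w‖ ≤ η := by
  have hρ : Integrable ρ :=
    ρ.contDiff.continuous.integrable_of_hasCompactSupport ρ.hasCompactSupport
  have hρg : Integrable fun a => ρ a * g a :=
    (ρ.contDiff.continuous.mul hg).integrable_of_hasCompactSupport ρ.hasCompactSupport.mul_right
  have hsub : (∫ a, ρ a * g a) - w = ∫ a, ρ a * (g a - w) := by
    simp_rw [mul_sub]
    rw [integral_sub hρg (hρ.mul_const w), integral_mul_const, ρ.integral_eq_one, one_mul]
  have hnorm : ∫ a, ‖ρ a‖ = 1 := by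
    rw [integral_norm_eq_lintegral_enorm hρ.aestronglyMeasurable, ρ.lintegral_enorm,
      ENNReal.toReal_one]
  rw [hsub, ← one_mul η, ← hnorm, ← integral_mul_const]
  refine norm_integral_le_of_norm_le (hρ.norm.mul_const _) (Eventually.of_forall fun a => ?_)
  rw [norm_mul]
  by_cases ha : a ∈ tsupport ρ
  · exact mul_le_mul_of_nonneg_left (hη a (ρ.norm_le_of_mem_tsupport ha)) (norm_nonneg _)
  · simp [image_eq_zero_of_notMem_tsupport ha]

lemma tendsto_reg_zero {f : ℂ → ℂ} (hf : Continuous f) {ε : ℕ → ℝ}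
    (hε : Tendsto ε atTop (𝓝 0)) (ρ : ∀ k, Mollifier (ε k)) (z : ℂ) :
    Tendsto (fun k => reg 0 (ρ k) f z) atTop (𝓝 (f z)) := by
  have hweyl : Continuous fun a => weyl 0 a f z := continuous_weyl_left 0 hf z
  have hreg : ∀ k, reg 0 (ρ k) f z = ∫ a, ρ k a * weyl 0 a f z := fun k => by
    simp [reg, weylAvg, regDensity]
  rw [Metric.tendsto_nhds]
  intro η hη
  obtain ⟨r, hr, hr'⟩ := Metric.continuous_iff.1 hweyl 0 (η / 2) (by positivity)
  have hε3 : Tendsto (fun k => 3 * ε k) atTop (𝓝 0) := by simpa using hε.const_mul 3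
  filter_upwards [hε3.eventually_lt_const hr] with k hk
  rw [dist_eq_norm, hreg]
  refine ((ρ k).norm_integral_mul_sub_le hweyl fun a ha => ?_).trans_lt (half_lt_self hη)
  simpa [weyl, dist_eq_norm] using (hr' a (by simpa using ha.trans_lt hk)).le

/-- `f = p e^{bz}` for a polynomial `p` of degree less than `n`. -/
def IsWeightedPoly (n : ℕ) (b : ℝ) (f : ℂ → ℂ) : Prop :=
  ∃ p : ℂ[X], p.degree < n ∧ ∀ z, f z = p.eval z * Complex.exp (b * z)

lemma IsWeightedPoly.differentiable {n : ℕ} {b : ℝ} {f : ℂ → ℂ} (hf : IsWeightedPoly n b f) :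
    Differentiable ℂ f := by
  obtain ⟨p, -, hp⟩ := hf
  rw [funext hp]
  exact p.differentiable.mul (by fun_prop)

lemma eval_add_eq_sum_hasseDeriv {n : ℕ} {p : ℂ[X]} (hp : p.degree < n) (x a : ℂ) :
    p.eval (x + a) = ∑ j ∈ Finset.range n, (hasseDeriv j p).eval a * x ^ j := by
  rw [← taylor_eval]
  simp_rw [← taylor_coeff]
  by_cases h0 : taylor a p = 0
  · simp [h0]
  · exact eval_eq_sum_range' ((natDegree_lt_iff_degree_lt h0).2 (by rwa [degree_taylor])) _

lemma weyl_inv_eq_sum {n : ℕ} {b : ℝ} (hb : b ≠ 0) {p : ℂ[X]} (hp : p.degree < n) (a z : ℂ) :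
    weyl b⁻¹ a (fun z => p.eval z * Complex.exp (b * z)) z =
      ∑ j ∈ Finset.range n, Complex.exp (-(b * a)) * ((hasseDeriv j p).eval (-a) *
        (1 - (b⁻¹ : ℝ) * conj a) ^ j) * (z ^ j * Complex.exp (b * z)) := by
  have hb' : (b : ℂ) ≠ 0 := by exact_mod_cast hb
  have hexp : Complex.exp (conj a * z) *
      Complex.exp (b * ((1 - (b⁻¹ : ℝ) * conj a) * z - a)) =
      Complex.exp (-(b * a)) * Complex.exp (b * z) := by
    rw [← Complex.exp_add, ← Complex.exp_add]
    congr 1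
    push_cast
    field_simp
    ring
  rw [weyl, mul_left_comm, hexp, sub_eq_add_neg _ a, eval_add_eq_sum_hasseDeriv hp, Finset.sum_mul]
  refine Finset.sum_congr rfl fun j _ => ?_
  rw [mul_pow]
  ring

lemma IsWeightedPoly.weylAvg {n : ℕ} {b : ℝ} (hb : b ≠ 0) {f : ℂ → ℂ}
    (hf : IsWeightedPoly n b f) {σ : ℂ → ℂ} (hσ : Continuous σ) (hs : HasCompactSupport σ) :
    IsWeightedPoly n b (weylAvg b⁻¹ σ f) := by
  obtain ⟨p, hpn, hp⟩ := hf
  set u : ℕ → ℂ → ℂ := fun j a => Complex.exp (-(b * a)) *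
    ((hasseDeriv j p).eval (-a) * (1 - (b⁻¹ : ℝ) * conj a) ^ j)
  have hu : ∀ j, Continuous (u j) := fun j => by
    have := (hasseDeriv j p).continuous.comp (continuous_neg (G := ℂ))
    have := Complex.continuous_conj
    simp only [u]
    fun_prop
  refine ⟨∑ j ∈ Finset.range n, C (∫ a, σ a * u j a) * X ^ j, ?_, fun z => ?_⟩
  · refine mem_degreeLT.1 (Submodule.sum_mem _ fun j hj => mem_degreeLT.2 ?_)
    exact (degree_C_mul_X_pow_le _ _).trans_lt (by exact_mod_cast Finset.mem_range.1 hj)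
  · have hweyl : ∀ a, weyl b⁻¹ a f z =
        ∑ j ∈ Finset.range n, u j a * (z ^ j * Complex.exp (b * z)) := fun a => by
      rw [funext hp, weyl_inv_eq_sum hb hpn]
    unfold EdgeRecursion.weylAvg
    simp_rw [hweyl, Finset.mul_sum]
    have hint : ∀ j ∈ Finset.range n,
        Integrable fun a => σ a * (u j a * (z ^ j * Complex.exp (b * z))) := fun j _ =>
      (hσ.mul ((hu j).mul continuous_const)).integrable_of_hasCompactSupport hs.mul_right
    rw [integral_finsetSum _ hint, eval_finsetSum, Finset.sum_mul]
    refine Finset.sum_congr rfl fun j _ => ?_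
    simp_rw [← mul_assoc]
    rw [integral_mul_const, integral_mul_const]
    simp

lemma IsWeightedPoly.reg {n : ℕ} {b : ℝ} (hb : b ≠ 0) {f : ℂ → ℂ} (hf : IsWeightedPoly n b f)
    {ρ : ℂ → ℂ} (hρ : ContDiff ℝ 1 ρ) (hs : HasCompactSupport ρ) :
    IsWeightedPoly n b (reg b⁻¹ ρ f) :=
  hf.weylAvg hb (continuous_regDensity _ hρ) (hs.mono' (support_regDensity_subset _ ρ))

/-! ### Weighted polynomials and their reproducing kernels -/

/-- The weighted polynomial `p(z) e^{bz - b²/2}`. The constant factor makes its squared modulus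
times `e^{-|z|²}` equal to `|p(z)|² e^{-|z - b|²}`. -/
def expPoly (b : ℝ) (p : ℂ[X]) (z : ℂ) : ℂ := p.eval z * Complex.exp (b * z - b ^ 2 / 2)

lemma isWeightedPoly_expPoly {n : ℕ} (b : ℝ) {p : ℂ[X]} (hp : p.degree < n) :
    IsWeightedPoly n b (expPoly b p) := by
  refine ⟨C (Complex.exp (-(b ^ 2 / 2))) * p, ?_, fun z => ?_⟩
  · rwa [degree_C_mul (Complex.exp_ne_zero _)]
  · rw [expPoly, eval_mul, eval_C, sub_eq_add_neg, Complex.exp_add]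
    ring

lemma IsWeightedPoly.exists_expPoly {n : ℕ} {b : ℝ} {f : ℂ → ℂ} (hf : IsWeightedPoly n b f) :
    ∃ p : ℂ[X], p.degree < n ∧ f = expPoly b p := by
  obtain ⟨p, hp, hfp⟩ := hf
  refine ⟨C (Complex.exp (b ^ 2 / 2)) * p, ?_, funext fun z => ?_⟩
  · rwa [degree_C_mul (Complex.exp_ne_zero _)]
  · have h : Complex.exp (b * z) = Complex.exp (b ^ 2 / 2) * Complex.exp (b * z - b ^ 2 / 2) := by
      rw [← Complex.exp_add, add_sub_cancel]
    rw [expPoly, eval_mul, eval_C, hfp, h]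
    ring

lemma expPoly_add (b : ℝ) (p q : ℂ[X]) : expPoly b (p + q) = expPoly b p + expPoly b q := by
  funext z
  simp [expPoly, add_mul]

lemma expPoly_sum_smul {ι : Type*} (b : ℝ) (s : Finset ι) (u : ι → ℂ) (p : ι → ℂ[X]) (z : ℂ) :
    expPoly b (∑ j ∈ s, u j • p j) z = ∑ j ∈ s, u j * expPoly b (p j) z := by
  simp only [expPoly, eval_finsetSum, eval_smul, smul_eq_mul, Finset.sum_mul, mul_assoc]

lemma differentiable_expPoly (b : ℝ) (p : ℂ[X]) : Differentiable ℂ (expPoly b p) :=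
  p.differentiable.mul (by fun_prop)

lemma norm_exp_mul_sub (b : ℝ) (z : ℂ) :
    ‖Complex.exp (b * z - b ^ 2 / 2)‖ = Real.exp (b * z.re - b ^ 2 / 2) := by
  have h : (b : ℂ) ^ 2 / 2 = ((b ^ 2 / 2 : ℝ) : ℂ) := by push_cast; ring
  rw [Complex.norm_exp, h, Complex.sub_re, Complex.re_ofReal_mul, Complex.ofReal_re]

lemma norm_expPoly_monomial_le (b : ℝ) (n : ℕ) (a z : ℂ) :
    ‖expPoly b (monomial n a) z‖ ≤ ‖a‖ * n.factorial * Real.exp ((1 + |b|) * ‖z‖) := by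
  have hpow : ‖z‖ ^ n ≤ n.factorial * Real.exp ‖z‖ := by
    have := Real.pow_div_factorial_le_exp ‖z‖ (norm_nonneg z) n
    rwa [div_le_iff₀' (by positivity)] at this
  have hre : b * z.re ≤ |b| * ‖z‖ :=
    (le_abs_self _).trans (abs_mul b z.re ▸
      mul_le_mul_of_nonneg_left (Complex.abs_re_le_norm z) (abs_nonneg b))
  rw [expPoly, eval_monomial, norm_mul, norm_mul, norm_pow, norm_exp_mul_sub]
  calc ‖a‖ * ‖z‖ ^ n * Real.exp (b * z.re - b ^ 2 / 2)
      ≤ ‖a‖ * (n.factorial * Real.exp ‖z‖) * Real.exp (|b| * ‖z‖) := by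
        gcongr
        linarith [sq_nonneg b]
    _ = ‖a‖ * n.factorial * Real.exp ((1 + |b|) * ‖z‖) := by
        rw [one_add_mul, Real.exp_add]
        ring

lemma exists_norm_expPoly_le (b : ℝ) (p : ℂ[X]) : ∃ K : ℝ, 0 ≤ K ∧
    ∀ z, ‖expPoly b p z‖ ≤ K * Real.exp ((1 + |b|) * ‖z‖) := by
  induction p using Polynomial.induction_on' with
  | add p q hp hq =>
    obtain ⟨K₁, h₁, hK₁⟩ := hp
    obtain ⟨K₂, h₂, hK₂⟩ := hq
    refine ⟨K₁ + K₂, by positivity, fun z => ?_⟩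
    rw [expPoly_add, add_mul]
    exact (norm_add_le _ _).trans (add_le_add (hK₁ z) (hK₂ z))
  | monomial n a => exact ⟨_, by positivity, norm_expPoly_monomial_le b n a⟩

lemma fockWeight_mul_sq_le (c : ℝ) {K t x : ℝ} (hx : 0 ≤ x) {z : ℂ}
    (h : x ≤ K * Real.exp (t * ‖z‖)) :
    fockWeight c z * x ^ 2 ≤ K ^ 2 * Real.exp (2 * t ^ 2) *
      (‖z‖ ^ (2 * c) * Real.exp (-(1 / 2) * ‖z‖ ^ 2)) := by
  have hexp : Real.exp (-‖z‖ ^ 2) * Real.exp (2 * (t * ‖z‖)) ≤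
      Real.exp (2 * t ^ 2) * Real.exp (-(1 / 2) * ‖z‖ ^ 2) := by
    rw [← Real.exp_add, ← Real.exp_add]
    refine Real.exp_le_exp.2 ?_
    nlinarith only [sq_nonneg (‖z‖ - 2 * t)]
  have hsq : x ^ 2 ≤ K ^ 2 * Real.exp (2 * (t * ‖z‖)) := by
    have := pow_le_pow_left₀ hx h 2
    rwa [mul_pow, ← Real.exp_nat_mul, Nat.cast_ofNat] at this
  calc fockWeight c z * x ^ 2
      ≤ fockWeight c z * (K ^ 2 * Real.exp (2 * (t * ‖z‖))) :=
        mul_le_mul_of_nonneg_left hsq (fockWeight_nonneg _ _)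
    _ = K ^ 2 * ‖z‖ ^ (2 * c) * (Real.exp (-‖z‖ ^ 2) * Real.exp (2 * (t * ‖z‖))) := by
        unfold fockWeight
        ring
    _ ≤ K ^ 2 * ‖z‖ ^ (2 * c) * (Real.exp (2 * t ^ 2) * Real.exp (-(1 / 2) * ‖z‖ ^ 2)) :=
        mul_le_mul_of_nonneg_left hexp (by positivity)
    _ = _ := by ring

lemma energy_ne_top_of_norm_le {c : ℝ} (hc : -1 < c) {f : ℂ → ℂ} {K t : ℝ}
    (hf : ∀ z, ‖f z‖ ≤ K * Real.exp (t * ‖z‖)) : energy c f ≠ ⊤ := by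
  have hle : energy c f ≤ ENNReal.ofReal Real.pi⁻¹ *
      (ENNReal.ofReal (K ^ 2 * Real.exp (2 * t ^ 2)) *
        ∫⁻ z : ℂ, ENNReal.ofReal (‖z‖ ^ (2 * c) * Real.exp (-(1 / 2) * ‖z‖ ^ 2))) := by
    unfold energy
    rw [lintegral_fockMeasure, lintegral_areaMeasure,
      ← lintegral_const_mul' (ENNReal.ofReal (K ^ 2 * _)) _ ENNReal.ofReal_ne_top]
    refine mul_le_mul_right (lintegral_mono fun z => ?_) _
    rw [← ofReal_norm, ← ENNReal.ofReal_pow (norm_nonneg _),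
      ← ENNReal.ofReal_mul (fockWeight_nonneg _ _), ← ENNReal.ofReal_mul (by positivity)]
    exact ENNReal.ofReal_le_ofReal (fockWeight_mul_sq_le c (norm_nonneg _) (hf z))
  exact ne_top_of_le_ne_top (ENNReal.mul_lt_top ENNReal.ofReal_lt_top
    (ENNReal.mul_lt_top ENNReal.ofReal_lt_top
      (lintegral_rpow_mul_exp_lt_top hc one_half_pos))).ne hle

lemma IsWeightedPoly.energy_ne_top {c : ℝ} (hc : -1 < c) {n : ℕ} {b : ℝ} {f : ℂ → ℂ}
    (hf : IsWeightedPoly n b f) : energy c f ≠ ⊤ := by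
  obtain ⟨p, -, rfl⟩ := hf.exists_expPoly
  obtain ⟨K, -, hK⟩ := exists_norm_expPoly_le b p
  exact energy_ne_top_of_norm_le hc hK

lemma IsWeightedPoly.integrable_mul_conj {c : ℝ} (hc : -1 < c) {n : ℕ} {b : ℝ} {f h : ℂ → ℂ}
    (hf : IsWeightedPoly n b f) (hh : Continuous h) (hhE : energy c h ≠ ⊤) :
    Integrable (fun z => h z * conj (f z)) (fockMeasure c) :=
  EdgeRecursion.integrable_mul_conj hh.aemeasurable hf.differentiable.continuous.aemeasurable hhE
    (hf.energy_ne_top hc)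

lemma integral_mul_conj_self (c : ℝ) {f : ℂ → ℂ} (hf : Continuous f) :
    ∫ z, f z * conj (f z) ∂fockMeasure c = ((energy c f).toReal : ℂ) := by
  have h : ∀ z, f z * conj (f z) = ((‖f z‖ ^ 2 : ℝ) : ℂ) := fun z => by
    rw [Complex.mul_conj']
    push_cast
    rfl
  simp_rw [h]
  rw [integral_complex_ofReal, integral_eq_lintegral_of_nonneg_ae
    (Eventually.of_forall fun z => by positivity) (by fun_prop)]
  congr 2
  refine lintegral_congr fun z => ?_
  rw [ENNReal.ofReal_pow (norm_nonneg _), ofReal_norm]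

lemma energy_le_of_integral_mul_conj_eq {c : ℝ} {f g : ℂ → ℂ} (hf : Continuous f)
    (hg : Continuous g) (hgE : energy c g ≠ ⊤)
    (h : ∫ z, g z * conj (g z) ∂fockMeasure c = ∫ z, f z * conj (g z) ∂fockMeasure c) :
    energy c g ≤ energy c f := by
  have hcs := sq_enorm_integral_mul_conj_le (fockMeasure c) hf.aemeasurable hg.aemeasurable
  rw [← h, integral_mul_conj_self c hg, ← ofReal_norm, Complex.norm_real,
    Real.norm_of_nonneg ENNReal.toReal_nonneg, ENNReal.ofReal_toReal hgE, sq] at hcs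
  by_cases h0 : energy c g = 0
  · exact h0 ▸ zero_le
  · exact (ENNReal.mul_le_mul_iff_left h0 hgE).1 hcs

lemma integral_mul_conj_sum {α ι : Type*} [MeasurableSpace α] {μ : Measure α} {f : α → ℂ}
    {φ : ι → α → ℂ} {s : Finset ι} (h : ∀ j ∈ s, Integrable (fun z => f z * conj (φ j z)) μ)
    (u : ι → ℂ) :
    ∫ z, f z * conj (∑ j ∈ s, u j * φ j z) ∂μ =
      ∑ j ∈ s, conj (u j) * ∫ z, f z * conj (φ j z) ∂μ := by
  simp only [map_sum, map_mul, Finset.mul_sum, mul_left_comm (f _)]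
  rw [integral_finsetSum _ fun j hj => (h j hj).const_mul _]
  simp only [integral_const_mul]

lemma conj_integral_mul_conj {α : Type*} [MeasurableSpace α] (μ : Measure α) (f g : α → ℂ) :
    conj (∫ z, f z * conj (g z) ∂μ) = ∫ z, g z * conj (f z) ∂μ := by
  rw [← integral_conj]
  simp only [map_mul, Complex.conj_conj, mul_comm]

/-- `L` is the reproducing kernel of the space of weighted polynomials in `L²(fockMeasure c)`. -/
structure IsReproducing (c : ℝ) (n : ℕ) (b : ℝ) (L : ℂ → ℂ → ℂ) : Prop where
  mem : ∀ w, IsWeightedPoly n b fun z => L z w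
  eval : ∀ f, IsWeightedPoly n b f → ∀ w, ∫ z, f z * conj (L z w) ∂fockMeasure c = f w

namespace IsReproducing

variable {c : ℝ} {n : ℕ} {b : ℝ} {L : ℂ → ℂ → ℂ}

lemma conj_symm (hL : IsReproducing c n b L) (z w : ℂ) : conj (L w z) = L z w := by
  rw [← hL.eval _ (hL.mem w) z, ← hL.eval _ (hL.mem z) w, conj_integral_mul_conj]

lemma self_eq (hL : IsReproducing c n b L) (w : ℂ) :
    L w w = ((energy c fun z => L z w).toReal : ℂ) := by
  rw [← integral_mul_conj_self c (hL.mem w).differentiable.continuous]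
  exact (hL.eval _ (hL.mem w) w).symm

lemma energy_eq (hc : -1 < c) (hL : IsReproducing c n b L) (w : ℂ) :
    energy c (fun z => L z w) = ‖L w w‖ₑ := by
  rw [hL.self_eq w, ← ofReal_norm, Complex.norm_real, Real.norm_of_nonneg ENNReal.toReal_nonneg,
    ENNReal.ofReal_toReal ((hL.mem w).energy_ne_top hc)]

lemma enorm_sq_le (hc : -1 < c) (hL : IsReproducing c n b L) {f : ℂ → ℂ}
    (hf : IsWeightedPoly n b f) (w : ℂ) : ‖f w‖ₑ ^ 2 ≤ energy c f * ‖L w w‖ₑ := by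
  have hcs := sq_enorm_integral_mul_conj_le (fockMeasure c)
    hf.differentiable.continuous.aemeasurable (hL.mem w).differentiable.continuous.aemeasurable
  rw [hL.eval f hf w] at hcs
  rwa [← hL.energy_eq hc w]

end IsReproducing

lemma exists_energy_kernel_le {c : ℝ} (hc : -1 < c) (M : ℝ) : ∃ A : ℝ≥0∞, A ≠ ⊤ ∧
    ∀ n b L, IsReproducing c n b L → ∀ w, ‖w‖ ≤ M → energy c (fun z => L z w) ≤ A := by
  obtain ⟨C, hC⟩ := exists_enorm_sq_le_energy c M
  refine ⟨C, ENNReal.coe_ne_top, fun n b L hL w hw => ?_⟩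
  have h := hC _ (hL.mem w).differentiable w hw
  rw [hL.energy_eq hc w, sq] at h
  rw [hL.energy_eq hc w]
  by_cases h0 : ‖L w w‖ₑ = 0
  · exact h0 ▸ zero_le
  · exact (ENNReal.mul_le_mul_iff_left h0 enorm_ne_top).1 h

/-- The kernel `∑_{j<n} ψ_j(z) conj ψ_j(w)` of the weighted polynomials
`ψ_j = p_j e^{bz - b²/2}`. -/
def sumKernel (b : ℝ) (n : ℕ) (p : ℕ → ℂ[X]) (z w : ℂ) : ℂ :=
  ∑ j ∈ Finset.range n, expPoly b (p j) z * conj (expPoly b (p j) w)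

lemma Q_eq (b : ℝ) (z : ℂ) : Q b z = ‖z‖ ^ 2 - 2 * (b * z.re) + b ^ 2 := by
  rw [Q, Complex.sq_norm, Complex.sq_norm, Complex.normSq_apply, Complex.normSq_apply,
    Complex.sub_re, Complex.sub_im, Complex.ofReal_re, Complex.ofReal_im]
  ring

lemma expPoly_mul_conj_mul_fockWeight (c b : ℝ) (p q : ℂ[X]) (z : ℂ) :
    expPoly b p z * conj (expPoly b q z) * (fockWeight c z : ℂ) =
      p.eval z * conj (q.eval z) *
        ((‖z‖ ^ (2 * c) * Real.exp (-((1 : ℕ) : ℝ) * Q b z) : ℝ) : ℂ) := by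
  have hsq : Complex.exp (b * z - b ^ 2 / 2) * conj (Complex.exp (b * z - b ^ 2 / 2)) =
      ((Real.exp (2 * (b * z.re) - b ^ 2) : ℝ) : ℂ) := by
    rw [Complex.mul_conj', norm_exp_mul_sub, ← Complex.ofReal_pow, ← Real.exp_nat_mul]
    push_cast
    ring_nf
  have hQ : Real.exp (2 * (b * z.re) - b ^ 2) * Real.exp (-‖z‖ ^ 2) =
      Real.exp (-((1 : ℕ) : ℝ) * Q b z) := by
    rw [← Real.exp_add, Q_eq]
    push_cast
    ring_nf
  rw [← hQ]
  simp only [expPoly, map_mul, fockWeight]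
  push_cast
  push_cast at hsq
  linear_combination (p.eval z * conj (q.eval z) * ((‖z‖ ^ (2 * c) : ℝ) : ℂ) *
    Complex.exp (-(‖z‖ : ℂ) ^ 2)) * hsq

lemma integral_expPoly_mul_conj (c b : ℝ) (p q : ℂ[X]) :
    ∫ z, expPoly b p z * conj (expPoly b q z) ∂fockMeasure c =
      ∫ z, p.eval z * conj (q.eval z) *
        ((‖z‖ ^ (2 * c) * Real.exp (-((1 : ℕ) : ℝ) * Q b z) : ℝ) : ℂ) ∂areaMeasure := by
  rw [integral_fockMeasure]
  simp_rw [expPoly_mul_conj_mul_fockWeight]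

namespace IsOrthonormalPolys

variable {c b : ℝ} {p : ℕ → ℂ[X]}

lemma integral_eq (hp : IsOrthonormalPolys c b 1 p) (j k : ℕ) :
    ∫ z, expPoly b (p j) z * conj (expPoly b (p k) z) ∂fockMeasure c =
      if j = k then 1 else 0 := by
  rw [integral_expPoly_mul_conj, hp.2 j k]

lemma isWeightedPoly (hp : IsOrthonormalPolys c b 1 p) {n j : ℕ} (hj : j < n) :
    IsWeightedPoly n b (expPoly b (p j)) :=
  isWeightedPoly_expPoly b (by rw [hp.1 j]; exact_mod_cast hj)

lemma isWeightedPoly_sum (hp : IsOrthonormalPolys c b 1 p) (n : ℕ) (u : ℕ → ℂ) :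
    IsWeightedPoly n b fun z => ∑ j ∈ Finset.range n, u j * expPoly b (p j) z := by
  simp_rw [← expPoly_sum_smul]
  refine isWeightedPoly_expPoly b (mem_degreeLT.1 (Submodule.sum_mem _ fun j hj =>
    Submodule.smul_mem _ _ (mem_degreeLT.2 ?_)))
  rw [hp.1 j]
  exact_mod_cast Finset.mem_range.1 hj

lemma exists_eq_sum (hp : IsOrthonormalPolys c b 1 p) {n : ℕ} {f : ℂ → ℂ}
    (hf : IsWeightedPoly n b f) :
    ∃ u : ℕ → ℂ, f = fun z => ∑ j ∈ Finset.range n, u j * expPoly b (p j) z := by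
  obtain ⟨q, hq, rfl⟩ := hf.exists_expPoly
  let s : Polynomial.Sequence ℂ := ⟨p, hp.1⟩
  have hspan := s.span_degreeLT (m := n) fun i _ => (leadingCoeff_ne_zero.2 (s.ne_zero i)).isUnit
  have hmem : q ∈ Submodule.span ℂ (s '' (Finset.range n : Set ℕ)) := by
    rw [Finset.coe_range, hspan]
    exact mem_degreeLT.2 hq
  obtain ⟨u, rfl⟩ := Submodule.mem_span_image_finset_iff_exists_fun' ℂ |>.1 hmem
  exact ⟨u, funext fun z => expPoly_sum_smul b _ u p z⟩

lemma integral_sum_mul_conj (hc : -1 < c) (hp : IsOrthonormalPolys c b 1 p) {n j : ℕ}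
    (hj : j ∈ Finset.range n) (u : ℕ → ℂ) :
    ∫ z, (∑ i ∈ Finset.range n, u i * expPoly b (p i) z) * conj (expPoly b (p j) z)
      ∂fockMeasure c = u j := by
  have hψ : ∀ i, IsWeightedPoly (i + 1) b (expPoly b (p i)) := fun i =>
    hp.isWeightedPoly i.lt_succ_self
  simp only [Finset.sum_mul, mul_assoc]
  rw [integral_finsetSum _ fun i _ => ((hψ j).integrable_mul_conj hc
    (hψ i).differentiable.continuous ((hψ i).energy_ne_top hc)).const_mul _]
  simp_rw [integral_const_mul, hp.integral_eq]
  simp [Finset.mem_range.1 hj]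

lemma integral_mul_conj_sumKernel (hc : -1 < c) (hp : IsOrthonormalPolys c b 1 p) (n : ℕ)
    {h : ℂ → ℂ} (hh : Continuous h) (hhE : energy c h ≠ ⊤) (w : ℂ) :
    ∫ z, h z * conj (sumKernel b n p z w) ∂fockMeasure c = ∑ j ∈ Finset.range n,
      (∫ z, h z * conj (expPoly b (p j) z) ∂fockMeasure c) * expPoly b (p j) w := by
  have hint := integral_mul_conj_sum (s := Finset.range n) (fun j hj => (hp.isWeightedPoly
    (Finset.mem_range.1 hj)).integrable_mul_conj hc hh hhE) fun j => conj (expPoly b (p j) w)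
  simpa only [sumKernel, mul_comm, Complex.conj_conj] using hint

lemma isReproducing (hc : -1 < c) (hp : IsOrthonormalPolys c b 1 p) (n : ℕ) :
    IsReproducing c n b (sumKernel b n p) := by
  refine ⟨fun w => ?_, fun f hf w => ?_⟩
  · simpa only [sumKernel, mul_comm] using
      hp.isWeightedPoly_sum n fun j => conj (expPoly b (p j) w)
  · rw [hp.integral_mul_conj_sumKernel hc n hf.differentiable.continuous (hf.energy_ne_top hc)]
    obtain ⟨u, rfl⟩ := hp.exists_eq_sum hf
    exact Finset.sum_congr rfl fun j hj => by rw [hp.integral_sum_mul_conj hc hj]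

lemma projection (hc : -1 < c) (hp : IsOrthonormalPolys c b 1 p) (n : ℕ) {h : ℂ → ℂ}
    (hh : Continuous h) (hhE : energy c h ≠ ⊤) :
    IsWeightedPoly n b (fun w => ∫ z, h z * conj (sumKernel b n p z w) ∂fockMeasure c) ∧
      energy c (fun w => ∫ z, h z * conj (sumKernel b n p z w) ∂fockMeasure c) ≤ energy c h := by
  simp_rw [hp.integral_mul_conj_sumKernel hc n hh hhE]
  set u : ℕ → ℂ := fun j => ∫ z, h z * conj (expPoly b (p j) z) ∂fockMeasure c
  have hg := hp.isWeightedPoly_sum n u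
  have hgc := hg.differentiable.continuous
  have hψ : ∀ j ∈ Finset.range n, IsWeightedPoly n b (expPoly b (p j)) := fun j hj =>
    hp.isWeightedPoly (Finset.mem_range.1 hj)
  refine ⟨hg, energy_le_of_integral_mul_conj_eq hh hgc (hg.energy_ne_top hc) ?_⟩
  rw [integral_mul_conj_sum fun j hj => (hψ j hj).integrable_mul_conj hc hgc (hg.energy_ne_top hc),
    integral_mul_conj_sum fun j hj => (hψ j hj).integrable_mul_conj hc hh hhE]
  exact Finset.sum_congr rfl fun j hj => by rw [hp.integral_sum_mul_conj hc hj]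

end IsOrthonormalPolys

/-! ### Limits of weighted polynomials -/

/-- `h` is the pointwise limit of weighted polynomials of degree less than `n k` and exponent `b k`
whose energies of charge `s` are bounded. -/
def IsWeightedPolyLimit (n : ℕ → ℕ) (b : ℕ → ℝ) (s : ℝ) (h : ℂ → ℂ) : Prop :=
  ∃ (u : ℕ → ℂ → ℂ) (A : ℝ≥0∞), A ≠ ⊤ ∧ (∀ᶠ k in atTop, IsWeightedPoly (n k) (b k) (u k)) ∧
    (∀ᶠ k in atTop, u k ∈ energyBall s A) ∧ ∀ z, Tendsto (fun k => u k z) atTop (𝓝 (h z))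

lemma energy_reg_zero_ne_top {c : ℝ} (hc : -1 < c) {h : ℂ → ℂ} (hh : Differentiable ℂ h)
    (hhE : energy c h ≠ ⊤) {ε : ℝ} (hε : ε ≤ 1 / 3) (ρ : Mollifier ε) :
    energy c (reg 0 ρ h) ≠ ⊤ := by
  obtain ⟨C, hC⟩ := exists_energy_reg_le hc
  obtain ⟨δ₀, hδ₀, hle⟩ := hC _ ρ hε
  exact ne_top_of_le_ne_top (ENNReal.mul_ne_top ENNReal.coe_ne_top hhE) (hle 0 le_rfl hδ₀.le h hh)

lemma exists_mollifier_seq : ∃ (ε : ℕ → ℝ) (_ : ∀ k, Mollifier (ε k)),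
    (∀ k, ε k ≤ 1 / 3) ∧ Tendsto ε atTop (𝓝 0) := by
  have hε : ∀ k : ℕ, 0 < 1 / ((k : ℝ) + 3) := fun k => by positivity
  refine ⟨fun k => 1 / ((k : ℝ) + 3), fun k => (nonempty_mollifier (hε k)).some,
    fun k => ?_, ?_⟩
  · exact one_div_le_one_div_of_le (by norm_num) (by linarith [Nat.cast_nonneg (α := ℝ) k])
  · have : Tendsto (fun k : ℕ => (k : ℝ) + 3) atTop atTop :=
      tendsto_atTop_add_const_right _ _ tendsto_natCast_atTop_atTop
    simpa [Function.comp_def] using tendsto_inv_atTop_zero.comp this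

section Limit

variable {c c₀ s : ℝ} {n : ℕ → ℕ} {b : ℕ → ℝ} {h : ℂ → ℂ} {p : ℕ → ℕ → ℂ[X]} {L₀ : ℂ → ℂ → ℂ}
  {L : ℕ → ℂ → ℂ → ℂ}

lemma isWeightedPolyLimit_of_isReproducing (hc : -1 < c)
    (hL : ∀ k, IsReproducing c (n k) (b k) (L k)) {w : ℂ} {f : ℂ → ℂ}
    (hf : ∀ z, Tendsto (fun k => L k z w) atTop (𝓝 (f z))) : IsWeightedPolyLimit n b c f := by
  obtain ⟨A, hA, hAle⟩ := exists_energy_kernel_le hc ‖w‖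
  exact ⟨fun k z => L k z w, A, hA, Eventually.of_forall fun k => (hL k).mem w,
    Eventually.of_forall fun k => ⟨((hL k).mem w).differentiable, hAle _ _ _ (hL k) w le_rfl⟩, hf⟩

namespace IsWeightedPolyLimit

lemma exists_mem_energyBall (hh : IsWeightedPolyLimit n b s h) :
    ∃ A : ℝ≥0∞, A ≠ ⊤ ∧ h ∈ energyBall s A := by
  obtain ⟨u, A, hA, -, huA, hlim⟩ := hh
  exact ⟨A, hA, mem_energyBall_of_tendsto hA huA hlim⟩

lemma differentiable (hh : IsWeightedPolyLimit n b s h) : Differentiable ℂ h := by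
  obtain ⟨A, -, hhA⟩ := hh.exists_mem_energyBall
  exact hhA.1

lemma energy_ne_top (hh : IsWeightedPolyLimit n b s h) : energy s h ≠ ⊤ := by
  obtain ⟨A, hA, hhA⟩ := hh.exists_mem_energyBall
  exact ne_top_of_le_ne_top hA hhA.2

lemma comp (hh : IsWeightedPolyLimit n b s h) {φ : ℕ → ℕ} (hφ : Tendsto φ atTop atTop) :
    IsWeightedPolyLimit (n ∘ φ) (b ∘ φ) s h := by
  obtain ⟨u, A, hA, hu, huA, hlim⟩ := hh
  exact ⟨u ∘ φ, A, hA, hφ.eventually hu, hφ.eventually huA, fun z => (hlim z).comp hφ⟩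

lemma mono {s' : ℝ} (hs' : -1 < s') (hss : s' ≤ s) (hh : IsWeightedPolyLimit n b s h) :
    IsWeightedPolyLimit n b s' h := by
  obtain ⟨u, A, hA, hu, huA, hlim⟩ := hh
  obtain ⟨C, hC⟩ := exists_energy_le_energy hs' hss
  exact ⟨u, C * A, ENNReal.mul_ne_top ENNReal.coe_ne_top hA, hu,
    huA.mono fun k hk => ⟨hk.1, (hC _ hk.1).trans (mul_le_mul_right hk.2 _)⟩, hlim⟩

lemma reg (hs : -1 < s) (hb : Tendsto b atTop atTop) (hh : IsWeightedPolyLimit n b s h) {ε : ℝ}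
    (hε : ε ≤ 1 / 3) (ρ : Mollifier ε) : IsWeightedPolyLimit n b (s + 1) (reg 0 ρ h) := by
  obtain ⟨u, A, hA, hu, huA, hlim⟩ := hh
  obtain ⟨C, hC⟩ := exists_energy_add_one_reg_le hs ρ hε
  have hreg : ∀ᶠ k in atTop, IsWeightedPoly (n k) (b k) (EdgeRecursion.reg (b k)⁻¹ ρ (u k)) := by
    filter_upwards [hu, hb.eventually_gt_atTop 0] with k hk hbk
    exact hk.reg hbk.ne' ρ.contDiff ρ.hasCompactSupport
  refine ⟨fun k => EdgeRecursion.reg (b k)⁻¹ ρ (u k), C * A,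
    ENNReal.mul_ne_top ENNReal.coe_ne_top hA, hreg, ?_, fun z => tendsto_reg hA (by simp)
      (tendsto_inv_atTop_zero.comp hb) huA hlim ρ.contDiff ρ.hasCompactSupport z⟩
  filter_upwards [hreg, huA, hb.eventually_ge_atTop 3] with k hk hukA hbk
  refine ⟨hk.differentiable, (hC _ (by positivity) ?_ _ hukA.1).trans
    (mul_le_mul_right hukA.2 _)⟩
  rw [inv_le_comm₀ (by linarith) (by norm_num)]
  linarith

lemma eval_eq_integral (hc : -1 < c) (hL : ∀ k, IsReproducing c (n k) (b k) (L k)) {w : ℂ}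
    {f : ℂ → ℂ} (hf : ∀ z, Tendsto (fun k => L k z w) atTop (𝓝 (f z)))
    (hh : IsWeightedPolyLimit n b (c + 1) h) :
    h w = ∫ z, h z * conj (f z) ∂fockMeasure c := by
  obtain ⟨A, hA, hAle⟩ := exists_energy_kernel_le hc ‖w‖
  obtain ⟨u, B, hB, hu, huB, hlim⟩ := hh
  obtain ⟨C, hC⟩ := exists_energy_le_energy hc (c₂ := c + 1) (by linarith)
  have huA : ∀ᶠ k in atTop, u k ∈ energyBall c (A + C * B) := huB.mono fun k hk =>
    ⟨hk.1, ((hC _ hk.1).trans (mul_le_mul_right hk.2 _)).trans le_add_self⟩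
  have hLA : ∀ᶠ k in atTop, (fun z => L k z w) ∈ energyBall c (A + C * B) :=
    Eventually.of_forall fun k => ⟨((hL k).mem w).differentiable,
      (hAle _ _ _ (hL k) w le_rfl).trans le_self_add⟩
  have hint := tendsto_integral_mul_conj hc
    (ENNReal.add_ne_top.2 ⟨hA, ENNReal.mul_ne_top ENNReal.coe_ne_top hB⟩) huA hLA hlim hf
    (tight_of_energy_add_one_le hB (huB.mono fun k hk => hk.2))
  exact tendsto_nhds_unique (hlim w) (hint.congr' (hu.mono fun k hk => (hL k).eval _ hk w))

-- The projections of `h` onto the weighted polynomials of index `k` converge for the whole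
-- sequence, and the reproducing property along the subsequence identifies their limit as `h`.
lemma of_subseq (hc : -1 < c) (hp : ∀ k, IsOrthonormalPolys c (b k) 1 (p k))
    (hL₀ : ∀ z w, Tendsto (fun k => sumKernel (b k) (n k) (p k) z w) atTop (𝓝 (L₀ z w)))
    {φ : ℕ → ℕ} (hφ : Tendsto φ atTop atTop)
    (hh : IsWeightedPolyLimit (n ∘ φ) (b ∘ φ) (c + 1) h) : IsWeightedPolyLimit n b c h := by
  have hE := (hh.mono hc (by linarith)).energy_ne_top
  have hd := hh.differentiable
  have hL := fun k => (hp k).isReproducing hc (n k)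
  have hproj := fun k => (hp k).projection hc (n k) hd.continuous hE
  refine ⟨fun k w => ∫ z, h z * conj (sumKernel (b k) (n k) (p k) z w) ∂fockMeasure c,
    energy c h, hE, Eventually.of_forall fun k => (hproj k).1,
    Eventually.of_forall fun k => ⟨(hproj k).1.differentiable, (hproj k).2⟩, fun w => ?_⟩
  obtain ⟨A, hA, hAle⟩ := exists_energy_kernel_le hc ‖w‖
  rw [hh.eval_eq_integral hc (fun k => hL (φ k)) (fun z => (hL₀ z w).comp hφ)]
  exact tendsto_integral_mul_conj hc (ENNReal.add_ne_top.2 ⟨hA, hE⟩)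
    (Eventually.of_forall fun _ => ⟨hd, le_add_self⟩)
    (Eventually.of_forall fun k => ⟨((hL k).mem w).differentiable,
      (hAle _ _ _ (hL k) w le_rfl).trans le_self_add⟩)
    (fun z => tendsto_const_nhds) (fun z => hL₀ z w) (tight_const hE)

end IsWeightedPolyLimit

lemma energy_sub_ne_top {f g : ℂ → ℂ} (hf : Measurable f) (hfE : energy c f ≠ ⊤)
    (hgE : energy c g ≠ ⊤) : energy c (fun z => f z - g z) ≠ ⊤ := by
  have hle : energy c (fun z => f z - g z) ≤
      ∫⁻ z, 2 * (‖f z‖ₑ ^ 2 + ‖g z‖ₑ ^ 2) ∂fockMeasure c := by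
    refine lintegral_mono fun z => (pow_le_pow_left' enorm_sub_le 2).trans ?_
    have := ENNReal.rpow_add_le_mul_rpow_add_rpow ‖f z‖ₑ ‖g z‖ₑ (p := (2 : ℕ)) (by norm_num)
    norm_num at this
    exact_mod_cast this
  refine ne_top_of_le_ne_top ?_ hle
  rw [lintegral_const_mul' _ _ ENNReal.ofNat_ne_top, lintegral_add_left (hf.enorm.pow_const 2)]
  exact ENNReal.mul_ne_top ENNReal.ofNat_ne_top (ENNReal.add_ne_top.2 ⟨hfE, hgE⟩)

lemma eq_zero_of_energy_eq_zero {f : ℂ → ℂ} (hf : Differentiable ℂ f) (hE : energy c f = 0)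
    (z : ℂ) : f z = 0 := by
  obtain ⟨C, hC⟩ := exists_enorm_sq_le_energy c ‖z‖
  simpa [hE] using hC f hf z le_rfl

lemma integral_mul_conj_eq_zero_of_reg (hc : -1 < c) {d : ℂ → ℂ} (hh : Differentiable ℂ h)
    (hhE : energy c h ≠ ⊤) (hd : Differentiable ℂ d) (hdE : energy c d ≠ ⊤)
    (H : ∀ ε : ℝ, ε ≤ 1 / 3 → ∀ ρ : Mollifier ε, Differentiable ℂ (reg 0 ρ h) ∧
      ∫ z, d z * conj (reg 0 ρ h z) ∂fockMeasure c = 0) :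
    ∫ z, d z * conj (h z) ∂fockMeasure c = 0 := by
  obtain ⟨C, hC⟩ := exists_energy_reg_le hc
  obtain ⟨ε, ρ, hε, hεlim⟩ := exists_mollifier_seq
  have hA : (C : ℝ≥0∞) * energy c h + energy c d ≠ ⊤ :=
    ENNReal.add_ne_top.2 ⟨ENNReal.mul_ne_top ENNReal.coe_ne_top hhE, hdE⟩
  have hreg : ∀ k, reg 0 (ρ k) h ∈ energyBall c (C * energy c h + energy c d) := fun k => by
    obtain ⟨δ₀, hδ₀, hle⟩ := hC _ (ρ k) (hε k)
    exact ⟨(H _ (hε k) (ρ k)).1, (hle 0 le_rfl hδ₀.le h hh).trans le_self_add⟩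
  have hlim := tendsto_integral_mul_conj hc hA
    (Eventually.of_forall fun _ => ⟨hd, le_add_self⟩) (Eventually.of_forall hreg)
    (fun z => tendsto_const_nhds) (tendsto_reg_zero hh.continuous hεlim ρ) (tight_const hdE)
  simp_rw [fun k => (H _ (hε k) (ρ k)).2] at hlim
  exact tendsto_nhds_unique hlim tendsto_const_nhds

lemma integral_mul_conj_eq_zero_of_add_natCast (hc : -1 < c) (hb : Tendsto b atTop atTop)
    {d : ℂ → ℂ} (hd : Differentiable ℂ d) (hdE : energy c d ≠ ⊤) (m : ℕ) (hs : -1 < s)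
    (H : ∀ h, IsWeightedPolyLimit n b (s + m) h → energy c h ≠ ⊤ →
      ∫ z, d z * conj (h z) ∂fockMeasure c = 0)
    (hh : IsWeightedPolyLimit n b s h) (hhE : energy c h ≠ ⊤) :
    ∫ z, d z * conj (h z) ∂fockMeasure c = 0 := by
  induction m generalizing s h with
  | zero => exact H h (by simpa using hh) hhE
  | succ m ih =>
    refine integral_mul_conj_eq_zero_of_reg hc hh.differentiable hhE hd hdE fun ε hε ρ => ?_
    have hr := hh.reg hs hb hε ρ
    refine ⟨hr.differentiable, ih (s := s + 1) (by linarith) (fun h hh => H h ?_) hr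
      (energy_reg_zero_ne_top hc hh.differentiable hhE hε ρ)⟩
    rwa [Nat.cast_succ, add_comm (m : ℝ), ← add_assoc]

-- Regularising raises the charge of a subsequential limit until it is a limit along the whole
-- sequence; regularising further raises the charge above `c + 1`.
lemma integral_mul_conj_eq_zero_of_subseq (hc : -1 < c) (hc₀ : -1 < c₀)
    (hb : Tendsto b atTop atTop) (hp : ∀ k, IsOrthonormalPolys c₀ (b k) 1 (p k))
    (hL₀ : ∀ z w, Tendsto (fun k => sumKernel (b k) (n k) (p k) z w) atTop (𝓝 (L₀ z w)))
    {d : ℂ → ℂ} (hd : Differentiable ℂ d) (hdE : energy c d ≠ ⊤)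
    (H : ∀ h, IsWeightedPolyLimit n b (c + 1) h → ∫ z, d z * conj (h z) ∂fockMeasure c = 0)
    {φ : ℕ → ℕ} (hφ : Tendsto φ atTop atTop) (hh : IsWeightedPolyLimit (n ∘ φ) (b ∘ φ) c h) :
    ∫ z, d z * conj (h z) ∂fockMeasure c = 0 := by
  obtain ⟨m, hm⟩ := exists_nat_ge (c₀ + 1 - c)
  obtain ⟨m₀, hm₀⟩ := exists_nat_ge (c + 1 - c₀)
  refine integral_mul_conj_eq_zero_of_add_natCast hc (hb.comp hφ) hd hdE m hc
    (fun h hh hhE => ?_) hh hh.energy_ne_top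
  have hh₀ : IsWeightedPolyLimit n b c₀ h :=
    .of_subseq hc₀ hp hL₀ hφ (hh.mono (by linarith) (by linarith))
  exact integral_mul_conj_eq_zero_of_add_natCast hc hb hd hdE m₀ hc₀
    (fun h hh _ => H h (hh.mono (by linarith) (by linarith))) hh₀ hhE

lemma kernel_limit_unique (hc : -1 < c) (hc₀ : -1 < c₀) (hb : Tendsto b atTop atTop)
    (hp : ∀ k, IsOrthonormalPolys c₀ (b k) 1 (p k))
    (hL₀ : ∀ z w, Tendsto (fun k => sumKernel (b k) (n k) (p k) z w) atTop (𝓝 (L₀ z w)))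
    (hL : ∀ k, IsReproducing c (n k) (b k) (L k)) {w : ℂ} {φ ψ : ℕ → ℕ}
    (hφ : Tendsto φ atTop atTop) (hψ : Tendsto ψ atTop atTop) {f g : ℂ → ℂ}
    (hf : ∀ z, Tendsto (fun k => L (φ k) z w) atTop (𝓝 (f z)))
    (hg : ∀ z, Tendsto (fun k => L (ψ k) z w) atTop (𝓝 (g z))) : f = g := by
  have hfl : IsWeightedPolyLimit (n ∘ φ) (b ∘ φ) c f :=
    isWeightedPolyLimit_of_isReproducing hc (fun k => hL (φ k)) hf
  have hgl : IsWeightedPolyLimit (n ∘ ψ) (b ∘ ψ) c g :=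
    isWeightedPolyLimit_of_isReproducing hc (fun k => hL (ψ k)) hg
  set d : ℂ → ℂ := fun z => f z - g z with hd
  have hdd : Differentiable ℂ d := hfl.differentiable.sub hgl.differentiable
  have hdE : energy c d ≠ ⊤ :=
    energy_sub_ne_top hfl.differentiable.continuous.measurable hfl.energy_ne_top hgl.energy_ne_top
  have hsub : ∀ h : ℂ → ℂ, Differentiable ℂ h → energy c h ≠ ⊤ →
      ∫ z, h z * conj (d z) ∂fockMeasure c =
        (∫ z, h z * conj (f z) ∂fockMeasure c) - ∫ z, h z * conj (g z) ∂fockMeasure c := by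
    intro h hh hhE
    simp only [hd, map_sub, mul_sub]
    exact integral_sub (integrable_mul_conj hh.continuous.aemeasurable
      hfl.differentiable.continuous.aemeasurable hhE hfl.energy_ne_top)
      (integrable_mul_conj hh.continuous.aemeasurable
      hgl.differentiable.continuous.aemeasurable hhE hgl.energy_ne_top)
  have hbase : ∀ h, IsWeightedPolyLimit n b (c + 1) h →
      ∫ z, d z * conj (h z) ∂fockMeasure c = 0 := fun h hh => by
    rw [← conj_integral_mul_conj,
      hsub h hh.differentiable (hh.mono hc (by linarith)).energy_ne_top,
      ← (hh.comp hφ).eval_eq_integral hc (fun k => hL (φ k)) hf,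
      ← (hh.comp hψ).eval_eq_integral hc (fun k => hL (ψ k)) hg, sub_self, map_zero]
  have hzero : ∫ z, d z * conj (d z) ∂fockMeasure c = 0 := by
    rw [hsub d hdd hdE,
      integral_mul_conj_eq_zero_of_subseq hc hc₀ hb hp hL₀ hdd hdE hbase hφ hfl,
      integral_mul_conj_eq_zero_of_subseq hc hc₀ hb hp hL₀ hdd hdE hbase hψ hgl, sub_zero]
  rw [integral_mul_conj_self c hdd.continuous, Complex.ofReal_eq_zero,
    ENNReal.toReal_eq_zero_iff] at hzero
  exact funext fun z =>
    sub_eq_zero.1 (eq_zero_of_energy_eq_zero hdd (hzero.resolve_right hdE) z)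

lemma exists_kernel_limit (hc : -1 < c) (hc₀ : -1 < c₀) (hb : Tendsto b atTop atTop)
    (hp : ∀ k, IsOrthonormalPolys c₀ (b k) 1 (p k))
    (hL₀ : ∀ z w, Tendsto (fun k => sumKernel (b k) (n k) (p k) z w) atTop (𝓝 (L₀ z w)))
    (hL : ∀ k, IsReproducing c (n k) (b k) (L k)) :
    ∃ K : ℂ → ℂ → ℂ, ∀ z w, Tendsto (fun k => L k z w) atTop (𝓝 (K z w)) := by
  suffices ∀ w, ∃ f : ℂ → ℂ, ∀ z, Tendsto (fun k => L k z w) atTop (𝓝 (f z)) by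
    choose K hK using this
    exact ⟨fun z w => K w z, fun z w => hK w z⟩
  intro w
  obtain ⟨A, hA, hAle⟩ := exists_energy_kernel_le hc ‖w‖
  have hsub : ∀ χ : ℕ → ℕ, ∃ (g : ℂ → ℂ) (φ : ℕ → ℕ), StrictMono φ ∧
      ∀ z, Tendsto (fun k => L (χ (φ k)) z w) atTop (𝓝 (g z)) := fun χ =>
    exists_subseq_tendsto_of_mem_energyBall hA (f := fun k z => L (χ k) z w)
      fun k => ⟨((hL (χ k)).mem w).differentiable, hAle _ _ _ (hL (χ k)) w le_rfl⟩
  obtain ⟨f, φ, hφ, hf⟩ := hsub id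
  refine ⟨f, fun z => tendsto_of_subseq_tendsto fun χ hχ => ?_⟩
  obtain ⟨g, ψ, hψ, hg⟩ := hsub χ
  refine ⟨ψ, ?_⟩
  rw [kernel_limit_unique hc hc₀ hb hp hL₀ hL hφ.tendsto_atTop (hχ.comp hψ.tendsto_atTop) hf hg]
  exact hg z

lemma exists_isWeightedPolyLimit_apply_zero_ne_zero (hs : -1 < s) (hb : Tendsto b atTop atTop)
    (hh : IsWeightedPolyLimit n b s h) (h0 : h 0 ≠ 0) (j : ℕ) :
    ∃ h, IsWeightedPolyLimit n b (s + j) h ∧ h 0 ≠ 0 := by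
  induction j with
  | zero => exact ⟨h, by simpa using hh, h0⟩
  | succ j ih =>
    obtain ⟨h, hh, h0⟩ := ih
    obtain ⟨ε, ρ, hε, hεlim⟩ := exists_mollifier_seq
    obtain ⟨k, hk⟩ := ((tendsto_reg_zero hh.differentiable.continuous hεlim ρ 0).eventually_ne
      h0).exists
    refine ⟨_, ?_, hk⟩
    rw [Nat.cast_succ, ← add_assoc]
    exact hh.reg (by linarith [Nat.cast_nonneg (α := ℝ) j]) hb (hε k) (ρ k)

lemma kernel_limit_ne_zero (hc : -1 < c) (hL : ∀ k, IsReproducing c (n k) (b k) (L k))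
    {K : ℂ → ℂ → ℂ} {w : ℂ} (hK : Tendsto (fun k => L k w w) atTop (𝓝 (K w w)))
    (hh : IsWeightedPolyLimit n b c h) (hhw : h w ≠ 0) : K w w ≠ 0 := by
  obtain ⟨u, A, hA, hu, huA, hlim⟩ := hh
  intro hK0
  have hz : Tendsto (fun k => A * ‖L k w w‖ₑ) atTop (𝓝 0) := by
    simpa [hK0] using ENNReal.Tendsto.const_mul (a := A) hK.enorm (Or.inr hA)
  have hsq : Tendsto (fun k => ‖u k w‖ₑ ^ 2) atTop (𝓝 0) := by
    refine tendsto_of_tendsto_of_tendsto_of_le_of_le' tendsto_const_nhds hz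
      (Eventually.of_forall fun k => zero_le) ?_
    filter_upwards [hu, huA] with k hk hkA
    exact ((hL k).enorm_sq_le hc hk w).trans (mul_le_mul_left hkA.2 _)
  have := tendsto_nhds_unique hsq (ENNReal.Tendsto.pow (n := 2) (hlim w).enorm)
  rw [eq_comm, pow_eq_zero_iff two_ne_zero, enorm_eq_zero] at this
  exact hhw this

end Limit

/-! ### The truncated exponential series at its transition point -/

/-- The truncated exponential series `e^{-x} ∑_{j<n} x^j / j!`. -/
def expTail (n : ℕ) (x : ℂ) : ℂ := Complex.exp (-x) * ∑ j ∈ Finset.range n, x ^ j / j.factorial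

lemma hasDerivAt_expTail (m : ℕ) (x : ℂ) :
    HasDerivAt (expTail (m + 1)) (-(Complex.exp (-x) * (x ^ m / m.factorial))) x := by
  have hexp : HasDerivAt (fun x : ℂ => Complex.exp (-x)) (-Complex.exp (-x)) x := by
    simpa using (hasDerivAt_neg x).cexp
  induction m with
  | zero =>
    have : expTail (0 + 1) = fun x => Complex.exp (-x) := by funext x; simp [expTail]
    rw [this]
    simpa using hexp
  | succ m ih =>
    have : expTail (m + 1 + 1) = expTail (m + 1) +
        fun x => Complex.exp (-x) * (x ^ (m + 1) / (m + 1).factorial) := by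
      funext x
      rw [Pi.add_apply, expTail, Finset.sum_range_succ, mul_add, expTail]
    rw [this]
    refine (ih.add (hexp.mul ((hasDerivAt_pow (m + 1) x).div_const _))).congr_deriv ?_
    have h1 : (m.factorial : ℂ) ≠ 0 := by exact_mod_cast m.factorial_ne_zero
    have h2 : (m + 1 : ℂ) ≠ 0 := by exact_mod_cast m.succ_ne_zero
    rw [Nat.factorial_succ]
    push_cast
    field_simp
    ring

/-- The truncated exponential series around its transition point `n`, in the scale `√n`. -/
def scaledTail (n : ℕ) (τ : ℂ) : ℂ := expTail n (n + (√n : ℝ) * τ)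

/-- The Stirling ratio `√n n^n e^{-n} / n!`, whose limit is `(2π)^{-1/2}`. -/
def stirlingConst (n : ℕ) : ℝ := √n * (n ^ n * Real.exp (-n) / n.factorial)

/-- Minus the derivative of `scaledTail`; it converges to the Gaussian density. -/
def scaledDensity (n : ℕ) (τ : ℂ) : ℂ :=
  stirlingConst n * (Complex.exp (-((√n : ℝ) * τ)) * (1 + τ / (√n : ℝ)) ^ (n - 1))

lemma hasDerivAt_scaledTail {n : ℕ} (hn : 1 ≤ n) (τ : ℂ) :
    HasDerivAt (scaledTail n) (-scaledDensity n τ) τ := by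
  obtain ⟨m, rfl⟩ : ∃ m, n = m + 1 := ⟨n - 1, by omega⟩
  have h1 : HasDerivAt (fun τ : ℂ => ((m + 1 : ℕ) : ℂ) + (√(m + 1 : ℕ) : ℝ) * τ)
      (√(m + 1 : ℕ) : ℝ) τ := by
    simpa using ((hasDerivAt_id τ).const_mul ((√(m + 1 : ℕ) : ℝ) : ℂ)).const_add ((m + 1 : ℕ) : ℂ)
  refine ((hasDerivAt_expTail m _).comp τ h1).congr_deriv ?_
  have hs : (0 : ℝ) < √(m + 1 : ℕ) := by positivity
  set s : ℝ := √(m + 1 : ℕ) with hsdef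
  have hss : ((m + 1 : ℕ) : ℂ) = (s : ℂ) ^ 2 := by
    rw [← Complex.ofReal_pow, hsdef, Real.sq_sqrt (by positivity)]; simp
  have hs0 : (s : ℂ) ≠ 0 := by exact_mod_cast hs.ne'
  have h2 : ((m + 1 : ℕ) : ℂ) + s * τ = (m + 1 : ℕ) * (1 + τ / s) := by
    rw [hss]; field_simp
  have h3 : (m.factorial : ℂ) ≠ 0 := by exact_mod_cast m.factorial_ne_zero
  have h4 : ((m + 1 : ℕ) : ℂ) ≠ 0 := by exact_mod_cast m.succ_ne_zero
  rw [neg_add, Complex.exp_add, h2, mul_pow, scaledDensity, stirlingConst, Nat.factorial_succ]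
  have hs' : √((m : ℝ) + 1) = s := by rw [hsdef]; push_cast; rfl
  push_cast at h4 ⊢
  simp only [hs']
  field_simp
  ring_nf

lemma continuous_scaledDensity (n : ℕ) : Continuous (scaledDensity n) := by
  unfold scaledDensity; fun_prop

lemma tendsto_stirlingConst : Tendsto stirlingConst atTop (𝓝 (√(2 * Real.pi))⁻¹) := by
  have h := (Stirling.tendsto_stirlingSeq_sqrt_pi.const_mul (√2)).inv₀ (by positivity)
  rw [← Real.sqrt_mul (by norm_num)] at h
  refine h.congr' ?_
  filter_upwards [eventually_ge_atTop 1] with n hn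
  have hn0 : (0 : ℝ) < n := by exact_mod_cast hn
  rw [Stirling.stirlingSeq, stirlingConst, Real.sqrt_mul (by norm_num), div_pow, Real.exp_neg,
    ← Real.exp_nat_mul, mul_one]
  have := (Real.sqrt_pos.2 hn0).ne'
  field_simp

lemma scaledDensity_eq {n : ℕ} (hn : 1 ≤ n) {τ : ℂ} (hτ : 1 + τ / (√n : ℝ) ≠ 0) :
    scaledDensity n τ = stirlingConst n * (Complex.exp (n * (Complex.log (1 + τ / (√n : ℝ)) -
      τ / (√n : ℝ))) / (1 + τ / (√n : ℝ))) := by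
  have hs : (0 : ℝ) < √n := Real.sqrt_pos.2 (by exact_mod_cast hn)
  have hs0 : ((√n : ℝ) : ℂ) ≠ 0 := by exact_mod_cast hs.ne'
  have hss : (n : ℂ) = ((√n : ℝ) : ℂ) ^ 2 := by
    rw [← Complex.ofReal_pow, Real.sq_sqrt (by positivity)]; simp
  have e : (n : ℂ) * (Complex.log (1 + τ / (√n : ℝ)) - τ / (√n : ℝ)) =
      n * Complex.log (1 + τ / (√n : ℝ)) + -((√n : ℝ) * τ) := by
    have : (n : ℂ) * (τ / (√n : ℝ)) = (√n : ℝ) * τ := by rw [hss]; field_simp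
    rw [mul_sub, this, sub_eq_add_neg]
  rw [e, Complex.exp_add, Complex.exp_nat_mul, Complex.exp_log hτ, scaledDensity]
  obtain ⟨m, rfl⟩ : ∃ m, n = m + 1 := ⟨n - 1, by omega⟩
  rw [add_tsub_cancel_right, pow_succ, mul_div_right_comm, mul_div_cancel_right₀ _ hτ,
    mul_comm (Complex.exp _)]

lemma natCast_mul_div_sqrt_sq {n : ℕ} (hn : 1 ≤ n) (τ : ℂ) :
    (n : ℂ) * (τ / (√n : ℝ)) ^ 2 = τ ^ 2 := by
  have hn0 : (n : ℂ) ≠ 0 := by exact_mod_cast (by omega : n ≠ 0)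
  rw [div_pow, ← Complex.ofReal_pow, Real.sq_sqrt (Nat.cast_nonneg n), Complex.ofReal_natCast,
    mul_div_cancel₀ _ hn0]

lemma norm_natCast_mul_div_sqrt_sq {n : ℕ} (hn : 1 ≤ n) (τ : ℂ) :
    (n : ℝ) * ‖τ / (√n : ℝ)‖ ^ 2 = ‖τ‖ ^ 2 := by
  simpa using congrArg norm (natCast_mul_div_sqrt_sq hn τ)

lemma norm_log_one_add_sub_le {u : ℂ} (hu : ‖u‖ ≤ 1 / 2) : ‖Complex.log (1 + u) - u‖ ≤ ‖u‖ ^ 2 := by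
  refine (Complex.norm_log_one_add_sub_self_le (by linarith)).trans ?_
  have : (1 - ‖u‖)⁻¹ ≤ 2 := by
    rw [inv_le_comm₀ (by linarith) (by norm_num)]; linarith
  nlinarith [sq_nonneg ‖u‖]

lemma norm_log_one_add_sub_add_sq_le {u : ℂ} (hu : ‖u‖ ≤ 1 / 2) :
    ‖Complex.log (1 + u) - u + u ^ 2 / 2‖ ≤ ‖u‖ ^ 3 := by
  have htaylor : Complex.log (1 + u) - Complex.logTaylor (2 + 1) u =
      Complex.log (1 + u) - u + u ^ 2 / 2 := by
    simp [Complex.logTaylor_succ, Complex.logTaylor_zero]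
    ring
  have hinv : (1 - ‖u‖)⁻¹ ≤ 2 := by
    rw [inv_le_comm₀ (by linarith) (by norm_num)]; linarith
  have hbound : ‖u‖ ^ (2 + 1) * (1 - ‖u‖)⁻¹ ≤ ‖u‖ ^ 3 * 2 :=
    mul_le_mul_of_nonneg_left hinv (by positivity)
  rw [← htaylor]
  refine (Complex.norm_log_sub_logTaylor_le 2 (by linarith)).trans ?_
  rw [div_le_iff₀ (by positivity)]
  push_cast
  linarith [show 0 ≤ ‖u‖ ^ 3 by positivity]

lemma exists_norm_scaledDensity_le (M : ℝ) : ∃ B : ℝ, ∀ᶠ n : ℕ in atTop, ∀ τ : ℂ, ‖τ‖ ≤ M →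
    ‖scaledDensity n τ‖ ≤ B := by
  obtain ⟨B, hB⟩ : ∃ B : ℝ, ∀ᶠ n in atTop, stirlingConst n ≤ B :=
    ⟨_, tendsto_stirlingConst.eventually (eventually_le_nhds (lt_add_one _))⟩
  refine ⟨B * (Real.exp (M ^ 2) * 2), ?_⟩
  have hsq : Tendsto (fun n : ℕ => √(n : ℝ)) atTop atTop :=
    Real.tendsto_sqrt_atTop.comp tendsto_natCast_atTop_atTop
  filter_upwards [hB, eventually_ge_atTop 1, hsq.eventually_ge_atTop (2 * M)] with n hn hn1 hnM τ hτ
  have hs : (0 : ℝ) < √n := Real.sqrt_pos.2 (by exact_mod_cast hn1)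
  set u : ℂ := τ / (√n : ℝ) with hu
  have hu2 : ‖u‖ ≤ 1 / 2 := by
    rw [hu, norm_div, Complex.norm_real, Real.norm_of_nonneg hs.le, div_le_iff₀ hs]
    linarith
  have h1u : 1 / 2 ≤ ‖1 + u‖ := by
    have := norm_sub_norm_le (1 : ℂ) (-u)
    rw [sub_neg_eq_add, norm_neg, norm_one] at this
    linarith
  have hne : 1 + u ≠ 0 := norm_pos_iff.1 (by linarith)
  rw [scaledDensity_eq hn1 hne, norm_mul, norm_div, Complex.norm_real, Complex.norm_exp]
  have hst : 0 ≤ stirlingConst n := by unfold stirlingConst; positivity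
  rw [Real.norm_of_nonneg hst]
  have hre : (n * (Complex.log (1 + u) - u) : ℂ).re ≤ M ^ 2 := by
    refine (Complex.re_le_norm _).trans ?_
    rw [norm_mul, Complex.norm_natCast]
    calc (n : ℝ) * ‖Complex.log (1 + u) - u‖ ≤ n * ‖u‖ ^ 2 := by
          gcongr; exact norm_log_one_add_sub_le hu2
      _ = ‖τ‖ ^ 2 := norm_natCast_mul_div_sqrt_sq hn1 τ
      _ ≤ M ^ 2 := by gcongr
  rw [div_eq_mul_inv]
  gcongr
  · linarith
  · rw [inv_le_comm₀ (by linarith) (by norm_num)]; linarith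

lemma tendsto_div_sqrt_natCast {ι : Type*} {l : Filter ι} {n : ι → ℕ} (hn : Tendsto n l atTop)
    {τ : ι → ℂ} {τ₀ : ℂ} (hτ : Tendsto τ l (𝓝 τ₀)) :
    Tendsto (fun k => τ k / (√(n k : ℝ) : ℝ)) l (𝓝 0) := by
  have hinv : Tendsto (fun k => (((√(n k : ℝ))⁻¹ : ℝ) : ℂ)) l (𝓝 ((0 : ℝ) : ℂ)) :=
    (Complex.continuous_ofReal.tendsto 0).comp (tendsto_inv_atTop_zero.comp
      (Real.tendsto_sqrt_atTop.comp (tendsto_natCast_atTop_atTop.comp hn)))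
  simpa [div_eq_mul_inv] using hτ.mul hinv

lemma tendsto_natCast_mul_log_sub {ι : Type*} {l : Filter ι} {n : ι → ℕ} (hn : Tendsto n l atTop)
    {τ : ι → ℂ} {τ₀ : ℂ} (hτ : Tendsto τ l (𝓝 τ₀)) :
    Tendsto (fun k => (n k : ℂ) * (Complex.log (1 + τ k / (√(n k : ℝ) : ℝ)) -
      τ k / (√(n k : ℝ) : ℝ))) l (𝓝 (-(τ₀ ^ 2 / 2))) := by
  have hu0 := tendsto_div_sqrt_natCast hn hτ
  set u : ι → ℂ := fun k => τ k / (√(n k : ℝ) : ℝ)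
  have hn1 : ∀ᶠ k in l, 1 ≤ n k := hn.eventually_ge_atTop 1
  have hcubic : Tendsto (fun k => (n k : ℂ) * (Complex.log (1 + u k) - u k + u k ^ 2 / 2)) l
      (𝓝 0) := by
    have hbound : Tendsto (fun k => ‖τ k‖ ^ 2 * ‖u k‖) l (𝓝 0) := by
      simpa using (hτ.norm.pow 2).mul hu0.norm
    refine squeeze_zero_norm' ?_ hbound
    filter_upwards [hn1, hu0.norm.eventually (eventually_le_nhds
      (show ‖(0 : ℂ)‖ < 1 / 2 by simp))] with k hk hu
    rw [norm_mul, Complex.norm_natCast]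
    calc (n k : ℝ) * ‖Complex.log (1 + u k) - u k + u k ^ 2 / 2‖ ≤ n k * ‖u k‖ ^ 3 := by
          gcongr; exact norm_log_one_add_sub_add_sq_le hu
      _ = (n k * ‖u k‖ ^ 2) * ‖u k‖ := by ring
      _ = ‖τ k‖ ^ 2 * ‖u k‖ := by rw [norm_natCast_mul_div_sqrt_sq hk]
  have hlim := hcubic.sub ((hτ.pow 2).div_const 2)
  rw [zero_sub] at hlim
  refine hlim.congr' ?_
  filter_upwards [hn1] with k hk
  linear_combination natCast_mul_div_sqrt_sq hk (τ k) / 2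

/-- The density of the standard normal distribution, extended to an entire function. -/
def gaussianDensity (τ : ℂ) : ℂ := ((√(2 * Real.pi))⁻¹ : ℝ) * Complex.exp (-(τ ^ 2 / 2))

lemma tendsto_scaledDensity {ι : Type*} {l : Filter ι} {n : ι → ℕ} (hn : Tendsto n l atTop)
    {τ : ι → ℂ} {τ₀ : ℂ} (hτ : Tendsto τ l (𝓝 τ₀)) :
    Tendsto (fun k => scaledDensity (n k) (τ k)) l (𝓝 (gaussianDensity τ₀)) := by
  have hst : Tendsto (fun k => ((stirlingConst (n k) : ℝ) : ℂ)) l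
      (𝓝 (((√(2 * Real.pi))⁻¹ : ℝ) : ℂ)) :=
    (Complex.continuous_ofReal.tendsto _).comp (tendsto_stirlingConst.comp hn)
  have h1u : Tendsto (fun k => 1 + τ k / (√(n k : ℝ) : ℝ)) l (𝓝 1) := by
    simpa using (tendsto_div_sqrt_natCast hn hτ).const_add 1
  have h := hst.mul ((tendsto_natCast_mul_log_sub hn hτ).cexp.div h1u one_ne_zero)
  rw [div_one] at h
  refine h.congr' ?_
  filter_upwards [hn.eventually_ge_atTop 1, h1u.eventually_ne one_ne_zero] with k hk hne
  rw [scaledDensity_eq hk hne, Pi.div_apply]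

/-- The integral of `gaussianDensity` along the segment from `x` to `y`. -/
def gaussianIncrement (x y : ℂ) : ℂ :=
  (y - x) * ∫ t in (0 : ℝ)..1, gaussianDensity (x + t • (y - x))

lemma tendsto_scaledTail_sub {ι : Type*} {l : Filter ι} [l.IsCountablyGenerated] {n : ι → ℕ}
    (hn : Tendsto n l atTop) {x y : ι → ℂ} {x₀ y₀ : ℂ} (hx : Tendsto x l (𝓝 x₀))
    (hy : Tendsto y l (𝓝 y₀)) :
    Tendsto (fun k => scaledTail (n k) (x k) - scaledTail (n k) (y k)) l
      (𝓝 (gaussianIncrement x₀ y₀)) := by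
  have hint : Tendsto (fun k => ∫ t in (0 : ℝ)..1, scaledDensity (n k) (x k + t • (y k - x k)))
      l (𝓝 (∫ t in (0 : ℝ)..1, gaussianDensity (x₀ + t • (y₀ - x₀)))) := by
    obtain ⟨B, hB⟩ := exists_norm_scaledDensity_le (‖x₀‖ + 1 + (‖y₀ - x₀‖ + 1))
    refine intervalIntegral.tendsto_integral_filter_of_dominated_convergence (fun _ => B)
      (Eventually.of_forall fun k => ?_) ?_ (by simp) ?_
    · exact ((continuous_scaledDensity _).comp (by fun_prop)).aestronglyMeasurable
    · filter_upwards [hn.eventually hB, hx.norm.eventually (eventually_le_nhds (lt_add_one _)),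
        (hy.sub hx).norm.eventually (eventually_le_nhds (lt_add_one _))] with k hk hxk hyxk
      refine Eventually.of_forall fun t ht => hk _ ((norm_add_le _ _).trans (add_le_add hxk ?_))
      rw [Set.uIoc_of_le zero_le_one] at ht
      rw [norm_smul, Real.norm_of_nonneg ht.1.le]
      exact (mul_le_of_le_one_left (norm_nonneg _) ht.2).trans hyxk
    · exact Eventually.of_forall fun t _ =>
        tendsto_scaledDensity hn (hx.add ((hy.sub hx).const_smul t))
  refine ((hy.sub hx).mul hint).congr' ?_
  filter_upwards [hn.eventually_ge_atTop 1] with k hk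
  have h := intervalIntegral.integral_unitInterval_deriv_eq_sub (f := scaledTail (n k))
    (f' := fun τ => -scaledDensity (n k) τ) (z₀ := x k) (z₁ := y k - x k)
    ((continuous_scaledDensity _).neg.comp (by fun_prop)).continuousOn
    (fun t _ => hasDerivAt_scaledTail hk _)
  rw [intervalIntegral.integral_neg, smul_eq_mul, add_sub_cancel] at h
  linear_combination -h

lemma scaledTail_ofReal (n : ℕ) (ξ : ℝ) : scaledTail n ξ = ((Real.exp (-(n + √n * ξ)) *
    ∑ j ∈ Finset.range n, (n + √n * ξ) ^ j / j.factorial : ℝ) : ℂ) := by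
  simp [scaledTail, expTail]

lemma sum_range_pow_div_factorial_le {q x : ℝ} (hq : 1 ≤ q) (hx : 0 ≤ x) (n : ℕ) :
    ∑ j ∈ Finset.range n, x ^ j / j.factorial ≤ q ^ n * Real.exp (x / q) := by
  calc ∑ j ∈ Finset.range n, x ^ j / j.factorial
      ≤ ∑ j ∈ Finset.range n, q ^ n * ((x / q) ^ j / j.factorial) := by
        refine Finset.sum_le_sum fun j hj => ?_
        have e : x ^ j = q ^ j * (x / q) ^ j := by rw [← mul_pow]; field_simp
        rw [e, mul_div_assoc]
        exact mul_le_mul_of_nonneg_right (pow_le_pow_right₀ hq (Finset.mem_range.1 hj).le)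
          (by positivity)
    _ = q ^ n * ∑ j ∈ Finset.range n, (x / q) ^ j / j.factorial := by rw [Finset.mul_sum]
    _ ≤ q ^ n * Real.exp (x / q) := by gcongr; exact Real.sum_le_exp_of_nonneg (by positivity) n

lemma norm_scaledTail_le {n : ℕ} (hn : 1 ≤ n) {ξ : ℝ} (hξ : 1 ≤ ξ) :
    ‖scaledTail n ξ‖ ≤ Real.exp ((1 - ξ) / 2) := by
  have hn0 : (1 : ℝ) ≤ n := by exact_mod_cast hn
  set s : ℝ := √n
  have hs1 : 1 ≤ s := Real.one_le_sqrt.2 hn0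
  have hss : (n : ℝ) = s ^ 2 := (Real.sq_sqrt (by positivity)).symm
  set x : ℝ := n + s * ξ with hx
  have hx0 : 0 ≤ x := by positivity
  set q : ℝ := 1 + 1 / s with hq
  have hq1 : 1 ≤ q := le_add_of_nonneg_right (by positivity)
  have hq2 : q ≤ 2 := by linarith [(div_le_one (by positivity)).2 hs1]
  have hqn : q ^ n ≤ Real.exp s := by
    calc q ^ n ≤ Real.exp (1 / s) ^ n := by
          gcongr; rw [hq, add_comm]; exact Real.add_one_le_exp _
      _ = Real.exp s := by rw [← Real.exp_nat_mul, hss]; congr 1; field_simp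
  have hexponent : -x + (s + x / q) = (1 - ξ) / q := by
    rw [hx, hss, hq]
    field_simp
    ring
  have hnonneg : 0 ≤ Real.exp (-x) * ∑ j ∈ Finset.range n, x ^ j / j.factorial :=
    mul_nonneg (Real.exp_pos _).le (Finset.sum_nonneg fun j _ => by positivity)
  rw [scaledTail_ofReal, Complex.norm_real, Real.norm_of_nonneg hnonneg]
  calc Real.exp (-x) * ∑ j ∈ Finset.range n, x ^ j / j.factorial
      ≤ Real.exp (-x) * (Real.exp s * Real.exp (x / q)) := by
        gcongr
        exact (sum_range_pow_div_factorial_le hq1 hx0 n).trans (by gcongr)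
    _ = Real.exp ((1 - ξ) / q) := by rw [← Real.exp_add, ← Real.exp_add, hexponent]
    _ ≤ Real.exp ((1 - ξ) / 2) := by
        rw [Real.exp_le_exp, div_le_div_iff₀ (by linarith) (by norm_num)]
        nlinarith

lemma cauchySeq_scaledTail_zero : CauchySeq fun n : ℕ => scaledTail n 0 := by
  rw [Metric.cauchySeq_iff]
  intro ε hε
  -- The tail at a large `ξ` is small uniformly in `n`, and the increment from `0` to `ξ` converges.
  have hlim : Tendsto (fun ξ : ℝ => Real.exp ((1 - ξ) / 2)) atTop (𝓝 0) := by
    refine Real.tendsto_exp_atBot.comp (Tendsto.atBot_div_const (by norm_num) ?_)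
    exact tendsto_atBot_add_const_left _ _ tendsto_neg_atTop_atBot
  obtain ⟨ξ, hξ1, hξ⟩ := ((eventually_ge_atTop 1).and
    (hlim.eventually (gt_mem_nhds (show (0 : ℝ) < ε / 4 by positivity)))).exists
  set I := gaussianIncrement 0 ξ
  have hincr : Tendsto (fun n => scaledTail n 0 - scaledTail n ξ) atTop (𝓝 I) :=
    tendsto_scaledTail_sub tendsto_id tendsto_const_nhds tendsto_const_nhds
  obtain ⟨N, hN⟩ := eventually_atTop.1 ((Metric.tendsto_nhds.1 hincr (ε / 4)
    (by positivity)).and (eventually_ge_atTop 1))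
  have hI : ∀ k ≥ N, dist (scaledTail k 0) I < ε / 2 := by
    intro k hk
    obtain ⟨hdist, hk1⟩ := hN k hk
    have htail := norm_scaledTail_le hk1 hξ1
    have hsplit : scaledTail k 0 - I = (scaledTail k 0 - scaledTail k ξ - I) + scaledTail k ξ := by
      ring
    rw [dist_eq_norm] at hdist ⊢
    rw [hsplit]
    exact (norm_add_le _ _).trans_lt (by linarith)
  refine ⟨N, fun m hm k hk => ?_⟩
  linarith [dist_triangle_right (scaledTail m 0) (scaledTail k 0) I, hI m hm, hI k hk]

lemma exists_tendsto_scaledTail : ∃ F : ℂ → ℂ, ∀ x₀ : ℂ,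
    Tendsto (fun p : ℕ × ℂ => scaledTail p.1 p.2) (atTop ×ˢ 𝓝 x₀) (𝓝 (F x₀)) := by
  obtain ⟨a, ha⟩ := cauchySeq_tendsto_of_complete cauchySeq_scaledTail_zero
  refine ⟨fun x₀ => a + gaussianIncrement x₀ 0, fun x₀ => ?_⟩
  refine ((ha.comp tendsto_fst).add
    (tendsto_scaledTail_sub tendsto_fst tendsto_snd tendsto_const_nhds)).congr fun p => ?_
  simp

lemma eventually_re_scaledTail_nonneg (ξ : ℝ) : ∀ᶠ n : ℕ in atTop, 0 ≤ (scaledTail n ξ).re := by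
  have hsq : Tendsto (fun n : ℕ => √(n : ℝ)) atTop atTop :=
    Real.tendsto_sqrt_atTop.comp tendsto_natCast_atTop_atTop
  filter_upwards [hsq.eventually_ge_atTop (-ξ)] with n hn
  have hx : 0 ≤ (n : ℝ) + √n * ξ := by
    have : (n : ℝ) = √n * √n := (Real.mul_self_sqrt (by positivity)).symm
    rw [this, Real.sqrt_mul_self (by positivity), ← mul_add]
    exact mul_nonneg (by positivity) (by linarith)
  rw [scaledTail_ofReal, Complex.ofReal_re]
  positivity

lemma gaussianIncrement_add_one_re_pos (s : ℝ) : 0 < (gaussianIncrement s (s + 1)).re := by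
  have hreal : gaussianIncrement s (s + 1) =
      ((∫ t in (0 : ℝ)..1, (√(2 * Real.pi))⁻¹ * Real.exp (-((s + t) ^ 2 / 2)) : ℝ) : ℂ) := by
    rw [gaussianIncrement, add_sub_cancel_left, one_mul, ← intervalIntegral.integral_ofReal]
    refine intervalIntegral.integral_congr fun t _ => ?_
    simp [gaussianDensity]
  rw [hreal, Complex.ofReal_re]
  exact intervalIntegral.intervalIntegral_pos_of_pos
    (Continuous.intervalIntegrable (by fun_prop) _ _) (fun t => by positivity) one_pos

lemma limit_scaledTail_ne_zero {F : ℂ → ℂ} (hF : ∀ x₀ : ℂ,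
    Tendsto (fun p : ℕ × ℂ => scaledTail p.1 p.2) (atTop ×ˢ 𝓝 x₀) (𝓝 (F x₀))) (s : ℝ) :
    F s ≠ 0 := by
  intro hs
  have hlim : ∀ x : ℂ, Tendsto (fun n => scaledTail n x) atTop (𝓝 (F x)) := fun x => by
    have hpair : Tendsto (fun n : ℕ => (n, x)) atTop (atTop ×ˢ 𝓝 x) :=
      tendsto_id.prodMk tendsto_const_nhds
    simpa only [Function.comp_def] using (hF x).comp hpair
  have hincr : F s - F (s + 1) = gaussianIncrement s (s + 1) :=
    tendsto_nhds_unique ((hlim s).sub (hlim (s + 1)))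
      (tendsto_scaledTail_sub tendsto_id tendsto_const_nhds tendsto_const_nhds)
  have hnonneg : 0 ≤ (F (s + 1)).re := by
    have hre := (Complex.continuous_re.tendsto _).comp (hlim (s + 1 : ℝ))
    simpa using ge_of_tendsto hre (eventually_re_scaledTail_nonneg (s + 1))
  have hpos := gaussianIncrement_add_one_re_pos s
  rw [← hincr, hs, zero_sub, Complex.neg_re] at hpos
  linarith

/-! ### The Gaussian weight -/

lemma integral_areaMeasure (f : ℂ → ℂ) :
    ∫ z, f z ∂areaMeasure = (Real.pi⁻¹ : ℝ) * ∫ z, f z := by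
  rw [areaMeasure, integral_smul_measure, ENNReal.toReal_ofReal (by positivity), Complex.real_smul]

lemma integral_pow_mul_conj_pow_self (i : ℕ) :
    ∫ z : ℂ, z ^ i * conj (z ^ i) * (Real.exp (-‖z‖ ^ 2) : ℂ) ∂areaMeasure = i.factorial := by
  have hradial : ∀ z : ℂ, z ^ i * conj (z ^ i) * (Real.exp (-‖z‖ ^ 2) : ℂ) =
      ((‖z‖ ^ (2 * i : ℝ) * Real.exp (-‖z‖ ^ (2 : ℝ)) : ℝ) : ℂ) := fun z => by
    rw [Complex.mul_conj', norm_pow, ← Complex.ofReal_pow, ← pow_mul, mul_comm i 2]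
    have : (2 * i : ℝ) = ((2 * i : ℕ) : ℝ) := by push_cast; rfl
    rw [this, Real.rpow_natCast, Real.rpow_ofNat]
    push_cast
    rfl
  rw [integral_areaMeasure]
  simp_rw [hradial]
  rw [integral_complex_ofReal, Complex.integral_rpow_mul_exp_neg_rpow (by norm_num)
    (by linarith [Nat.cast_nonneg (α := ℝ) i]), ← Complex.ofReal_mul]
  have hexponent : (2 * (i : ℝ) + 2) / 2 = i + 1 := by ring
  have hpi := Real.pi_ne_zero
  have hval : Real.pi⁻¹ * (2 * Real.pi / 2 * (i.factorial : ℝ)) = i.factorial := by field_simp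
  rw [hexponent, Real.Gamma_nat_eq_factorial, hval, Complex.ofReal_natCast]

-- A rotation through the angle `π / (i - j)` changes the sign of the integrand.
lemma integral_pow_mul_conj_pow_of_ne {i j : ℕ} (hij : i ≠ j) :
    ∫ z : ℂ, z ^ i * conj (z ^ j) * (Real.exp (-‖z‖ ^ 2) : ℂ) ∂areaMeasure = 0 := by
  set f : ℂ → ℂ := fun z => z ^ i * conj (z ^ j) * (Real.exp (-‖z‖ ^ 2) : ℂ) with hf
  have hsub : ((i : ℂ) - j) ≠ 0 := sub_ne_zero.2 (by exact_mod_cast hij)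
  set a : Circle := Circle.exp (Real.pi / (i - j)) with ha
  have ha_pow : (a : ℂ) ^ i * conj ((a : ℂ) ^ j) = -1 := by
    rw [ha, Circle.coe_exp, map_pow, ← Complex.exp_conj, ← Complex.exp_nat_mul,
      ← Complex.exp_nat_mul, ← Complex.exp_add, ← Complex.exp_pi_mul_I]
    congr 1
    simp only [map_mul, Complex.conj_ofReal, Complex.conj_I]
    push_cast
    field_simp
    ring
  have hrot : ∀ z, f (rotation a z) = -f z := fun z => by
    simp only [hf]
    rw [LinearIsometryEquiv.norm_map, rotation_apply, mul_pow, mul_pow, map_mul]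
    linear_combination (z ^ i * conj (z ^ j) * (Real.exp (-‖z‖ ^ 2) : ℂ)) * ha_pow
  have h := (rotation a).measurePreserving.integral_comp
    (rotation a).toHomeomorph.measurableEmbedding f
  simp only [hrot] at h
  rw [integral_neg] at h
  rw [integral_areaMeasure, self_eq_neg.1 h.symm, mul_zero]

/-- The orthonormal polynomials `(X - b)^j / √j!` of the Gaussian weight centred at `b`. -/
def shiftedMonomial (b : ℝ) (j : ℕ) : ℂ[X] :=
  C (((√(j.factorial : ℝ))⁻¹ : ℝ) : ℂ) * (X - C (b : ℂ)) ^ j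

lemma isOrthonormalPolys_shiftedMonomial (b : ℝ) :
    IsOrthonormalPolys 0 b 1 (shiftedMonomial b) := by
  refine ⟨fun j => ?_, fun j k => ?_⟩
  · have h : (((√(j.factorial : ℝ))⁻¹ : ℝ) : ℂ) ≠ 0 := by
      have : (0 : ℝ) < j.factorial := by exact_mod_cast j.factorial_pos
      exact_mod_cast (inv_pos.2 (Real.sqrt_pos.2 this)).ne'
    rw [shiftedMonomial, degree_C_mul h, degree_pow, degree_X_sub_C]
    simp
  · set f : ℂ → ℂ := fun z => (((√(j.factorial : ℝ))⁻¹ * (√(k.factorial : ℝ))⁻¹ : ℝ) : ℂ) *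
      (z ^ j * conj (z ^ k) * (Real.exp (-‖z‖ ^ 2) : ℂ)) with hf
    have h : ∀ ζ : ℂ, (shiftedMonomial b j).eval ζ * conj ((shiftedMonomial b k).eval ζ) *
        ((‖ζ‖ ^ (2 * (0 : ℝ)) * Real.exp (-((1 : ℕ) : ℝ) * Q b ζ) : ℝ) : ℂ) = f (ζ - b) :=
      fun ζ => by
        simp only [hf, shiftedMonomial, eval_mul, eval_C, eval_pow, eval_sub, eval_X, map_mul, Q,
          Complex.conj_ofReal, mul_zero, Real.rpow_zero, Nat.cast_one, one_mul, neg_one_mul]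
        push_cast
        ring
    simp_rw [h]
    rw [integral_areaMeasure, integral_sub_right_eq_self f, integral_const_mul, mul_left_comm,
      ← integral_areaMeasure]
    split_ifs with hjk
    · subst hjk
      rw [integral_pow_mul_conj_pow_self]
      have : (0 : ℝ) < j.factorial := by exact_mod_cast j.factorial_pos
      rw [← mul_inv, Real.mul_self_sqrt this.le]
      push_cast
      exact inv_mul_cancel₀ (by exact_mod_cast this.ne')
    · rw [integral_pow_mul_conj_pow_of_ne hjk, mul_zero]

lemma sumKernel_shiftedMonomial (b : ℝ) (n : ℕ) (z w : ℂ) :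
    sumKernel b n (shiftedMonomial b) z w =
      Complex.exp (z * conj w) * expTail n ((z - b) * (conj w - b)) := by
  have hexp : Complex.exp (b * z - b ^ 2 / 2) * conj (Complex.exp (b * w - b ^ 2 / 2)) =
      Complex.exp (z * conj w) * Complex.exp (-((z - b) * (conj w - b))) := by
    rw [← Complex.exp_conj, ← Complex.exp_add, ← Complex.exp_add]
    congr 1
    simp only [map_sub, map_mul, map_div₀, map_pow, Complex.conj_ofReal, map_ofNat]
    ring
  rw [expTail, ← mul_assoc, ← hexp, sumKernel, Finset.mul_sum]
  refine Finset.sum_congr rfl fun j _ => ?_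
  have hj : (((√(j.factorial : ℝ))⁻¹ : ℝ) : ℂ) * (((√(j.factorial : ℝ))⁻¹ : ℝ) : ℂ) =
      ((j.factorial : ℂ))⁻¹ := by
    rw [← Complex.ofReal_mul, ← mul_inv, Real.mul_self_sqrt (by positivity)]
    push_cast; rfl
  simp only [expPoly, shiftedMonomial, eval_mul, eval_C, eval_pow, eval_sub, eval_X, map_mul,
    map_pow, map_sub, Complex.conj_ofReal, div_eq_mul_inv, mul_pow]
  rw [← hj]
  ring

/-- The sequence `(n, b)` of degrees and shifts approaches the edge regime of parameter `S`. -/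
structure EdgeSeq (S : ℝ) (n : ℕ → ℕ) (b : ℕ → ℝ) : Prop where
  tendsto_n : Tendsto n atTop atTop
  tendsto_b : Tendsto (fun k => b k - √(n k)) atTop (𝓝 (S / 2))

lemma EdgeSeq.tendsto_sqrt {S : ℝ} {n : ℕ → ℕ} {b : ℕ → ℝ} (h : EdgeSeq S n b) :
    Tendsto (fun k => √(n k : ℝ)) atTop atTop :=
  Real.tendsto_sqrt_atTop.comp (tendsto_natCast_atTop_atTop.comp h.tendsto_n)

lemma EdgeSeq.tendsto_atTop {S : ℝ} {n : ℕ → ℕ} {b : ℕ → ℝ} (h : EdgeSeq S n b) :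
    Tendsto b atTop atTop := by
  simpa using h.tendsto_sqrt.atTop_add h.tendsto_b

lemma EdgeSeq.tendsto_scaled_argument {S : ℝ} {n : ℕ → ℕ} {b : ℕ → ℝ} (h : EdgeSeq S n b)
    (z w : ℂ) : Tendsto (fun k => ((z - b k) * (w - b k) - n k) / ((√(n k : ℝ) : ℝ) : ℂ)) atTop
      (𝓝 (S - (z + w))) := by
  have hinv := tendsto_div_sqrt_natCast h.tendsto_n (tendsto_const_nhds (x := (1 : ℂ)))
  have hβ : Tendsto (fun k => ((b k - √(n k) : ℝ) : ℂ)) atTop (𝓝 ((S / 2 : ℝ) : ℂ)) :=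
    (Complex.continuous_ofReal.tendsto _).comp h.tendsto_b
  have hlim := (((hβ.const_mul 2).add ((hβ.pow 2).mul hinv)).sub
    (((hβ.mul hinv).const_add 1).const_mul (z + w))).add (hinv.const_mul (z * w))
  have hval : (2 * ((S / 2 : ℝ) : ℂ) + ((S / 2 : ℝ) : ℂ) ^ 2 * 0 -
      (z + w) * (1 + ((S / 2 : ℝ) : ℂ) * 0) + z * w * 0) = S - (z + w) := by
    push_cast; ring
  rw [hval] at hlim
  refine hlim.congr' ?_
  filter_upwards [h.tendsto_sqrt.eventually_gt_atTop 0] with k hk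
  have hs0 : ((√(n k : ℝ) : ℝ) : ℂ) ≠ 0 := by exact_mod_cast hk.ne'
  have hss : (n k : ℂ) = ((√(n k : ℝ) : ℝ) : ℂ) ^ 2 := by
    rw [← Complex.ofReal_pow, Real.sq_sqrt (by positivity)]; simp
  rw [hss]
  push_cast
  field_simp
  ring

lemma exists_tendsto_sumKernel_shiftedMonomial {S : ℝ} {n : ℕ → ℕ} {b : ℕ → ℝ}
    (h : EdgeSeq S n b) : ∃ L₀ : ℂ → ℂ → ℂ, (∀ z w, Tendsto (fun k =>
      sumKernel (b k) (n k) (shiftedMonomial (b k)) z w) atTop (𝓝 (L₀ z w))) ∧ L₀ 0 0 ≠ 0 := by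
  obtain ⟨F, hF⟩ := exists_tendsto_scaledTail
  refine ⟨fun z w => Complex.exp (z * conj w) * F (S - (z + conj w)), fun z w => ?_, ?_⟩
  · simp_rw [sumKernel_shiftedMonomial]
    refine ((hF _).comp (h.tendsto_n.prodMk
      (h.tendsto_scaled_argument z (conj w)))).const_mul _ |>.congr' ?_
    filter_upwards [h.tendsto_sqrt.eventually_gt_atTop 0] with k hk
    have hs0 : ((√(n k : ℝ) : ℝ) : ℂ) ≠ 0 := by exact_mod_cast hk.ne'
    simp only [Function.comp_apply, scaledTail]
    rw [mul_div_cancel₀ _ hs0, add_sub_cancel]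
  · simpa using limit_scaledTail_ne_zero hF S

lemma energy_expPoly_ne_top {c : ℝ} (hc : -1 < c) (b : ℝ) (p : ℂ[X]) :
    energy c (expPoly b p) ≠ ⊤ := by
  obtain ⟨K, -, hK⟩ := exists_norm_expPoly_le b p
  exact energy_ne_top_of_norm_le hc hK

lemma integrable_expPoly_mul_conj {c : ℝ} (hc : -1 < c) (b : ℝ) (p q : ℂ[X]) :
    Integrable (fun z => expPoly b p z * conj (expPoly b q z)) (fockMeasure c) :=
  integrable_mul_conj (differentiable_expPoly b p).continuous.aemeasurable
    (differentiable_expPoly b q).continuous.aemeasurable (energy_expPoly_ne_top hc b p)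
    (energy_expPoly_ne_top hc b q)

/-- The `L²(fockMeasure c)` inner product of polynomials, through `expPoly`. -/
@[reducible]
def polyCore {c : ℝ} (hc : -1 < c) (b : ℝ) : InnerProductSpace.Core ℂ ℂ[X] where
  inner p q := ∫ z, expPoly b q z * conj (expPoly b p z) ∂fockMeasure c
  conj_inner_symm p q := by
    rw [← integral_conj]
    exact integral_congr_ae (Eventually.of_forall fun z => by simp [mul_comm])
  re_inner_nonneg p := by
    rw [integral_mul_conj_self c (differentiable_expPoly b p).continuous]
    exact ENNReal.toReal_nonneg
  add_left p q r := by
    rw [← integral_add (integrable_expPoly_mul_conj hc b _ _)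
      (integrable_expPoly_mul_conj hc b _ _)]
    simp [expPoly_add, mul_add]
  smul_left p q r := by
    rw [← integral_const_mul]
    refine integral_congr_ae (Eventually.of_forall fun z => ?_)
    simp only [expPoly, eval_smul, smul_eq_mul, map_mul]
    ring
  definite p hp := by
    rw [integral_mul_conj_self c (differentiable_expPoly b p).continuous,
      Complex.ofReal_eq_zero, ENNReal.toReal_eq_zero_iff] at hp
    have hE := hp.resolve_right (energy_expPoly_ne_top hc b p)
    refine Polynomial.funext fun z => ?_
    simpa [expPoly] using eq_zero_of_energy_eq_zero (differentiable_expPoly b p) hE z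

lemma exists_isOrthonormalPolys {c : ℝ} (hc : -1 < c) (b : ℝ) :
    ∃ p, IsOrthonormalPolys c b 1 p := by
  let core := polyCore hc b
  let _ : NormedAddCommGroup ℂ[X] := core.toNormedAddCommGroup
  let _ : InnerProductSpace ℂ ℂ[X] := InnerProductSpace.ofCore core.toCore
  have hli : LinearIndependent ℂ fun j : ℕ => (X : ℂ[X]) ^ j := by
    simpa [← X_pow_eq_monomial] using (Polynomial.basisMonomials ℂ).linearIndependent
  have hspan : ∀ j : ℕ, Submodule.span ℂ ((fun j : ℕ => (X : ℂ[X]) ^ j) '' Set.Iio j) ≤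
      degreeLT ℂ j := fun j => by
    rw [Submodule.span_le]
    rintro _ ⟨i, hi, rfl⟩
    rw [SetLike.mem_coe, mem_degreeLT]
    simp only [degree_X_pow]
    exact_mod_cast hi
  have hdeg : ∀ j : ℕ, (InnerProductSpace.gramSchmidt ℂ (fun j : ℕ => (X : ℂ[X]) ^ j) j).degree =
      (j : WithBot ℕ) := fun j => by
    rw [InnerProductSpace.gramSchmidt_def, degree_sub_eq_left_of_degree_lt, degree_X_pow]
    rw [degree_X_pow, ← mem_degreeLT]
    refine hspan j ?_
    rw [← InnerProductSpace.span_gramSchmidt_Iio ℂ]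
    refine Submodule.sum_mem _ fun i hi => ?_
    rw [Submodule.starProjection_singleton]
    exact Submodule.smul_mem _ _ (Submodule.subset_span ⟨i, by simpa using hi, rfl⟩)
  refine ⟨InnerProductSpace.gramSchmidtNormed ℂ fun j : ℕ => (X : ℂ[X]) ^ j, fun j => ?_,
    fun j k => ?_⟩
  · have h0 := norm_ne_zero_iff.2 (InnerProductSpace.gramSchmidt_ne_zero (𝕜 := ℂ) j hli)
    rw [InnerProductSpace.gramSchmidtNormed, smul_eq_C_mul, degree_C_mul, hdeg j]
    exact inv_ne_zero (Complex.ofReal_ne_zero.2 h0)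
  · rw [← integral_expPoly_mul_conj]
    have h := orthonormal_iff_ite.1 (InnerProductSpace.gramSchmidtNormed_orthonormal hli) k j
    simp only [eq_comm (a := j)]
    exact h

/-! ### Limits of the reproducing kernels -/

lemma tendsto_ite_even {α : Type*} {l : Filter α} {u v : ℕ → α} (hu : Tendsto u atTop l)
    (hv : Tendsto v atTop l) :
    Tendsto (fun m => if Even m then u (m / 2) else v (m / 2)) atTop l := by
  have h : Tendsto (fun m : ℕ => m / 2) atTop atTop :=
    Nat.tendsto_div_const_atTop two_ne_zero
  exact (hu.comp h).if' (hv.comp h)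

lemma EdgeSeq.interlace {S : ℝ} {n n' : ℕ → ℕ} {b b' : ℕ → ℝ} (h : EdgeSeq S n b)
    (h' : EdgeSeq S n' b') : EdgeSeq S (fun m => if Even m then n (m / 2) else n' (m / 2))
      (fun m => if Even m then b (m / 2) else b' (m / 2)) := by
  refine ⟨tendsto_ite_even h.tendsto_n h'.tendsto_n, ?_⟩
  refine (tendsto_ite_even h.tendsto_b h'.tendsto_b).congr fun m => ?_
  split_ifs <;> rfl

/-- The shift `√N + S / 2` of the `N`-point ensemble with edge parameter `S`, rescaled by `√N`. -/
def edgeShift (S : ℝ) (N : ℕ) : ℝ := √N + S / 2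

lemma edgeSeq_edgeShift (S : ℝ) : EdgeSeq S id (edgeShift S) :=
  ⟨tendsto_id, by simp [edgeShift]⟩

lemma sqrt_add_one_sub_sqrt_le {x : ℝ} (hx : 0 < x) : √(x + 1) - √x ≤ (√x)⁻¹ := by
  have hsub : 0 ≤ √(x + 1) - √x := sub_nonneg.2 (Real.sqrt_le_sqrt (by linarith))
  rw [← one_div, le_div_iff₀ (Real.sqrt_pos.2 hx)]
  calc (√(x + 1) - √x) * √x ≤ (√(x + 1) - √x) * (√(x + 1) + √x) :=
        mul_le_mul_of_nonneg_left (le_add_of_nonneg_left (Real.sqrt_nonneg _)) hsub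
    _ = √(x + 1) ^ 2 - √x ^ 2 := by ring
    _ = 1 := by rw [Real.sq_sqrt (by positivity), Real.sq_sqrt hx.le, add_sub_cancel_left]

lemma edgeSeq_succ_edgeShift (S : ℝ) : EdgeSeq S (fun N => N + 1) (edgeShift S) := by
  refine ⟨tendsto_add_atTop_nat 1, ?_⟩
  have hsqrt : Tendsto (fun N : ℕ => √((N + 1 : ℕ) : ℝ) - √(N : ℝ)) atTop (𝓝 0) := by
    refine squeeze_zero' (Eventually.of_forall fun N => sub_nonneg.2 (Real.sqrt_le_sqrt (by simp)))
      ?_ (tendsto_inv_atTop_zero.comp (edgeSeq_edgeShift S).tendsto_sqrt)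
    filter_upwards [eventually_gt_atTop 0] with N hN
    rw [Nat.cast_add_one]
    exact sqrt_add_one_sub_sqrt_le (Nat.cast_pos.2 hN)
  have hlim := hsqrt.neg.add_const (S / 2)
  rw [neg_zero, zero_add] at hlim
  refine hlim.congr fun N => ?_
  rw [edgeShift]
  ring

lemma equicontinuous_isReproducing {c : ℝ} (hc : -1 < c) :
    {F : ℂ × ℂ → ℂ | ∃ n b, IsReproducing c n b (Function.curry F)}.Equicontinuous := by
  rintro ⟨z₀, w₀⟩
  obtain ⟨A, hA, hAle⟩ := exists_energy_kernel_le hc (max ‖z₀‖ ‖w₀‖ + 1)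
  have heq (x : ℂ) := Metric.equicontinuousAt_iff_right.1 (equicontinuous_energyBall c hA x)
  refine Metric.equicontinuousAt_iff_right.2 fun ε hε => ?_
  have hz := heq z₀ (ε / 2) (half_pos hε)
  have hw := heq w₀ (ε / 2) (half_pos hε)
  have hball : ∀ᶠ w in 𝓝 w₀, ‖w‖ ≤ max ‖z₀‖ ‖w₀‖ + 1 :=
    (continuous_norm.tendsto w₀).eventually (eventually_le_nhds
      ((le_max_right ‖z₀‖ ‖w₀‖).trans_lt (lt_add_one _)))
  rw [nhds_prod_eq]
  filter_upwards [hz.prod_mk (hw.and hball)] with ⟨z, w⟩ ⟨hz, hw, hwM⟩ ⟨F, n, b, hF⟩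
  have hmem {x : ℂ} (hx : ‖x‖ ≤ max ‖z₀‖ ‖w₀‖ + 1) :
      (fun z => F (z, x)) ∈ energyBall c A :=
    ⟨(hF.mem x).differentiable, hAle _ _ _ hF x hx⟩
  have hsymm (x : ℂ) : F (z₀, x) = conj (F (x, z₀)) := (hF.conj_symm z₀ x).symm
  refine (dist_triangle _ (F (z₀, w)) _).trans_lt ((add_lt_add ?_ ?_).trans_eq (add_halves ε))
  · change dist (F (z₀, w₀)) _ < _
    rw [hsymm w₀, hsymm w, Complex.dist_conj_conj]
    exact hw ⟨_, hmem ((le_max_left _ _).trans (lt_add_one _).le)⟩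
  · exact hz ⟨_, hmem hwM⟩

section Limit

variable {c : ℝ} {n : ℕ → ℕ} {b : ℕ → ℝ} {L : ℕ → ℂ → ℂ → ℂ} {K : ℂ → ℂ → ℂ}

lemma tendstoLocallyUniformly_kernel (hc : -1 < c)
    (hL : ∀ k, IsReproducing c (n k) (b k) (L k))
    (hK : ∀ z w, Tendsto (fun k => L k z w) atTop (𝓝 (K z w))) :
    TendstoLocallyUniformly (fun k (q : ℂ × ℂ) => L k q.1 q.2) (fun q => K q.1 q.2) atTop :=
  tendstoLocallyUniformly_of_equicontinuous (equicontinuous_isReproducing hc)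
    (Eventually.of_forall fun k => ⟨n k, b k, hL k⟩) fun q => hK q.1 q.2

lemma continuous_kernel_limit (hc : -1 < c) (hL : ∀ k, IsReproducing c (n k) (b k) (L k))
    (hK : ∀ z w, Tendsto (fun k => L k z w) atTop (𝓝 (K z w))) :
    Continuous fun q : ℂ × ℂ => K q.1 q.2 :=
  (tendstoLocallyUniformly_kernel hc hL hK).continuous (Frequently.of_forall fun k =>
    (equicontinuous_isReproducing hc).continuous ⟨fun q => L k q.1 q.2, n k, b k, hL k⟩)

lemma kernel_limit_conj_symm (hL : ∀ k, IsReproducing c (n k) (b k) (L k))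
    (hK : ∀ z w, Tendsto (fun k => L k z w) atTop (𝓝 (K z w))) (z w : ℂ) :
    conj (K w z) = K z w :=
  tendsto_nhds_unique ((Complex.continuous_conj.tendsto _).comp (hK w z))
    ((hK z w).congr fun k => ((hL k).conj_symm z w).symm)

lemma kernel_limit_self_re_nonneg (hL : ∀ k, IsReproducing c (n k) (b k) (L k))
    (hK : ∀ z w, Tendsto (fun k => L k z w) atTop (𝓝 (K z w))) (z : ℂ) : 0 ≤ (K z z).re := by
  refine ge_of_tendsto ((Complex.continuous_re.tendsto _).comp (hK z z))
    (Eventually.of_forall fun k => ?_)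
  rw [Function.comp_apply, (hL k).self_eq z]
  exact ENNReal.toReal_nonneg

end Limit

/-- `K` is the limit of the reproducing kernels of charge `c` along every edge sequence. -/
def IsEdgeLimit (S c : ℝ) (K : ℂ → ℂ → ℂ) : Prop :=
  ∀ ⦃n : ℕ → ℕ⦄ ⦃b : ℕ → ℝ⦄ ⦃L : ℕ → ℂ → ℂ → ℂ⦄, EdgeSeq S n b →
    (∀ k, IsReproducing c (n k) (b k) (L k)) →
    ∀ z w, Tendsto (fun k => L k z w) atTop (𝓝 (K z w))

section EdgeSeq

variable {S c : ℝ} {n : ℕ → ℕ} {b : ℕ → ℝ} {L : ℕ → ℂ → ℂ → ℂ}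

lemma EdgeSeq.exists_kernel_limit (h : EdgeSeq S n b) (hc : -1 < c)
    (hL : ∀ k, IsReproducing c (n k) (b k) (L k)) :
    ∃ K : ℂ → ℂ → ℂ, ∀ z w, Tendsto (fun k => L k z w) atTop (𝓝 (K z w)) := by
  obtain ⟨L₀, hL₀, -⟩ := exists_tendsto_sumKernel_shiftedMonomial h
  exact EdgeRecursion.exists_kernel_limit hc (by norm_num) h.tendsto_atTop
    (fun k => isOrthonormalPolys_shiftedMonomial (b k)) hL₀ hL

-- Regularising the charge-zero limit raises its charge above `c` without making it vanish at `0`.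
lemma EdgeSeq.kernel_limit_zero_ne_zero (h : EdgeSeq S n b) (hc : -1 < c)
    (hL : ∀ k, IsReproducing c (n k) (b k) (L k)) {K : ℂ → ℂ → ℂ}
    (hK : Tendsto (fun k => L k 0 0) atTop (𝓝 (K 0 0))) : K 0 0 ≠ 0 := by
  obtain ⟨L₀, hL₀, hL₀0⟩ := exists_tendsto_sumKernel_shiftedMonomial h
  have hlim : IsWeightedPolyLimit n b 0 fun z => L₀ z 0 :=
    isWeightedPolyLimit_of_isReproducing (by norm_num)
      (fun k => (isOrthonormalPolys_shiftedMonomial (b k)).isReproducing (by norm_num) (n k))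
      fun z => hL₀ z 0
  obtain ⟨j, hj⟩ := exists_nat_ge c
  obtain ⟨f, hf, hf0⟩ :=
    exists_isWeightedPolyLimit_apply_zero_ne_zero (by norm_num) h.tendsto_atTop hlim hL₀0 j
  exact kernel_limit_ne_zero hc hL hK (hf.mono hc (by rwa [zero_add])) hf0

lemma exists_isReproducing (hc : -1 < c) (n : ℕ) (b : ℝ) : ∃ L, IsReproducing c n b L := by
  obtain ⟨p, hp⟩ := exists_isOrthonormalPolys hc b
  exact ⟨_, hp.isReproducing hc n⟩

-- Interlacing an edge sequence with the standard one forces both limits to agree.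
lemma exists_isEdgeLimit (hc : -1 < c) (S : ℝ) : ∃ K, IsEdgeLimit S c K := by
  choose L₀ hL₀ using fun N => exists_isReproducing hc N (edgeShift S N)
  obtain ⟨K, hK⟩ := (edgeSeq_edgeShift S).exists_kernel_limit hc hL₀
  refine ⟨K, fun n b L h hL z w => ?_⟩
  obtain ⟨K₁, hK₁⟩ := h.exists_kernel_limit hc hL
  obtain ⟨K₂, hK₂⟩ := ((edgeSeq_edgeShift S).interlace h).exists_kernel_limit hc
    (L := fun m => if Even m then L₀ (m / 2) else L (m / 2)) fun m => by
      split_ifs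
      exacts [hL₀ _, hL _]
  have hmul : Tendsto (fun k : ℕ => 2 * k) atTop atTop := tendsto_id.const_mul_atTop' two_pos
  have heven : K z w = K₂ z w := tendsto_nhds_unique (hK z w)
    (((hK₂ z w).comp hmul).congr fun k => by simp)
  have hodd : K₁ z w = K₂ z w := tendsto_nhds_unique (hK₁ z w)
    (((hK₂ z w).comp ((tendsto_add_atTop_nat 1).comp hmul)).congr fun k => by
      have hdiv : (2 * k + 1) / 2 = k := by omega
      simp [hdiv])
  rw [heven, ← hodd]
  exact hK₁ z w

end EdgeSeq

lemma IsWeightedPoly.exists_eq_id_mul {n : ℕ} {b : ℝ} {f : ℂ → ℂ}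
    (hf : IsWeightedPoly (n + 1) b f) (h0 : f 0 = 0) :
    ∃ g, IsWeightedPoly n b g ∧ ∀ z, f z = z * g z := by
  obtain ⟨p, hp, hfp⟩ := hf
  have hroot : p.eval 0 = 0 := by simpa [hfp] using h0
  obtain ⟨q, rfl⟩ : X ∣ p := X_dvd_iff.2 (by rwa [coeff_zero_eq_eval_zero])
  refine ⟨fun z => q.eval z * Complex.exp (b * z), ⟨q, ?_, fun z => rfl⟩, fun z => ?_⟩
  · rw [degree_mul, degree_X, add_comm, Nat.cast_add_one] at hp
    exact lt_of_add_lt_add_right hp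
  · rw [hfp, eval_mul, eval_X, mul_assoc]

lemma IsWeightedPoly.id_mul {n : ℕ} {b : ℝ} {f : ℂ → ℂ} (hf : IsWeightedPoly n b f) :
    IsWeightedPoly (n + 1) b fun z => z * f z := by
  obtain ⟨p, hp, hfp⟩ := hf
  refine ⟨X * p, ?_, fun z => by simp only [hfp, eval_mul, eval_X, mul_assoc]⟩
  rw [degree_mul, degree_X, add_comm, Nat.cast_add_one]
  exact WithBot.add_lt_add_right WithBot.one_ne_bot hp

lemma IsWeightedPoly.sub_mul_const {n : ℕ} {b : ℝ} {f g : ℂ → ℂ} (hf : IsWeightedPoly n b f)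
    (hg : IsWeightedPoly n b g) (a : ℂ) : IsWeightedPoly n b fun z => f z - g z * a := by
  obtain ⟨p, hp, hfp⟩ := hf
  obtain ⟨q, hq, hgq⟩ := hg
  refine ⟨p - a • q, ?_, fun z => ?_⟩
  · exact mem_degreeLT.1 (Submodule.sub_mem _ (mem_degreeLT.2 hp)
      (Submodule.smul_mem _ _ (mem_degreeLT.2 hq)))
  · simp only [hfp, hgq, eval_sub, eval_smul, smul_eq_mul]
    ring

lemma IsReproducing.integral_mul_conj_sub {c : ℝ} (hc : -1 < c) {n : ℕ} {b : ℝ}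
    {L : ℂ → ℂ → ℂ} (hL : IsReproducing c n b L) {f : ℂ → ℂ} (hf : IsWeightedPoly n b f)
    (u w a : ℂ) :
    ∫ ζ, f ζ * conj (L ζ w - L ζ u * a) ∂fockMeasure c = f w - conj a * f u := by
  have hint : ∀ v, Integrable (fun ζ => f ζ * conj (L ζ v)) (fockMeasure c) := fun v =>
    (hL.mem v).integrable_mul_conj hc hf.differentiable.continuous (hf.energy_ne_top hc)
  have hexpand : ∀ ζ, f ζ * conj (L ζ w - L ζ u * a) =
      f ζ * conj (L ζ w) - conj a * (f ζ * conj (L ζ u)) := fun ζ => by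
    rw [map_sub, map_mul]
    ring
  simp_rw [hexpand]
  rw [integral_sub (hint w) ((hint u).const_mul _), integral_const_mul, hL.eval _ hf w,
    hL.eval _ hf u]

-- `L(·, w) - L(·, 0) L(0, w) / L(0, 0)` vanishes at `0`, hence equals `ζ ↦ ζ H(ζ)`, and `H`
-- represents the functional `f ↦ w f(w)` with respect to the measure of charge `c + 1`.
lemma IsReproducing.mul_conj_mul_eq {c : ℝ} (hc : -1 < c) {n : ℕ} {b : ℝ} {L L' : ℂ → ℂ → ℂ}
    (hL : IsReproducing c (n + 1) b L) (hL' : IsReproducing (c + 1) n b L') (h0 : L 0 0 ≠ 0)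
    (z w : ℂ) : z * conj w * L' z w = L z w - L z 0 * (L 0 w / L 0 0) := by
  obtain ⟨H, hH, hGH⟩ := ((hL.mem w).sub_mul_const (hL.mem 0)
    (L 0 w / L 0 0)).exists_eq_id_mul (by field_simp; ring)
  have hpair : ∀ f, IsWeightedPoly n b f →
      ∫ ζ, f ζ * conj (H ζ) ∂fockMeasure (c + 1) = w * f w := fun f hf => by
    rw [integral_fockMeasure_add_one]
    simp_rw [← hGH]
    rw [hL.integral_mul_conj_sub hc hf.id_mul, zero_mul, mul_zero, sub_zero]
  have hHz : conj (w * L' w z) = H z := by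
    rw [← hpair _ (hL'.mem z), conj_integral_mul_conj, hL'.eval H hH z]
  rw [hGH z, ← hHz, map_mul, hL'.conj_symm z w]
  ring

namespace IsEdgeLimit

variable {S c : ℝ} {K : ℂ → ℂ → ℂ}

lemma exists_isReproducing_tendsto (hK : IsEdgeLimit S c K) (hc : -1 < c) :
    ∃ L : ℕ → ℂ → ℂ → ℂ, (∀ N, IsReproducing c N (edgeShift S N) (L N)) ∧
      ∀ z w, Tendsto (fun N => L N z w) atTop (𝓝 (K z w)) := by
  choose L hL using fun N => exists_isReproducing hc N (edgeShift S N)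
  exact ⟨L, hL, hK (edgeSeq_edgeShift S) hL⟩

lemma apply_zero_ne_zero (hK : IsEdgeLimit S c K) (hc : -1 < c) : K 0 0 ≠ 0 := by
  obtain ⟨L, hL, hlim⟩ := hK.exists_isReproducing_tendsto hc
  exact (edgeSeq_edgeShift S).kernel_limit_zero_ne_zero hc hL (hlim 0 0)

lemma continuous (hK : IsEdgeLimit S c K) (hc : -1 < c) :
    Continuous fun q : ℂ × ℂ => K q.1 q.2 := by
  obtain ⟨L, hL, hlim⟩ := hK.exists_isReproducing_tendsto hc
  exact continuous_kernel_limit hc hL hlim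

lemma conj_symm (hK : IsEdgeLimit S c K) (hc : -1 < c) (z w : ℂ) : conj (K w z) = K z w := by
  obtain ⟨L, hL, hlim⟩ := hK.exists_isReproducing_tendsto hc
  exact kernel_limit_conj_symm hL hlim z w

lemma apply_self (hK : IsEdgeLimit S c K) (hc : -1 < c) (z : ℂ) : ((K z z).re : ℂ) = K z z :=
  Complex.conj_eq_iff_re.1 (hK.conj_symm hc z z)

lemma re_apply_zero_pos (hK : IsEdgeLimit S c K) (hc : -1 < c) : 0 < (K 0 0).re := by
  obtain ⟨L, hL, hlim⟩ := hK.exists_isReproducing_tendsto hc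
  refine (kernel_limit_self_re_nonneg hL hlim 0).lt_of_ne' fun h => hK.apply_zero_ne_zero hc ?_
  rw [← hK.apply_self hc, h, Complex.ofReal_zero]

lemma mul_conj_mul_eq {K' : ℂ → ℂ → ℂ} (hK : IsEdgeLimit S c K)
    (hK' : IsEdgeLimit S (c + 1) K') (hc : -1 < c) (z w : ℂ) :
    z * conj w * K' z w = K z w - K z 0 * (K 0 w / K 0 0) := by
  have h0 := hK.apply_zero_ne_zero hc
  choose L hL using fun N => exists_isReproducing hc (N + 1) (edgeShift S N)
  obtain ⟨L', hL', h'⟩ := hK'.exists_isReproducing_tendsto (by linarith)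
  have h := hK (edgeSeq_succ_edgeShift S) hL
  refine tendsto_nhds_unique ((h' z w).const_mul _)
    (((h z w).sub ((h z 0).mul ((h 0 w).div (h 0 0) h0))).congr' ?_)
  filter_upwards [(h 0 0).eventually_ne h0] with N hN
  exact ((hL N).mul_conj_mul_eq hc (hL' N) hN z w).symm

lemma sq_norm_mul_re_eq {K' : ℂ → ℂ → ℂ} (hK : IsEdgeLimit S c K)
    (hK' : IsEdgeLimit S (c + 1) K') (hc : -1 < c) (z : ℂ) :
    ‖z‖ ^ 2 * (K' z z).re = (K z z).re - ‖K 0 z‖ ^ 2 / (K 0 0).re := by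
  have h := hK.mul_conj_mul_eq hK' hc z z
  rw [Complex.mul_conj', mul_div_assoc', ← hK.conj_symm hc z 0, Complex.conj_mul',
    ← hK.apply_self hc 0, ← hK.apply_self hc z, ← hK'.apply_self (by linarith) z] at h
  exact_mod_cast h

lemma eventually_re_apply_self_pos (hK : IsEdgeLimit S c K) (hc : -1 < c) :
    ∀ᶠ w in 𝓝 (0 : ℂ), 0 < (K w w).re :=
  ((Complex.continuous_re.comp ((hK.continuous hc).comp
    (continuous_id.prodMk continuous_id))).tendsto 0).eventually
    (lt_mem_nhds (hK.re_apply_zero_pos hc))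

end IsEdgeLimit

/-! ### The rescaled kernels -/

/-- The polynomial `s^{-(c+1)} p(z / s)`. For `s = √N` it is orthonormal in the rescaled variable
`z = √N ζ`: the factor makes up for the Jacobian and for `|ζ|^{2c}`. -/
def rescale (c s : ℝ) (p : ℂ[X]) : ℂ[X] :=
  C ((s ^ (-(c + 1)) : ℝ) : ℂ) * p.comp (C ((s⁻¹ : ℝ) : ℂ) * X)

lemma eval_rescale (c s : ℝ) (p : ℂ[X]) (z : ℂ) :
    (rescale c s p).eval z = ((s ^ (-(c + 1)) : ℝ) : ℂ) * p.eval (z / (s : ℂ)) := by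
  simp only [rescale, eval_mul, eval_C, eval_comp, eval_X, Complex.ofReal_inv]
  rw [div_eq_inv_mul]

lemma rescale_rescale_inv (c : ℝ) {s : ℝ} (hs : 0 < s) (p : ℂ[X]) :
    rescale c s (rescale c s⁻¹ p) = p := by
  refine Polynomial.funext fun z => ?_
  have hs0 : (s : ℂ) ≠ 0 := by exact_mod_cast hs.ne'
  have h : s ^ (-(c + 1)) * s⁻¹ ^ (-(c + 1)) = 1 := by
    rw [← Real.mul_rpow hs.le (inv_pos.2 hs).le, mul_inv_cancel₀ hs.ne', Real.one_rpow]
  rw [eval_rescale, eval_rescale, ← mul_assoc, ← Complex.ofReal_mul, h, Complex.ofReal_one,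
    one_mul, Complex.ofReal_inv, div_inv_eq_mul, div_mul_cancel₀ _ hs0]

lemma degree_rescale (c : ℝ) {s : ℝ} (hs : 0 < s) (p : ℂ[X]) :
    (rescale c s p).degree = p.degree := by
  have hs0 : ((s⁻¹ : ℝ) : ℂ) ≠ 0 := by exact_mod_cast (inv_pos.2 hs).ne'
  have hc0 : ((s ^ (-(c + 1)) : ℝ) : ℂ) ≠ 0 := by
    exact_mod_cast (Real.rpow_pos_of_pos hs _).ne'
  rw [rescale, degree_C_mul hc0, degree_comp (by rw [degree_C_mul_X hs0]; exact one_pos),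
    degree_C_mul_X hs0, mul_one]

lemma sqrt_natCast_pos {N : ℕ} (hN : 1 ≤ N) : 0 < √(N : ℝ) := Real.sqrt_pos.2 (by exact_mod_cast hN)

lemma natCast_mul_Q_div_sqrt (a : ℝ) {N : ℕ} (hN : 1 ≤ N) (z : ℂ) :
    N * Q a (z / (√N : ℝ)) = Q (√N * a) z := by
  have hs : ((√N : ℝ) : ℂ) ≠ 0 := by exact_mod_cast (sqrt_natCast_pos hN).ne'
  have h : z - (√N * a : ℝ) = (√N : ℝ) * (z / (√N : ℝ) - a) := by
    rw [mul_sub, mul_div_cancel₀ _ hs, Complex.ofReal_mul]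
  rw [Q, Q, h, norm_mul, mul_pow, Complex.norm_real, Real.norm_of_nonneg (Real.sqrt_nonneg _),
    Real.sq_sqrt N.cast_nonneg]

lemma sqrt_rpow_neg_add_one_sq (c : ℝ) {N : ℕ} (hN : 1 ≤ N) :
    (√(N : ℝ) ^ (-(c + 1))) ^ 2 = (N : ℝ)⁻¹ * (√(N : ℝ) ^ (-c)) ^ 2 := by
  rw [neg_add, Real.rpow_add (sqrt_natCast_pos hN), Real.rpow_neg_one, mul_pow, inv_pow,
    Real.sq_sqrt N.cast_nonneg, mul_comm]

lemma weight_div_sqrt (c a : ℝ) {N : ℕ} (hN : 1 ≤ N) (z : ℂ) :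
    (√(N : ℝ) ^ (-(c + 1))) ^ 2 * (‖z‖ ^ (2 * c) * Real.exp (-((1 : ℕ) : ℝ) * Q (√N * a) z)) =
      (N : ℝ)⁻¹ * (‖z / (√N : ℝ)‖ ^ (2 * c) * Real.exp (-(N : ℝ) * Q a (z / (√N : ℝ)))) := by
  have hs := sqrt_natCast_pos hN
  have hpow : ‖z / (√N : ℝ)‖ ^ (2 * c) = ‖z‖ ^ (2 * c) * (√(N : ℝ) ^ (-c)) ^ 2 := by
    rw [norm_div, Complex.norm_real, Real.norm_of_nonneg hs.le,
      Real.div_rpow (norm_nonneg z) hs.le, ← Real.rpow_mul_natCast hs.le, div_eq_mul_inv,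
      ← Real.rpow_neg hs.le]
    push_cast
    ring_nf
  rw [hpow, sqrt_rpow_neg_add_one_sq c hN, Nat.cast_one, neg_one_mul, neg_mul,
    natCast_mul_Q_div_sqrt a hN]
  ring

lemma integral_rescale (c a : ℝ) {N : ℕ} (hN : 1 ≤ N) (p q : ℂ[X]) :
    ∫ z, (rescale c (√N) p).eval z * conj ((rescale c (√N) q).eval z) *
        ((‖z‖ ^ (2 * c) * Real.exp (-((1 : ℕ) : ℝ) * Q (√N * a) z) : ℝ) : ℂ) ∂areaMeasure =
      ∫ ζ, p.eval ζ * conj (q.eval ζ) *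
        ((‖ζ‖ ^ (2 * c) * Real.exp (-(N : ℝ) * Q a ζ) : ℝ) : ℂ) ∂areaMeasure := by
  let f : ℂ → ℂ := fun ζ => p.eval ζ * conj (q.eval ζ) *
    ((‖ζ‖ ^ (2 * c) * Real.exp (-(N : ℝ) * Q a ζ) : ℝ) : ℂ)
  have hpt : ∀ z, (rescale c (√N) p).eval z * conj ((rescale c (√N) q).eval z) *
      ((‖z‖ ^ (2 * c) * Real.exp (-((1 : ℕ) : ℝ) * Q (√N * a) z) : ℝ) : ℂ) =
      ((N : ℝ)⁻¹ : ℝ) * f ((√(N : ℝ))⁻¹ • z) := fun z => by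
    have hz : (√(N : ℝ))⁻¹ • z = z / (√N : ℝ) := by
      rw [Complex.real_smul, div_eq_inv_mul, Complex.ofReal_inv]
    have hw := congrArg Complex.ofReal (weight_div_sqrt c a hN z)
    rw [Complex.ofReal_mul, Complex.ofReal_mul (N : ℝ)⁻¹, Complex.ofReal_pow] at hw
    simp only [f, hz, eval_rescale, map_mul, Complex.conj_ofReal]
    linear_combination p.eval (z / (√N : ℝ)) * conj (q.eval (z / (√N : ℝ))) * hw
  have hN0 : (N : ℂ) ≠ 0 := by exact_mod_cast (Nat.one_le_iff_ne_zero.1 hN)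
  change _ = ∫ ζ, f ζ ∂areaMeasure
  simp_rw [hpt]
  rw [integral_const_mul, integral_areaMeasure, integral_areaMeasure,
    Measure.integral_comp_smul volume f, Complex.finrank_real_complex, inv_pow, inv_inv,
    Real.sq_sqrt N.cast_nonneg, Nat.abs_cast, Complex.real_smul]
  push_cast
  field_simp

lemma IsOrthonormalPolys.rescale {c a : ℝ} {N : ℕ} (hN : 1 ≤ N) {p : ℕ → ℂ[X]}
    (hp : IsOrthonormalPolys c a N p) :
    IsOrthonormalPolys c (√N * a) 1 fun j => rescale c (√N) (p j) :=
  ⟨fun j => by rw [degree_rescale c (sqrt_natCast_pos hN), hp.1 j],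
    fun j k => by rw [integral_rescale c a hN, hp.2 j k]⟩

lemma exists_isOrthonormalPolys_nat {c : ℝ} (hc : -1 < c) (a : ℝ) {N : ℕ} (hN : 1 ≤ N) :
    ∃ p, IsOrthonormalPolys c a N p := by
  have hs := sqrt_natCast_pos hN
  obtain ⟨p, hp⟩ := exists_isOrthonormalPolys hc (√N * a)
  refine ⟨fun j => EdgeRecursion.rescale c (√N)⁻¹ (p j), fun j => ?_, fun j k => ?_⟩
  · rw [degree_rescale c (inv_pos.2 hs), hp.1 j]
  · simp_rw [← integral_rescale c a hN, rescale_rescale_inv c hs]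
    exact hp.2 j k

lemma isReproducing_zero (c b : ℝ) : IsReproducing c 0 b fun _ _ => 0 where
  mem _ := ⟨0, by simp, by simp⟩
  eval := by
    rintro f ⟨p, hp, hf⟩ w
    rw [Nat.cast_zero, Nat.WithBot.lt_zero_iff, degree_eq_bot] at hp
    simp [hf, hp]

lemma isReproducing_sumKernel_rescale {S c : ℝ} (hc : -1 < c) {N : ℕ} {p : ℕ → ℂ[X]}
    (hp : 1 ≤ N → IsOrthonormalPolys c (critA S N) N p) :
    IsReproducing c N (edgeShift S N)
      (sumKernel (√N * critA S N) N fun j => rescale c (√N) (p j)) := by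
  rcases N.eq_zero_or_pos with rfl | hN
  · exact isReproducing_zero c _
  · have hshift : √N * critA S N = edgeShift S N := by
      have := sqrt_natCast_pos hN
      rw [critA, edgeShift]
      field_simp
    rw [hshift]
    exact (hshift ▸ (hp hN).rescale hN).isReproducing hc N

lemma ofReal_mul_cpow {s : ℝ} (hs : 0 < s) (z c : ℂ) : (s * z) ^ c = s ^ c * z ^ c := by
  have hs0 : (s : ℂ) ≠ 0 := by exact_mod_cast hs.ne'
  rcases eq_or_ne z 0 with rfl | hz
  · rcases eq_or_ne c 0 with rfl | hc
    · simp
    · simp [Complex.zero_cpow hc]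
  · rw [Complex.cpow_def_of_ne_zero (mul_ne_zero hs0 hz), Complex.log_ofReal_mul hs hz,
      Complex.ofReal_log hs.le, add_mul, Complex.exp_add, Complex.cpow_def_of_ne_zero hs0,
      Complex.cpow_def_of_ne_zero hz]

lemma div_ofReal_cpow (c : ℝ) {s : ℝ} (hs : 0 < s) (z : ℂ) :
    (z / (s : ℂ)) ^ (c : ℂ) = ((s ^ (-c) : ℝ) : ℂ) * z ^ (c : ℂ) := by
  rw [div_eq_inv_mul, ← Complex.ofReal_inv, ofReal_mul_cpow (inv_pos.2 hs),
    ← Complex.ofReal_cpow (inv_pos.2 hs).le, Real.inv_rpow hs.le, ← Real.rpow_neg hs.le]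

/-- The factor `z^c conj (w^c) e^{-(|z|² + |w|²)/2}` of the kernels of charge `c`. -/
def prefactor (c : ℝ) (z w : ℂ) : ℂ :=
  z ^ (c : ℂ) * conj (w ^ (c : ℂ)) * ((Real.exp (-(‖z‖ ^ 2 + ‖w‖ ^ 2) / 2) : ℝ) : ℂ)

/-- The unimodular factor `e^{ib Im z}`, by which `e^{-|z - b|²/2}` differs from a multiple of the
holomorphic function `e^{bz}`. -/
def phase (b : ℝ) (z : ℂ) : ℂ := Complex.exp (((b * z.im : ℝ) : ℂ) * Complex.I)

lemma norm_phase (b : ℝ) (z : ℂ) : ‖phase b z‖ = 1 := Complex.norm_exp_ofReal_mul_I _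

lemma phase_mul_exp (b : ℝ) (z : ℂ) :
    phase b z * ((Real.exp (-(1 / 2) * Q b z) : ℝ) : ℂ) =
      ((Real.exp (-‖z‖ ^ 2 / 2) : ℝ) : ℂ) * Complex.exp (b * z - b ^ 2 / 2) := by
  rw [phase, Q_eq, Complex.ofReal_exp, Complex.ofReal_exp, ← Complex.exp_add, ← Complex.exp_add]
  congr 1
  push_cast
  linear_combination (b : ℂ) * Complex.re_add_im z

lemma rescaledKernel_eq (c a : ℝ) {N : ℕ} (hN : 1 ≤ N) (p : ℕ → ℂ[X]) (z w : ℂ) :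
    rescaledKernel c a N p z w = z ^ (c : ℂ) * conj (w ^ (c : ℂ)) *
      (((Real.exp (-(1 / 2) * Q (√N * a) z) : ℝ) : ℂ) *
        ((Real.exp (-(1 / 2) * Q (√N * a) w) : ℝ) : ℂ)) *
      ∑ j ∈ Finset.range N,
        (rescale c (√N) (p j)).eval z * conj ((rescale c (√N) (p j)).eval w) := by
  have hs := sqrt_natCast_pos hN
  have hexp : Real.exp (-((N : ℝ) / 2) * (Q a (z / (√N : ℝ)) + Q a (w / (√N : ℝ)))) =
      Real.exp (-(1 / 2) * Q (√N * a) z) * Real.exp (-(1 / 2) * Q (√N * a) w) := by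
    rw [← Real.exp_add, ← natCast_mul_Q_div_sqrt a hN, ← natCast_mul_Q_div_sqrt a hN]
    ring_nf
  have hpow := congrArg Complex.ofReal (sqrt_rpow_neg_add_one_sq c hN)
  rw [Complex.ofReal_mul, Complex.ofReal_pow, Complex.ofReal_pow, Complex.ofReal_inv,
    Complex.ofReal_natCast] at hpow
  have hsum : ∑ j ∈ Finset.range N,
      (rescale c (√N) (p j)).eval z * conj ((rescale c (√N) (p j)).eval w) =
      (((√(N : ℝ) ^ (-(c + 1)) : ℝ) : ℂ)) ^ 2 *
        ∑ j ∈ Finset.range N, (p j).eval (z / (√N : ℝ)) * conj ((p j).eval (w / (√N : ℝ))) := by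
    rw [Finset.mul_sum]
    refine Finset.sum_congr rfl fun j _ => ?_
    rw [eval_rescale, eval_rescale, map_mul, Complex.conj_ofReal]
    ring
  rw [rescaledKernel, kernel, hsum, hpow, div_ofReal_cpow c hs, div_ofReal_cpow c hs, hexp,
    map_mul, Complex.conj_ofReal, Complex.ofReal_mul]
  ring

lemma phase_mul_rescaledKernel (c a : ℝ) (N : ℕ) (p : ℕ → ℂ[X]) (z w : ℂ) :
    phase (√N * a) z * conj (phase (√N * a) w) * rescaledKernel c a N p z w =
      prefactor c z w * sumKernel (√N * a) N (fun j => rescale c (√N) (p j)) z w := by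
  rcases N.eq_zero_or_pos with rfl | hN
  · simp [rescaledKernel, sumKernel]
  set b := √N * a
  have hz := phase_mul_exp b z
  have hw := congrArg conj (phase_mul_exp b w)
  rw [map_mul, map_mul, Complex.conj_ofReal, Complex.conj_ofReal] at hw
  have hexp : Real.exp (-(‖z‖ ^ 2 + ‖w‖ ^ 2) / 2) =
      Real.exp (-‖z‖ ^ 2 / 2) * Real.exp (-‖w‖ ^ 2 / 2) := by
    rw [← Real.exp_add]
    ring_nf
  rw [rescaledKernel_eq c a hN, prefactor, sumKernel, hexp, Complex.ofReal_mul, Finset.mul_sum,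
    Finset.mul_sum, Finset.mul_sum]
  refine Finset.sum_congr rfl fun j _ => ?_
  set P := (rescale c (√N) (p j)).eval z * conj ((rescale c (√N) (p j)).eval w)
  rw [expPoly, expPoly, map_mul]
  linear_combination z ^ (c : ℂ) * conj (w ^ (c : ℂ)) * P * (conj (phase b w) *
      ((Real.exp (-(1 / 2) * Q b w) : ℝ) : ℂ) * hz +
      ((Real.exp (-‖z‖ ^ 2 / 2) : ℝ) : ℂ) * Complex.exp (b * z - b ^ 2 / 2) * hw)

lemma norm_prefactor (c : ℝ) (z w : ℂ) : ‖prefactor c z w‖ =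
    ‖z‖ ^ c * ‖w‖ ^ c * Real.exp (-(‖z‖ ^ 2 + ‖w‖ ^ 2) / 2) := by
  rw [prefactor, norm_mul, norm_mul, Complex.norm_conj, Complex.norm_cpow_real,
    Complex.norm_cpow_real, Complex.norm_real, Real.norm_of_nonneg (Real.exp_pos _).le]

lemma fockWeight_eq_sq (c : ℝ) (z : ℂ) :
    fockWeight c z = (‖z‖ ^ c * Real.exp (-‖z‖ ^ 2 / 2)) ^ 2 := by
  rw [fockWeight, mul_pow, ← Real.rpow_mul_natCast (norm_nonneg z), ← Real.exp_nat_mul]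
  push_cast
  ring_nf

lemma fockWeight_pos {c : ℝ} {z : ℂ} (h : z ≠ 0 ∨ c = 0) : 0 < fockWeight c z := by
  unfold fockWeight
  rcases h with hz | rfl
  · positivity
  · simp [Real.exp_pos]

lemma sq_norm_prefactor (c : ℝ) (z w : ℂ) :
    ‖prefactor c z w‖ ^ 2 = fockWeight c z * fockWeight c w := by
  rw [norm_prefactor, fockWeight_eq_sq, fockWeight_eq_sq, neg_add, add_div, Real.exp_add]
  ring

lemma prefactor_self (c : ℝ) (z : ℂ) : prefactor c z z = (fockWeight c z : ℂ) := by
  rw [prefactor, Complex.mul_conj', Complex.norm_cpow_real, fockWeight_eq_sq, mul_pow,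
    ← Real.exp_nat_mul]
  push_cast
  ring_nf

lemma exists_norm_prefactor_le {c : ℝ} {C : Set (ℂ × ℂ)} (hC : IsCompact C)
    (hCc : C ⊆ finiteDomain c ×ˢ finiteDomain c) : ∃ B : ℝ, ∀ q ∈ C, ‖prefactor c q.1 q.2‖ ≤ B := by
  have h : ContinuousOn (fun q : ℂ × ℂ => ‖prefactor c q.1 q.2‖) C := by
    simp_rw [norm_prefactor]
    refine ((ContinuousOn.rpow_const (by fun_prop) fun q hq => ?_).mul
      (ContinuousOn.rpow_const (by fun_prop) fun q hq => ?_)).mul (by fun_prop)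
    · exact (hCc hq).1.imp_left norm_ne_zero_iff.2
    · exact (hCc hq).2.imp_left norm_ne_zero_iff.2
  obtain ⟨B, hB⟩ := (hC.image_of_continuousOn h).bddAbove
  exact ⟨B, fun q hq => hB ⟨q, hq, rfl⟩⟩

lemma tendstoUniformlyOn_mul_left {ι α 𝕜 : Type*} [NormedRing 𝕜] {F : ι → α → 𝕜} {f g : α → 𝕜}
    {l : Filter ι} {s : Set α} (hF : TendstoUniformlyOn F f l s) (hg : ∃ B, ∀ x ∈ s, ‖g x‖ ≤ B) :
    TendstoUniformlyOn (fun i x => g x * F i x) (fun x => g x * f x) l s := by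
  obtain ⟨B, hB⟩ := hg
  rw [Metric.tendstoUniformlyOn_iff] at hF ⊢
  intro ε hε
  filter_upwards [hF (ε / (|B| + 1)) (by positivity)] with i hi x hx
  rw [dist_eq_norm, ← mul_sub]
  calc ‖g x * (f x - F i x)‖ ≤ (|B| + 1) * ‖f x - F i x‖ :=
        (norm_mul_le _ _).trans (by gcongr; linarith [hB x hx, le_abs_self B])
    _ < (|B| + 1) * (ε / (|B| + 1)) := by gcongr; exact dist_eq_norm (f x) _ ▸ hi x hx
    _ = ε := by field_simp

section EdgeKernel

variable {S c : ℝ} {K₀ : ℂ → ℂ → ℂ}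

lemma isEdgeKernel_of_isEdgeLimit (hc : -1 < c) (hK₀ : IsEdgeLimit S c K₀) :
    IsEdgeKernel S c fun z w => prefactor c z w * K₀ z w := by
  choose! p hp using fun (N : ℕ) (hN : 1 ≤ N) => exists_isOrthonormalPolys_nat hc (critA S N) hN
  have hL := fun N => isReproducing_sumKernel_rescale hc (hp N)
  have hunif := tendstoLocallyUniformly_kernel hc hL (hK₀ (edgeSeq_edgeShift S) hL)
  refine ⟨p, hp, fun N => phase (√N * critA S N), fun N z => norm_phase _ z, fun C hC hCc => ?_⟩
  simp_rw [phase_mul_rescaledKernel]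
  exact tendstoUniformlyOn_mul_left
    ((tendstoLocallyUniformlyOn_iff_tendstoUniformlyOn_of_compact hC).1
      hunif.tendstoLocallyUniformlyOn) (exists_norm_prefactor_le hC hCc)

lemma tendsto_phase_mul_rescaledKernel (hc : -1 < c) (hK₀ : IsEdgeLimit S c K₀)
    {p : ℕ → ℕ → ℂ[X]} (hp : ∀ N, 1 ≤ N → IsOrthonormalPolys c (critA S N) N (p N)) (z w : ℂ) :
    Tendsto (fun N : ℕ => phase (√N * critA S N) z * conj (phase (√N * critA S N) w) *
      rescaledKernel c (critA S N) N (p N) z w) atTop (𝓝 (prefactor c z w * K₀ z w)) := by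
  simp_rw [phase_mul_rescaledKernel]
  exact (hK₀ (edgeSeq_edgeShift S) (fun N => isReproducing_sumKernel_rescale hc (hp N))
    z w).const_mul (prefactor c z w)

namespace IsEdgeKernel

variable {K K' : ℂ → ℂ → ℂ}

lemma sq_norm_eq (hK : IsEdgeKernel S c K) (hc : -1 < c) (hK₀ : IsEdgeLimit S c K₀) {z w : ℂ}
    (hz : z ∈ finiteDomain c) (hw : w ∈ finiteDomain c) :
    ‖K z w‖ ^ 2 = fockWeight c z * fockWeight c w * ‖K₀ z w‖ ^ 2 := by
  obtain ⟨p, hp, g, hg, hlim⟩ := hK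
  have hK : Tendsto _ atTop (𝓝 (K z w)) :=
    (hlim {(z, w)} isCompact_singleton (by simpa using ⟨hz, hw⟩)).tendsto_at rfl
  rw [← sq_norm_prefactor, ← mul_pow, ← norm_mul]
  congr 1
  refine tendsto_nhds_unique hK.norm
    ((tendsto_phase_mul_rescaledKernel hc hK₀ hp z w).norm.congr fun N => ?_)
  simp only [norm_mul, Complex.norm_conj, norm_phase, hg]

lemma onePoint_eq (hK : IsEdgeKernel S c K) (hc : -1 < c) (hK₀ : IsEdgeLimit S c K₀) {z : ℂ}
    (hz : z ∈ finiteDomain c) : onePoint K z = fockWeight c z * (K₀ z z).re := by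
  obtain ⟨p, hp, g, hg, hlim⟩ := hK
  have hK : Tendsto _ atTop (𝓝 (K z z)) :=
    (hlim {(z, z)} isCompact_singleton (by simpa using hz)).tendsto_at rfl
  have hone : ∀ u : ℂ, ‖u‖ = 1 → u * conj u = 1 := fun u hu => by simp [Complex.mul_conj', hu]
  rw [onePoint, ← Complex.re_ofReal_mul, ← prefactor_self]
  congr 1
  refine tendsto_nhds_unique hK
    ((tendsto_phase_mul_rescaledKernel hc hK₀ hp z z).congr fun N => ?_)
  rw [hone _ (norm_phase _ _), hone _ (hg _ _)]

lemma eventually_onePoint_pos (hK : IsEdgeKernel S c K) (hc : -1 < c)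
    (hK₀ : IsEdgeLimit S c K₀) : ∀ᶠ w in 𝓝[≠] (0 : ℂ), 0 < onePoint K w := by
  filter_upwards [nhdsWithin_le_nhds (hK₀.eventually_re_apply_self_pos hc),
    self_mem_nhdsWithin] with w hpos hw
  rw [hK.onePoint_eq hc hK₀ (Or.inl hw)]
  exact mul_pos (fockWeight_pos (Or.inl hw)) hpos

lemma sq_norm_div_onePoint (hK : IsEdgeKernel S c K) (hc : -1 < c) (hK₀ : IsEdgeLimit S c K₀)
    {z w : ℂ} (hz : z ∈ finiteDomain c) (hw : w ∈ finiteDomain c) (hw0 : fockWeight c w ≠ 0) :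
    ‖K w z‖ ^ 2 / onePoint K w = fockWeight c z * (‖K₀ w z‖ ^ 2 / (K₀ w w).re) := by
  rw [hK.sq_norm_eq hc hK₀ hw hz, hK.onePoint_eq hc hK₀ hw, mul_assoc, mul_div_mul_left _ _ hw0,
    mul_div_assoc]

lemma tendsto_sq_norm_div_onePoint (hK : IsEdgeKernel S c K) (hc : -1 < c)
    (hK₀ : IsEdgeLimit S c K₀) {z : ℂ} (hz : z ∈ finiteDomain c) :
    Tendsto (fun w => ‖K w z‖ ^ 2 / onePoint K w) (𝓝[≠] 0)
      (𝓝 (fockWeight c z * (‖K₀ 0 z‖ ^ 2 / (K₀ 0 0).re))) := by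
  have hcont := hK₀.continuous hc
  have hnum : Continuous fun w => ‖K₀ w z‖ ^ 2 :=
    (hcont.comp (continuous_id.prodMk continuous_const)).norm.pow 2
  have hden : Continuous fun w => (K₀ w w).re :=
    Complex.continuous_re.comp (hcont.comp (continuous_id.prodMk continuous_id))
  have hlim := ((hnum.tendsto 0).div (hden.tendsto 0)
    (hK₀.re_apply_zero_pos hc).ne').const_mul (fockWeight c z)
  refine (hlim.mono_left nhdsWithin_le_nhds).congr' ?_
  filter_upwards [self_mem_nhdsWithin] with w hw
  exact (hK.sq_norm_div_onePoint hc hK₀ hz (Or.inl hw) (fockWeight_pos (Or.inl hw)).ne').symm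

lemma onePoint_add_one (hK : IsEdgeKernel S c K) (hK' : IsEdgeKernel S (c + 1) K')
    (hc : -1 < c) (hK₀ : IsEdgeLimit S c K₀) {K₁ : ℂ → ℂ → ℂ} (hK₁ : IsEdgeLimit S (c + 1) K₁)
    {z : ℂ} (hz : z ∈ finiteDomain c) :
    onePoint K' z = onePoint K z - fockWeight c z * (‖K₀ 0 z‖ ^ 2 / (K₀ 0 0).re) := by
  have hc' : 0 ≤ c + 1 := by linarith
  have hw : fockWeight (c + 1) z = fockWeight c z * ‖z‖ ^ 2 := by
    rcases eq_or_ne z 0 with rfl | hz0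
    · simp [fockWeight, Real.zero_rpow (show 2 * (c + 1) ≠ 0 by linarith)]
    · rw [fockWeight_add_one c hz0, mul_comm]
  rw [hK'.onePoint_eq (by linarith) hK₁ (Or.inr hc'), hK.onePoint_eq hc hK₀ hz, hw, mul_assoc,
    hK₀.sq_norm_mul_re_eq hK₁ hc z, mul_sub]

end IsEdgeKernel

end EdgeKernel

end EdgeRecursion

end

/-- For all real `S` and `c > -1` the limiting edge kernel exists, and
`R^{c+1}(z) = R^c(z) - |K^c(0,z)|² / R^c(0)`. The quotient is the value at `w = 0` of
`|K^c(w,z)|² / R^c(w)`, that is its limit as `w → 0` (for `c ≠ 0` numerator and denominator carry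
the common factor `|w|^{2c}`); for `c = 0` it is also the literal quotient. -/
theorem proposition1p2 (S c : ℝ) (hc : -1 < c) :
    (∃ K, EdgeRecursion.IsEdgeKernel S c K) ∧
    ∀ K K' : ℂ → ℂ → ℂ,
      EdgeRecursion.IsEdgeKernel S c K → EdgeRecursion.IsEdgeKernel S (c + 1) K' →
      (∀ᶠ w in 𝓝[≠] (0 : ℂ), 0 < EdgeRecursion.onePoint K w) ∧
      (∀ z ∈ EdgeRecursion.finiteDomain c, ∃ B : ℝ,
        Tendsto (fun w : ℂ => ‖K w z‖ ^ 2 / EdgeRecursion.onePoint K w) (𝓝[≠] (0 : ℂ)) (𝓝 B) ∧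
        EdgeRecursion.onePoint K' z = EdgeRecursion.onePoint K z - B) ∧
      (c = 0 → 0 < EdgeRecursion.onePoint K 0 ∧
        ∀ z : ℂ, EdgeRecursion.onePoint K' z =
          EdgeRecursion.onePoint K z - ‖K 0 z‖ ^ 2 / EdgeRecursion.onePoint K 0) := by
  have hc' : -1 < c + 1 := by linarith
  obtain ⟨K₀, hK₀⟩ := EdgeRecursion.exists_isEdgeLimit hc S
  obtain ⟨K₁, hK₁⟩ := EdgeRecursion.exists_isEdgeLimit hc' S
  refine ⟨⟨_, EdgeRecursion.isEdgeKernel_of_isEdgeLimit hc hK₀⟩, fun K K' hK hK' => ?_⟩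
  have hrec := fun z hz => hK.onePoint_add_one (z := z) hK' hc hK₀ hK₁ hz
  refine ⟨hK.eventually_onePoint_pos hc hK₀,
    fun z hz => ⟨_, hK.tendsto_sq_norm_div_onePoint hc hK₀ hz, hrec z hz⟩, ?_⟩
  rintro rfl
  have hmem : ∀ z, z ∈ EdgeRecursion.finiteDomain 0 := fun _ => Or.inr le_rfl
  have hweight : 0 < EdgeRecursion.fockWeight 0 0 := EdgeRecursion.fockWeight_pos (Or.inr rfl)
  refine ⟨?_, fun z => ?_⟩
  · rw [hK.onePoint_eq hc hK₀ (hmem 0)]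
    exact mul_pos hweight (hK₀.re_apply_zero_pos hc)
  · rw [hrec z (hmem z), hK.sq_norm_div_onePoint hc hK₀ (hmem z) (hmem 0) hweight.ne']
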